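/- **Setting.** Let $N\ge 1$ be an integer, $\alpha_1,\alpha_2,\beta,\rho>0$, $r_1,r_2>1$, $r=r_1+r_2$ and $\bar r=2+\frac8N$. Let $H^2(\mathbb R^N)$ be the space of real-valued $u\in L^2(\mathbb R^N)$ whose weak gradient $\nabla u$ and weak Laplacian $\Delta u$ lie in $L^2$, with norm $\|u\|=(\|\Delta u\|_2^2+\|u\|_2^2)^{1/2}$. Put $$S_\rho=\{(u,v)\in H^2(\mathbb R^N)\times H^2(\mathbb R^N):\ \|u\|_2^2+\|v\|_2^2=\rho^2\},$$ $$I(u,v)=\tfrac12\big(\|\Delta u\|_2^2+\|\Delta v\|_2^2\big)-\tfrac{\alpha_1}2\|\nabla u\|_2^2-\tfrac{\alpha_2}2\|\nabla v\|_2^2-\beta\int_{\mathbb R^N}|u|^{r_1}|v|^{r_2}\,dx,\qquad m(\rho)=\inf_{S_\rho}I.$$ Let $C_{N,r}$ be the optimal constant in the Gagliardo–Nirenberg inequality $\|u\|_r\le C\,\|u\|_2^{1-\gamma_r}\|\Delta u\|_2^{\gamma_r}$ for all $u\in H^2(\mathbb R^N)$, where $\gamma_r=\frac{N(r-2)}{4r}$,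 and let $$\mathcal D_1=\Big(\frac{r_1}{r}\Big)^{r_1/2}\Big(\frac{r_2}{r}\Big)^{r_2/2}C_{N,r}^{\,r}.$$ **Theorem.** Assume that either $r<\bar r$, or $r=\bar r$ and $\rho<\big(\frac1{2\mathcal D_1\beta}\big)^{N/8}$. Let $\{(u_n,v_n)\}\subset S_\rho$ be a minimizing sequence of $m(\rho)$, that is, $I(u_n,v_n)\to m(\rho)$. Then one of the following holds: (i) (Vanishing) $\displaystyle\limsup_{n\to\infty}\sup_{y\in\mathbb R^N}\int_{B_1(y)}\big(|u_n|^2+|v_n|^2\big)\,dx=0$. (ii) (Compactness) Up to a subsequence, there exist $(u,v)\in S_\rho$ and a sequence $\{y_n\}\subset\mathbb R^N$ such that $\big(u_n(\cdot-y_n),v_n(\cdot-y_n)\big)\to(u,v)$ in $H^2(\mathbb R^N)\times H^2(\mathbb R^N)$ as $n\to\infty$, and $(u,v)$ is a global minimizer, that is, $I(u,v)=m(\rho)$. -/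

import Mathlib

open MeasureTheory Filter Topology
open scoped ContDiff ENNReal

noncomputable section

namespace MixedDispersion

/-- The Euclidean space `ℝ^N`. -/
abbrev RN (N : ℕ) : Type := EuclideanSpace ℝ (Fin N)

/-- `g` is a weak (distributional) gradient of `u`: `∫ u ∂_e φ = - ∫ ⟨g, e⟩ φ` for every test
function `φ ∈ C_c^∞(ℝ^N)` and every direction `e`. -/
def IsWeakGradient {N : ℕ} (u : RN N → ℝ) (g : RN N → RN N) : Prop :=
  LocallyIntegrable g ∧
    ∀ φ : RN N → ℝ, ContDiff ℝ ∞ φ → HasCompactSupport φ → ∀ e : RN N,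
      ∫ x, u x * fderiv ℝ φ x e = -∫ x, inner ℝ (g x) e * φ x

/-- `w` is a weak (distributional) Laplacian of `u`: `∫ u Δφ = ∫ w φ` for every test function
`φ ∈ C_c^∞(ℝ^N)`. -/
def IsWeakLaplacian {N : ℕ} (u w : RN N → ℝ) : Prop :=
  LocallyIntegrable w ∧
    ∀ φ : RN N → ℝ, ContDiff ℝ ∞ φ → HasCompactSupport φ →
      ∫ x, u x * Laplacian.laplacian φ x = ∫ x, w x * φ x

/-- Weak gradients are unique up to null sets. -/
theorem IsWeakGradient.ae_eq {N : ℕ} {u : RN N → ℝ} {g g' : RN N → RN N}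
    (h : IsWeakGradient u g) (h' : IsWeakGradient u g') : g =ᵐ[volume] g' := by
  have key : ∀ φ : RN N → ℝ, ContDiff ℝ ∞ φ → HasCompactSupport φ →
      ∫ x, φ x • g x = ∫ x, φ x • g' x := by
    intro φ hφ hc
    have hi : Integrable (fun x => φ x • g x) :=
      h.1.integrable_smul_left_of_hasCompactSupport hφ.continuous hc
    have hi' : Integrable (fun x => φ x • g' x) :=
      h'.1.integrable_smul_left_of_hasCompactSupport hφ.continuous hc
    refine ext_inner_left ℝ fun e => ?_
    rw [← integral_inner hi, ← integral_inner hi']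
    have := neg_injective ((h.2 φ hφ hc e).symm.trans (h'.2 φ hφ hc e))
    simpa [real_inner_smul_right, real_inner_comm, mul_comm] using this
  exact ae_eq_of_integral_contDiff_smul_eq h.1 h'.1 key

/-- Weak Laplacians are unique up to null sets. -/
theorem IsWeakLaplacian.ae_eq {N : ℕ} {u w w' : RN N → ℝ}
    (h : IsWeakLaplacian u w) (h' : IsWeakLaplacian u w') : w =ᵐ[volume] w' := by
  refine ae_eq_of_integral_contDiff_smul_eq h.1 h'.1 fun φ hφ hc => ?_
  have := (h.2 φ hφ hc).symm.trans (h'.2 φ hφ hc)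
  simpa [mul_comm] using this

open Classical in
/-- The weak gradient `∇u` (with the value `0` when `u` has none; it is determined up to null
sets). -/
def weakGradient {N : ℕ} (u : RN N → ℝ) : RN N → RN N :=
  if h : ∃ g, IsWeakGradient u g then h.choose else 0

open Classical in
/-- The weak Laplacian `Δu` (with the value `0` when `u` has none; it is determined up to null
sets). -/
def weakLaplacian {N : ℕ} (u : RN N → ℝ) : RN N → ℝ :=
  if h : ∃ w, IsWeakLaplacian u w then h.choose else 0

/-- Membership in `H²(ℝ^N) = {u ∈ L² : ∇u ∈ L², Δu ∈ L²}`, for real-valued functions. -/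
structure MemH2 {N : ℕ} (u : RN N → ℝ) : Prop where
  memLp : MemLp u 2
  gradient : ∃ g, IsWeakGradient u g ∧ MemLp g 2
  laplacian : ∃ w, IsWeakLaplacian u w ∧ MemLp w 2

/-- `weakGradient u` is the `L²` weak gradient of `u ∈ H²`. -/
theorem MemH2.weakGradient_spec {N : ℕ} {u : RN N → ℝ} (hu : MemH2 u) :
    IsWeakGradient u (weakGradient u) ∧ MemLp (weakGradient u) 2 := by
  obtain ⟨g, hg, hg2⟩ := hu.gradient
  have h : ∃ g, IsWeakGradient u g := ⟨g, hg⟩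
  have hs : IsWeakGradient u (weakGradient u) := by
    rw [weakGradient, dif_pos h]; exact h.choose_spec
  exact ⟨hs, hg2.ae_eq (hg.ae_eq hs)⟩

/-- `weakLaplacian u` is the `L²` weak Laplacian of `u ∈ H²`. -/
theorem MemH2.weakLaplacian_spec {N : ℕ} {u : RN N → ℝ} (hu : MemH2 u) :
    IsWeakLaplacian u (weakLaplacian u) ∧ MemLp (weakLaplacian u) 2 := by
  obtain ⟨w, hw, hw2⟩ := hu.laplacian
  have h : ∃ w, IsWeakLaplacian u w := ⟨w, hw⟩
  have hs : IsWeakLaplacian u (weakLaplacian u) := by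
    rw [weakLaplacian, dif_pos h]; exact h.choose_spec
  exact ⟨hs, hw2.ae_eq (hw.ae_eq hs)⟩

/-- The square `‖f‖₂²` of the `L²` norm of `f ∈ L²`. -/
def l2sq {N : ℕ} {F : Type*} [NormedAddCommGroup F] (f : RN N → F) : ℝ :=
  ∫ x, ‖f x‖ ^ 2

/-- The `H²` norm `‖u‖ = (‖Δu‖₂² + ‖u‖₂²)^{1/2}`. -/
def h2Norm {N : ℕ} (u : RN N → ℝ) : ℝ :=
  Real.sqrt (l2sq (weakLaplacian u) + l2sq u)

/-- The energy functional
`I(u,v) = ½(‖Δu‖₂² + ‖Δv‖₂²) - (α₁/2)‖∇u‖₂² - (α₂/2)‖∇v‖₂² - β ∫ |u|^{r₁} |v|^{r₂}`. -/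
def energy {N : ℕ} (α₁ α₂ β r₁ r₂ : ℝ) (u v : RN N → ℝ) : ℝ :=
  (1 / 2) * (l2sq (weakLaplacian u) + l2sq (weakLaplacian v))
    - (α₁ / 2) * l2sq (weakGradient u) - (α₂ / 2) * l2sq (weakGradient v)
    - β * ∫ x, |u x| ^ r₁ * |v x| ^ r₂

/-- The mass constraint `S_ρ = {(u,v) ∈ H² × H² : ‖u‖₂² + ‖v‖₂² = ρ²}`. -/
def massSphere (N : ℕ) (ρ : ℝ) : Set ((RN N → ℝ) × (RN N → ℝ)) :=
  {p | MemH2 p.1 ∧ MemH2 p.2 ∧ l2sq p.1 + l2sq p.2 = ρ ^ 2}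

/-- The infimum `m(ρ) = inf_{S_ρ} I`, in `[-∞, ∞]`. -/
def minEnergy (N : ℕ) (α₁ α₂ β r₁ r₂ ρ : ℝ) : EReal :=
  ⨅ p ∈ massSphere N ρ, (energy α₁ α₂ β r₁ r₂ p.1 p.2 : EReal)

/-- The exponent `γ_p = N(p-2)/(4p)`. -/
def gnExponent (N : ℕ) (p : ℝ) : ℝ := N * (p - 2) / (4 * p)

/-- The optimal constant `C_{N,p}` of the Gagliardo–Nirenberg inequality
`‖u‖_p ≤ C ‖u‖₂^{1-γ_p} ‖Δu‖₂^{γ_p}` for all `u ∈ H²(ℝ^N)`. -/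
def gnConst (N : ℕ) (p : ℝ) : ℝ :=
  sInf {C : ℝ | 0 < C ∧ ∀ u : RN N → ℝ, MemH2 u →
    eLpNorm u (ENNReal.ofReal p) volume ≤
      ENNReal.ofReal (C * Real.sqrt (l2sq u) ^ (1 - gnExponent N p) *
        Real.sqrt (l2sq (weakLaplacian u)) ^ gnExponent N p)}

/-- The constant `𝒟₁ = (r₁/r)^{r₁/2} (r₂/r)^{r₂/2} C_{N,r}^r`, `r = r₁ + r₂`. -/
def constD1 (N : ℕ) (r₁ r₂ : ℝ) : ℝ :=
  (r₁ / (r₁ + r₂)) ^ (r₁ / 2) * (r₂ / (r₁ + r₂)) ^ (r₂ / 2) * gnConst N (r₁ + r₂) ^ (r₁ + r₂)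

end MixedDispersion

end

open MixedDispersion

/-! If a minimizing sequence does not vanish, then after translations and extraction a fixed amount
of mass stays in the unit ball. The Gagliardo–Nirenberg bound `coupling_le` makes the energy
coercive on the sphere (`exists_coercive`): for r below the critical exponent the coupling is
sublinear in the squared Laplacian norms, and at the critical exponent the bound on ρ keeps its
coefficient below 1/2. The sequence is therefore bounded in H² and has a weak limit (U,V), which is
nonzero by Rellich's theorem (`H2WeakTendsto.l2sq_ne_zero`).

Mass and energy split along the weak limit (`H2WeakTendsto.tendsto_l2sq`,
`H2WeakTendsto.tendsto_energy`). The quadratic terms split by weak convergence, once Green's formula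
has rewritten the gradient terms as -∫uΔu; the coupling splits by a Brezis–Lieb argument
(`tendsto_integral_coupling_sub`). Call (τ/ρ²)m the share of a pair of mass τ. Since the coupling
has degree r > 2, multiplying a pair of mass at most ρ² up to mass ρ² shows that its energy is at
least its share (`mul_le_energy`). For the remainders this gives, in the limit, that the energy of
(U,V) is at most its share.

The decisive point is that the inequality is strict for nonzero pairs of mass below ρ²
(`mul_lt_energy`). Equality would force the coupling to vanish, leaving two quadratic forms ½‖Δa‖² -
(αᵢ/2)‖∇a‖² - (m/ρ²)‖a‖². Both are nonnegative on H², as pairs (a,0) and (0,b) show, so each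
component would be a null vector and would solve a linear equation with constant coefficients. On
the Fourier side its symbol is a nontrivial polynomial in |ξ|², nonzero almost everywhere, so the
component is zero (`eq_zero_ae_of_quadForm_eq_zero`). Thus no information on the sign of m or on
existence of minimizers is needed.

Hence (U,V) has mass ρ² and energy m, while mass and energy of the remainders tend to 0. Coupling
and gradients are then negligible, so the Laplacians of the remainders tend to 0 too
(`tendsto_h2Norm_of_energy`).

The analytic tools are derived from Plancherel's theorem: the Gagliardo–Nirenberg inequality by
cutting frequencies at a level-dependent radius, Rellich's theorem by cutting at a fixed large
radius. -/

noncomputable section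

namespace MixedDispersion

/-! ## Test functions are dense among Schwartz functions -/

section

open SchwartzMap

/-- Seminorm estimate for the tail `(1 - g(c·)) φ` of a Schwartz function, where `g = 1` on the unit
ball. -/
theorem seminorm_smul_tail_le {E : Type*} [NormedAddCommGroup E] [NormedSpace ℝ E]
    (h : E → ℝ) (hh : ContDiff ℝ ∞ h) (hzero : ∀ x, ‖x‖ < 1 → h x = 0)
    (hbd : ∀ n : ℕ, ∃ C, ∀ x, ‖iteratedFDeriv ℝ n h x‖ ≤ C)
    (φ : 𝓢(E, ℂ)) (k n : ℕ) :
    ∃ M : ℝ, ∀ c : ℝ, 0 < c → c ≤ 1 → ∀ f : 𝓢(E, ℂ), (∀ x, f x = h (c • x) • φ x) →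
      SchwartzMap.seminorm ℝ k n f ≤ M * c := by
  choose C hC using hbd
  refine ⟨∑ i ∈ Finset.range (n + 1), (n.choose i : ℝ) * C i *
    SchwartzMap.seminorm ℝ (k + 1) (n - i) φ, fun c hc hc1 f hf => ?_⟩
  have hC0 : ∀ i, 0 ≤ C i := fun i => (norm_nonneg _).trans (hC i 0)
  refine SchwartzMap.seminorm_le_bound ℝ k n f
    (mul_nonneg (Finset.sum_nonneg fun i _ => mul_nonneg (mul_nonneg (by positivity) (hC0 i))
      (apply_nonneg _ _)) hc.le) fun x => ?_
  have hfe : (f : E → ℂ) = fun x => h (c • x) • φ x := funext hf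
  -- Inside this ball the product vanishes near `x`. Outside it 1 ≤ c‖x‖, so one factor `c` is
  -- gained for one more weight ‖x‖; hence the index `k + 1` in the constant.
  by_cases hx : ‖x‖ < c⁻¹
  · have : (f : E → ℂ) =ᶠ[𝓝 x] 0 := by
      filter_upwards [(isOpen_lt continuous_norm continuous_const).mem_nhds hx] with y hy
      rw [hf y, hzero, zero_smul, Pi.zero_apply]
      · rw [norm_smul, Real.norm_of_nonneg hc.le]
        calc c * ‖y‖ < c * c⁻¹ := by gcongr
          _ = 1 := mul_inv_cancel₀ hc.ne'
    rw [(this.iteratedFDeriv ℝ n).eq_of_nhds]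
    rw [show (0 : E → ℂ) = fun _ => 0 from rfl, iteratedFDeriv_fun_zero, Pi.zero_apply, norm_zero,
      mul_zero]
    exact mul_nonneg (Finset.sum_nonneg fun i _ => mul_nonneg (mul_nonneg (by positivity) (hC0 i))
      (apply_nonneg _ _)) hc.le
  · push Not at hx
    have hx1 : 1 ≤ c * ‖x‖ := by
      calc (1 : ℝ) = c * c⁻¹ := (mul_inv_cancel₀ hc.ne').symm
        _ ≤ c * ‖x‖ := by gcongr
    have hcd : ContDiff ℝ ∞ fun y => h (c • y) := hh.comp (contDiff_const_smul c)
    have hle := norm_iteratedFDeriv_smul_le (𝕜 := ℝ) (n := n) hcd (φ.smooth ⊤) x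
      (by exact_mod_cast le_top)
    rw [hfe, Finset.sum_mul]
    refine (mul_le_mul_of_nonneg_left hle (by positivity)).trans ?_
    rw [Finset.mul_sum]
    refine Finset.sum_le_sum fun i _ => ?_
    have h1 : ‖iteratedFDeriv ℝ i (fun y => h (c • y)) x‖ ≤ C i := by
      rw [congrFun (iteratedFDeriv_comp_const_smul c (hh.of_le (by exact_mod_cast le_top))) x, norm_smul]
      calc ‖c ^ i‖ * ‖iteratedFDeriv ℝ i h (c • x)‖ ≤ 1 * C i := by
            gcongr
            · rw [norm_pow, Real.norm_of_nonneg hc.le]; exact pow_le_one₀ hc.le hc1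
            · exact hC i _
        _ = C i := one_mul _
    have h3 := hC0 i
    have h2 : ‖x‖ ^ k * ‖iteratedFDeriv ℝ (n - i) φ x‖ ≤
        SchwartzMap.seminorm ℝ (k + 1) (n - i) φ * c := by
      have := SchwartzMap.le_seminorm ℝ (k + 1) (n - i) φ x
      calc ‖x‖ ^ k * ‖iteratedFDeriv ℝ (n - i) φ x‖
          ≤ (c * ‖x‖) * (‖x‖ ^ k * ‖iteratedFDeriv ℝ (n - i) φ x‖) :=
            le_mul_of_one_le_left (by positivity) hx1
        _ = (‖x‖ ^ (k + 1) * ‖iteratedFDeriv ℝ (n - i) φ x‖) * c := by ring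
        _ ≤ _ := by gcongr
    calc ‖x‖ ^ k * ((n.choose i : ℝ) * ‖iteratedFDeriv ℝ i (fun y => h (c • y)) x‖ *
          ‖iteratedFDeriv ℝ (n - i) φ x‖)
        = ((n.choose i : ℝ) * ‖iteratedFDeriv ℝ i (fun y => h (c • y)) x‖) *
          (‖x‖ ^ k * ‖iteratedFDeriv ℝ (n - i) φ x‖) := by ring
      _ ≤ ((n.choose i : ℝ) * C i) * (SchwartzMap.seminorm ℝ (k + 1) (n - i) φ * c) := by
          gcongr
      _ = _ := by ring

/-- Compactly supported smooth functions are dense in the Schwartz space. -/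
theorem dense_hasCompactSupport {E : Type*} [NormedAddCommGroup E] [InnerProductSpace ℝ E]
    [FiniteDimensional ℝ E] : Dense {f : 𝓢(E, ℂ) | HasCompactSupport f} := by
  intro φ
  let b : ContDiffBump (0 : E) := ⟨1, 2, one_pos, one_lt_two⟩
  have hbs : HasCompactSupport (b : E → ℝ) := b.hasCompactSupport
  have hbc : ContDiff ℝ ∞ (b : E → ℝ) := b.contDiff
  have hcomp : ∀ m : ℕ, HasCompactSupport fun x : E =>
      b ((1 / ((m : ℝ) + 1)) • x) • φ x := fun m =>
    (hbs.comp_homeomorph (Homeomorph.smulOfNeZero (1 / ((m : ℝ) + 1)) (by positivity))).smul_right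
  have hsm : ∀ m : ℕ, ContDiff ℝ ∞ fun x : E => b ((1 / ((m : ℝ) + 1)) • x) • φ x := fun m =>
    (hbc.comp (contDiff_const_smul _)).smul (φ.smooth ⊤)
  refine mem_closure_of_tendsto (b := atTop)
    (f := fun m : ℕ => (hcomp m).toSchwartzMap (hsm m)) ?_
    (Eventually.of_forall fun m => hcomp m)
  rw [(schwartz_withSeminorms ℝ E ℂ).tendsto_nhds]
  rintro ⟨k, n⟩ ε hε
  -- The error of the cutoff is `b - 1` dilated; its derivatives of positive order are those of `b`,
  -- hence compactly supported and bounded.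
  obtain ⟨M, hM⟩ := seminorm_smul_tail_le (fun x : E => b x - 1) (hbc.sub contDiff_const)
    (fun x hx => by
      rw [b.one_of_mem_closedBall (by simpa using hx.le), sub_self])
    (fun n => by
      have h1 : ContDiff ℝ ∞ fun x : E => b x - 1 := hbc.sub contDiff_const
      rcases n with _ | n
      · refine ⟨2, fun x => ?_⟩
        rw [norm_iteratedFDeriv_zero, Real.norm_eq_abs, abs_le]
        constructor <;> linarith [b.nonneg (x := x), b.le_one (x := x)]
      · obtain ⟨C, hC⟩ := (hbs.iteratedFDeriv (𝕜 := ℝ) (n + 1)).exists_bound_of_continuous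
          ((hbc.of_le (m := (n + 1 : ℕ)) (by exact_mod_cast le_top)).continuous_iteratedFDeriv'
            )
        refine ⟨C, fun x => ?_⟩
        have : iteratedFDeriv ℝ (n + 1) (fun x : E => b x - 1) x =
            iteratedFDeriv ℝ (n + 1) b x := by
          rw [fun_iteratedFDeriv_sub_apply (hbc.of_le (by exact_mod_cast le_top)).contDiffAt
            contDiff_const.contDiffAt, iteratedFDeriv_const_of_ne (Nat.succ_ne_zero n)]
          simp
        rw [this]; exact hC x) φ k n
  have htend : Tendsto (fun m : ℕ => M * (1 / ((m : ℝ) + 1))) atTop (𝓝 0) := by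
    simpa using tendsto_one_div_add_atTop_nhds_zero_nat.const_mul M
  filter_upwards [htend.eventually (gt_mem_nhds hε)] with m hm
  refine lt_of_le_of_lt (hM (1 / ((m : ℝ) + 1)) (by positivity) ?_ _ fun x => ?_) hm
  · rw [div_le_one (by positivity)]; linarith [Nat.cast_nonneg (α := ℝ) m]
  · simp [sub_smul]

end

/-! ## The Fourier transform on `L²` -/

section

open SchwartzMap FourierTransform Laplacian LineDeriv

/-- The complexification of a real `L²` function, as an element of `L²(ℝ^N; ℂ)`. -/
def complexL2 {N : ℕ} {u : RN N → ℝ} (hu : MemLp u 2) :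
    Lp (α := RN N) ℂ 2 volume :=
  (hu.ofReal (K := ℂ)).toLp

theorem coeFn_complexL2 {N : ℕ} {u : RN N → ℝ} (hu : MemLp u 2) :
    (complexL2 hu : RN N → ℂ) =ᵐ[volume] fun x => (u x : ℂ) :=
  (hu.ofReal (K := ℂ)).coeFn_toLp

open Classical in
/-- The Fourier transform of a real `L²` function (`0` if the function is not in `L²`). -/
def l2Fourier {N : ℕ} (u : RN N → ℝ) : RN N → ℂ :=
  if hu : MemLp u 2 then (𝓕 (complexL2 hu) : Lp (α := RN N) ℂ 2 volume) else 0

theorem l2Fourier_of_memLp {N : ℕ} {u : RN N → ℝ} (hu : MemLp u 2) :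
    l2Fourier u = (𝓕 (complexL2 hu) : Lp (α := RN N) ℂ 2 volume) := dif_pos hu

theorem memLp_l2Fourier {N : ℕ} (u : RN N → ℝ) : MemLp (l2Fourier u) 2 := by
  by_cases hu : MemLp u 2
  · rw [l2Fourier_of_memLp hu]; exact Lp.memLp _
  · rw [l2Fourier, dif_neg hu]; exact MemLp.zero

/-- Plancherel's identity for the inner product of two real `L²` functions. -/
theorem integral_inner_l2Fourier {N : ℕ} {u v : RN N → ℝ} (hu : MemLp u 2) (hv : MemLp v 2) :
    ∫ ξ, inner ℂ (l2Fourier u ξ) (l2Fourier v ξ) = ((∫ x, u x * v x : ℝ) : ℂ) := by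
  have h := Lp.inner_fourier_eq (complexL2 hu) (complexL2 hv)
  rw [L2.inner_def, L2.inner_def] at h
  rw [l2Fourier_of_memLp hu, l2Fourier_of_memLp hv, h, ← integral_complex_ofReal]
  refine integral_congr_ae ?_
  filter_upwards [coeFn_complexL2 hu, coeFn_complexL2 hv] with x h1 h2
  rw [h1, h2]
  simp [mul_comm]

theorem l2sq_eq_integral_mul_self {N : ℕ} (u : RN N → ℝ) : l2sq u = ∫ x, u x * u x := by
  simp only [l2sq, Real.norm_eq_abs, sq, abs_mul_abs_self]

theorem l2sq_l2Fourier {N : ℕ} {u : RN N → ℝ} (hu : MemLp u 2) : l2sq (l2Fourier u) = l2sq u := by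
  have h := integral_inner_l2Fourier hu hu
  have h2 : ∫ ξ, inner ℂ (l2Fourier u ξ) (l2Fourier u ξ) = ((l2sq (l2Fourier u) : ℝ) : ℂ) := by
    rw [l2sq, ← integral_complex_ofReal]
    refine integral_congr_ae (Eventually.of_forall fun ξ => ?_)
    simp only [inner_self_eq_norm_sq_to_K]
    push_cast; rfl
  rw [h2] at h
  rw [l2sq_eq_integral_mul_self u]
  exact_mod_cast h

theorem l2Fourier_add_smul {N : ℕ} {u v : RN N → ℝ} (hu : MemLp u 2) (hv : MemLp v 2) (a b : ℝ) :
    l2Fourier (fun x => a * u x + b * v x) =ᵐ[volume]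
      fun ξ => (a : ℂ) * l2Fourier u ξ + (b : ℂ) * l2Fourier v ξ := by
  have hm : MemLp (fun x => a * u x + b * v x) 2 := (hu.const_mul a).add (hv.const_mul b)
  have h : complexL2 hm = (a : ℂ) • complexL2 hu + (b : ℂ) • complexL2 hv := by
    ext1
    filter_upwards [coeFn_complexL2 hm, coeFn_complexL2 hu, coeFn_complexL2 hv,
      Lp.coeFn_add ((a : ℂ) • complexL2 hu) ((b : ℂ) • complexL2 hv),
      Lp.coeFn_smul (a : ℂ) (complexL2 hu), Lp.coeFn_smul (b : ℂ) (complexL2 hv)]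
      with x h1 h2 h3 h4 h5 h6
    rw [h1, h4, Pi.add_apply, h5, h6, Pi.smul_apply, Pi.smul_apply, h2, h3]
    simp
  rw [l2Fourier_of_memLp hm, h, FourierTransform.fourier_add, FourierTransform.fourier_smul,
    FourierTransform.fourier_smul, l2Fourier_of_memLp hu, l2Fourier_of_memLp hv]
  filter_upwards [Lp.coeFn_add ((a : ℂ) • 𝓕 (complexL2 hu)) ((b : ℂ) • 𝓕 (complexL2 hv)),
    Lp.coeFn_smul (a : ℂ) (𝓕 (complexL2 hu)), Lp.coeFn_smul (b : ℂ) (𝓕 (complexL2 hv))]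
    with x h1 h2 h3
  rw [h1, Pi.add_apply, h2, h3]
  simp

/-- Two tempered distributions which agree on real test functions are equal. -/
theorem temperedDistribution_ext {N : ℕ} {S T : TemperedDistribution (RN N) ℂ}
    (h : ∀ φ : RN N → ℝ, ∀ hφ : ContDiff ℝ ∞ (Complex.ofRealCLM ∘ φ),
      ∀ hc : HasCompactSupport (Complex.ofRealCLM ∘ φ), ContDiff ℝ ∞ φ → HasCompactSupport φ →
      S (hc.toSchwartzMap hφ) = T (hc.toSchwartzMap hφ)) : S = T := by
  ext f
  have hcl : IsClosed {f : 𝓢(RN N, ℂ) | S f = T f} := isClosed_eq S.continuous T.continuous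
  refine hcl.closure_subset_iff.2 ?_ (dense_hasCompactSupport f)
  intro g hg
  have hre : ContDiff ℝ ∞ fun x => (g x).re := Complex.reCLM.contDiff.comp (g.smooth ⊤)
  have him : ContDiff ℝ ∞ fun x => (g x).im := Complex.imCLM.contDiff.comp (g.smooth ⊤)
  have hre' : HasCompactSupport fun x => (g x).re := HasCompactSupport.comp_left hg Complex.zero_re
  have him' : HasCompactSupport fun x => (g x).im := HasCompactSupport.comp_left hg Complex.zero_im
  have hre2 : HasCompactSupport (Complex.ofRealCLM ∘ fun x => (g x).re) := hre'.comp_left rfl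
  have him2 : HasCompactSupport (Complex.ofRealCLM ∘ fun x => (g x).im) := him'.comp_left rfl
  have hre3 : ContDiff ℝ ∞ (Complex.ofRealCLM ∘ fun x => (g x).re) :=
    Complex.ofRealCLM.contDiff.comp hre
  have him3 : ContDiff ℝ ∞ (Complex.ofRealCLM ∘ fun x => (g x).im) :=
    Complex.ofRealCLM.contDiff.comp him
  -- Complex linearity reduces a complex test function to its real and imaginary parts, the only
  -- kind of test function used for weak derivatives.
  have hdec : g = hre2.toSchwartzMap hre3 + Complex.I • him2.toSchwartzMap him3 := by
    ext x
    simp [mul_comm Complex.I, Complex.re_add_im]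
  rw [Set.mem_ofPred_eq, hdec, map_add, map_add, map_smul, map_smul, h _ hre3 hre2 hre hre',
    h _ him3 him2 him him']

/-- Uniqueness of a locally integrable complex function among tempered pairings. -/
theorem ae_eq_of_integral_ofReal_mul_eq {N : ℕ} {f g : RN N → ℂ} (hf : LocallyIntegrable f)
    (hg : LocallyIntegrable g)
    (h : ∀ φ : RN N → ℝ, ContDiff ℝ ∞ φ → HasCompactSupport φ →
      ∫ x, (φ x : ℂ) * f x = ∫ x, (φ x : ℂ) * g x) : f =ᵐ[volume] g := by
  refine ae_eq_of_integral_contDiff_smul_eq hf hg fun φ hφ hc => ?_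
  simpa using h φ hφ hc

/-- The Fourier transform turns an identity `w = Δu` in the weak sense into multiplication by
`-(2π|ξ|)²`. -/
theorem IsWeakLaplacian.l2Fourier_ae_eq {N : ℕ} {u w : RN N → ℝ} (h : IsWeakLaplacian u w)
    (hu : MemLp u 2) (hw : MemLp w 2) :
    l2Fourier w =ᵐ[volume] fun ξ => -((2 * Real.pi * ‖ξ‖) ^ 2 : ℝ) * l2Fourier u ξ := by
  -- The weak identity is lifted to tempered distributions, where the Laplacian is a Fourier
  -- multiplier; it is read back almost everywhere at the end by testing two locally integrable
  -- functions.
  have hT : Δ (complexL2 hu : TemperedDistribution (RN N) ℂ) =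
      (complexL2 hw : TemperedDistribution (RN N) ℂ) := by
    refine temperedDistribution_ext fun φ hφ hc hφ' hc' => ?_
    rw [TemperedDistribution.laplacian_apply_apply, Lp.toTemperedDistribution_apply,
      Lp.toTemperedDistribution_apply]
    have h1 : ∫ x, (Δ (hc.toSchwartzMap hφ)) x • (complexL2 hu) x =
        ((∫ x, u x * Laplacian.laplacian φ x : ℝ) : ℂ) := by
      rw [← integral_complex_ofReal]
      refine integral_congr_ae ?_
      filter_upwards [coeFn_complexL2 hu] with x hx
      rw [hx, SchwartzMap.laplacian_apply]
      have : Δ (hc.toSchwartzMap hφ : RN N → ℂ) x = ((Δ φ x : ℝ) : ℂ) := by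
        change Δ (Complex.ofRealCLM ∘ φ) x = _
        rw [ContDiffAt.laplacian_CLM_comp_left (hφ'.of_le (by norm_cast)).contDiffAt]
        rfl
      rw [this, smul_eq_mul]; push_cast; ring
    have h2 : ∫ x, (hc.toSchwartzMap hφ) x • (complexL2 hw) x =
        ((∫ x, w x * φ x : ℝ) : ℂ) := by
      rw [← integral_complex_ofReal]
      refine integral_congr_ae ?_
      filter_upwards [coeFn_complexL2 hw] with x hx
      rw [hx, smul_eq_mul]; push_cast
      exact mul_comm _ _
    rw [h1, h2, h.2 φ hφ' hc']
  rw [TemperedDistribution.laplacian_eq_fourierMultiplierCLM] at hT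
  have hF := congrArg (fun S => 𝓕 S) hT
  simp only [TemperedDistribution.fourierMultiplierCLM_apply] at hF
  rw [Lp.fourier_toTemperedDistribution_eq, Lp.fourier_toTemperedDistribution_eq,
    ← Complex.coe_smul, FourierTransform.fourier_smul, FourierTransform.fourier_fourierInv_eq] at hF
  have hlu := (memLp_l2Fourier u).locallyIntegrable one_le_two
  have hlw := (memLp_l2Fourier w).locallyIntegrable one_le_two
  refine ae_eq_of_integral_ofReal_mul_eq hlw ?_ fun φ hφ' hc' => ?_
  · have hcont : Continuous fun ξ : RN N => -(((2 * Real.pi * ‖ξ‖) ^ 2 : ℝ) : ℂ) := by fun_prop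
    have := hlu.continuous_smul hcont
    simpa [smul_eq_mul] using this
  have hc : HasCompactSupport (Complex.ofRealCLM ∘ φ) := hc'.comp_left rfl
  have hφ : ContDiff ℝ ∞ (Complex.ofRealCLM ∘ φ) := Complex.ofRealCLM.contDiff.comp hφ'
  have hE := DFunLike.congr_fun hF (hc.toSchwartzMap hφ)
  rw [_root_.smul_apply, TemperedDistribution.smulLeftCLM_apply_apply,
    Lp.toTemperedDistribution_apply, Lp.toTemperedDistribution_apply, ← l2Fourier_of_memLp hu,
    ← l2Fourier_of_memLp hw] at hE
  rw [show ∫ x, (φ x : ℂ) * l2Fourier w x = ∫ x, (hc.toSchwartzMap hφ) x • l2Fourier w x from rfl,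
    ← hE, ← integral_smul]
  refine integral_congr_ae (Eventually.of_forall fun ξ => ?_)
  simp only []
  rw [SchwartzMap.smulLeftCLM_apply_apply (by fun_prop)]
  simp
  ring

end

/-! ## Green's formula -/

section

open SchwartzMap FourierTransform Laplacian LineDeriv

/-- The Fourier transform turns a weak partial derivative into multiplication by
`2πi⟨ξ, e⟩`. -/
theorem IsWeakGradient.l2Fourier_ae_eq {N : ℕ} {u : RN N → ℝ} {g : RN N → RN N}
    (h : IsWeakGradient u g) (hu : MemLp u 2) (e : RN N) (hge : MemLp (fun x => inner ℝ (g x) e) 2) :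
    l2Fourier (fun x => inner ℝ (g x) e) =ᵐ[volume]
      fun ξ => (2 * Real.pi * Complex.I) * (inner ℝ ξ e : ℝ) * l2Fourier u ξ := by
  have hT : ∂_{e} (complexL2 hu : TemperedDistribution (RN N) ℂ) =
      (complexL2 hge : TemperedDistribution (RN N) ℂ) := by
    refine temperedDistribution_ext fun φ hφ hc hφ' hc' => ?_
    rw [TemperedDistribution.lineDerivOp_apply_apply, Lp.toTemperedDistribution_apply,
      Lp.toTemperedDistribution_apply]
    have h1 : ∫ x, (-∂_{e} (hc.toSchwartzMap hφ)) x • (complexL2 hu) x =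
        ((-∫ x, u x * fderiv ℝ φ x e : ℝ) : ℂ) := by
      rw [← integral_neg, ← integral_complex_ofReal]
      refine integral_congr_ae ?_
      filter_upwards [coeFn_complexL2 hu] with x hx
      rw [hx, neg_apply, SchwartzMap.lineDerivOp_apply_eq_fderiv]
      have : fderiv ℝ (hc.toSchwartzMap hφ : RN N → ℂ) x e = ((fderiv ℝ φ x e : ℝ) : ℂ) := by
        change fderiv ℝ (Complex.ofRealCLM ∘ φ) x e = _
        rw [fderiv_comp _ Complex.ofRealCLM.differentiableAt
          ((hφ'.differentiable (by simp)).differentiableAt)]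
        simp
      rw [this, smul_eq_mul]; push_cast; ring
    have h2 : ∫ x, (hc.toSchwartzMap hφ) x • (complexL2 hge) x =
        ((∫ x, inner ℝ (g x) e * φ x : ℝ) : ℂ) := by
      rw [← integral_complex_ofReal]
      refine integral_congr_ae ?_
      filter_upwards [coeFn_complexL2 hge] with x hx
      rw [hx, smul_eq_mul]; push_cast
      exact mul_comm _ _
    rw [h1, h2, h.2 φ hφ' hc', neg_neg]
  rw [TemperedDistribution.lineDeriv_eq_fourierMultiplierCLM] at hT
  have hF := congrArg (fun S => 𝓕 S) hT
  simp only [TemperedDistribution.fourierMultiplierCLM_apply] at hF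
  rw [Lp.fourier_toTemperedDistribution_eq, Lp.fourier_toTemperedDistribution_eq,
    FourierTransform.fourier_smul, FourierTransform.fourier_fourierInv_eq] at hF
  have hlu := (memLp_l2Fourier u).locallyIntegrable one_le_two
  have hlw := (memLp_l2Fourier (fun x => inner ℝ (g x) e)).locallyIntegrable one_le_two
  refine ae_eq_of_integral_ofReal_mul_eq hlw ?_ fun φ hφ' hc' => ?_
  · have hcont : Continuous fun ξ : RN N =>
        (2 * Real.pi * Complex.I) * ((inner ℝ ξ e : ℝ) : ℂ) := by fun_prop
    have := hlu.continuous_smul hcont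
    simpa [smul_eq_mul] using this
  have hc : HasCompactSupport (Complex.ofRealCLM ∘ φ) := hc'.comp_left rfl
  have hφ : ContDiff ℝ ∞ (Complex.ofRealCLM ∘ φ) := Complex.ofRealCLM.contDiff.comp hφ'
  have hE := DFunLike.congr_fun hF (hc.toSchwartzMap hφ)
  rw [_root_.smul_apply, TemperedDistribution.smulLeftCLM_apply_apply,
    Lp.toTemperedDistribution_apply, Lp.toTemperedDistribution_apply, ← l2Fourier_of_memLp hu,
    ← l2Fourier_of_memLp hge] at hE
  rw [show ∫ x, (φ x : ℂ) * l2Fourier (fun x => inner ℝ (g x) e) x =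
    ∫ x, (hc.toSchwartzMap hφ) x • l2Fourier (fun x => inner ℝ (g x) e) x from rfl,
    ← hE, ← integral_smul]
  refine integral_congr_ae (Eventually.of_forall fun ξ => ?_)
  simp only []
  rw [SchwartzMap.smulLeftCLM_apply_apply (by fun_prop)]
  simp
  ring

theorem MemLp.integrable_norm_sq {N : ℕ} {F : Type*} [NormedAddCommGroup F] {f : RN N → F}
    (hf : MemLp f 2) : Integrable fun x => ‖f x‖ ^ 2 := hf.integrable_norm_pow two_ne_zero

/-- Green's formula: `‖∇u‖² = -∫ u Δu`. -/
theorem IsWeakGradient.l2sq_eq {N : ℕ} {u w : RN N → ℝ} {g : RN N → RN N}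
    (h : IsWeakGradient u g) (h' : IsWeakLaplacian u w) (hu : MemLp u 2) (hg : MemLp g 2)
    (hw : MemLp w 2) : l2sq g = -∫ x, u x * w x := by
  let b := EuclideanSpace.basisFun (Fin N) ℝ
  have hint : ∀ i, Integrable fun ξ => ‖l2Fourier (fun x => inner ℝ (g x) (b i)) ξ‖ ^ 2 := fun i =>
    MemLp.integrable_norm_sq (memLp_l2Fourier _)
  have h1 : l2sq g = ∑ i, l2sq (l2Fourier fun x => inner ℝ (g x) (b i)) := by
    have : ∀ i, l2sq (l2Fourier fun x => inner ℝ (g x) (b i)) =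
        ∫ x, ‖inner ℝ (g x) (b i)‖ ^ 2 := fun i => l2sq_l2Fourier (hg.inner_const (b i))
    simp only [this]
    rw [← integral_finsetSum _ fun i _ => MemLp.integrable_norm_sq (hg.inner_const (b i)), l2sq]
    refine integral_congr_ae (Eventually.of_forall fun x => ?_)
    exact (b.sum_sq_norm_inner_left (g x)).symm
  -- Pointwise, the squares of the multipliers 2πi⟨ξ, bᵢ⟩ in an orthonormal basis add up to
  -- (2π‖ξ‖)², which is minus the multiplier of the Laplacian.
  have h2 : ((∑ i, l2sq (l2Fourier fun x => inner ℝ (g x) (b i)) : ℝ) : ℂ) =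
      -∫ ξ, inner ℂ (l2Fourier u ξ) (l2Fourier w ξ) := by
    simp only [l2sq]
    rw [← integral_finsetSum _ fun i _ => hint i, ← integral_complex_ofReal, ← integral_neg]
    refine integral_congr_ae ?_
    filter_upwards [eventually_all.2 fun i =>
      h.l2Fourier_ae_eq hu (b i) (hg.inner_const (b i)), h'.l2Fourier_ae_eq hu hw] with ξ h3 h4
    simp only [h3, h4, norm_mul, mul_pow]
    rw [← Finset.sum_mul, ← Finset.mul_sum]
    have : ∑ i, ‖((inner ℝ ξ (b i) : ℝ) : ℂ)‖ ^ 2 = ‖ξ‖ ^ 2 := by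
      simp only [Complex.norm_real]
      exact b.sum_sq_norm_inner_left ξ
    rw [this, ← smul_eq_mul (a := -(_ : ℂ)), inner_smul_right, inner_self_eq_norm_sq_to_K]
    simp [Complex.norm_real]
  rw [integral_inner_l2Fourier hu hw] at h2
  rw [h1]
  exact_mod_cast h2

end

/-! ## Frequency localization -/

section

open SchwartzMap FourierTransform RealInnerProductSpace

/-- The `L²` inverse Fourier transform of an integrable function is given by the integral. -/
theorem coeFn_fourierInv_toLp {N : ℕ} {f : RN N → ℂ} (hf2 : MemLp f 2) (hf1 : Integrable f) :
    (𝓕⁻ hf2.toLp : Lp (α := RN N) ℂ 2 volume) =ᵐ[volume] 𝓕⁻ f := by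
  have hcont : Continuous (𝓕⁻ f) :=
    VectorFourier.fourierIntegral_continuous Real.continuous_fourierChar
      (L := -innerₗ (RN N)) (continuous_inner (𝕜 := ℝ) (E := RN N)).neg hf1
  refine ae_eq_of_integral_ofReal_mul_eq ((Lp.memLp _).locallyIntegrable one_le_two)
    hcont.locallyIntegrable fun φ hφ' hc' => ?_
  have hc : HasCompactSupport (Complex.ofRealCLM ∘ φ) := hc'.comp_left rfl
  have hφ : ContDiff ℝ ∞ (Complex.ofRealCLM ∘ φ) := Complex.ofRealCLM.contDiff.comp hφ'
  set ψ := hc.toSchwartzMap hφ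
  have h1 := DFunLike.congr_fun (Lp.fourierInv_toTemperedDistribution_eq hf2.toLp) ψ
  rw [TemperedDistribution.fourierInv_apply, Lp.toTemperedDistribution_apply,
    Lp.toTemperedDistribution_apply] at h1
  have h2 : ∫ x, (𝓕⁻ ψ) x • (hf2.toLp f) x = ∫ x, (𝓕⁻ (ψ : RN N → ℂ)) x • f x := by
    rw [← SchwartzMap.fourierInv_coe]
    refine integral_congr_ae ?_
    filter_upwards [hf2.coeFn_toLp] with x hx
    rw [hx]
  -- The inverse transform is moved from ψ to f by Fubini; the phase is symmetric in its two
  -- variables, which is what `hflip` records.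
  have h3 : ∫ x, (𝓕⁻ (ψ : RN N → ℂ)) x • f x = ∫ x, ψ x • 𝓕⁻ f x := by
    have := VectorFourier.integral_fourierIntegral_smul_eq_flip (μ := volume) (ν := volume)
      (L := -innerₗ (RN N)) Real.continuous_fourierChar
      (continuous_inner (𝕜 := ℝ) (E := RN N)).neg ψ.integrable hf1
    have hflip : (-innerₗ (RN N)).flip = -innerₗ (RN N) := by
      ext x y; simp [real_inner_comm]
    rw [hflip] at this
    exact this
  rw [h2, h3] at h1
  exact h1.symm

/-- The part of `u` with frequencies in `K`. -/
def freqPart {N : ℕ} (K : Set (RN N)) (u : RN N → ℝ) : RN N → ℂ :=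
  𝓕⁻ (K.indicator (l2Fourier u))

theorem memLp_indicator_l2Fourier {N : ℕ} {K : Set (RN N)} (hK : MeasurableSet K) (u : RN N → ℝ) :
    MemLp (K.indicator (l2Fourier u)) 2 := (memLp_l2Fourier u).indicator hK

theorem integrable_indicator_l2Fourier {N : ℕ} {K : Set (RN N)} (hK : MeasurableSet K)
    (hK' : volume K ≠ ⊤) (u : RN N → ℝ) : Integrable (K.indicator (l2Fourier u)) := by
  rw [integrable_indicator_iff hK]
  have : IsFiniteMeasure (volume.restrict K) := ⟨by simpa using hK'.lt_top⟩
  exact ((memLp_l2Fourier u).restrict K).integrable one_le_two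

/-- Bernstein's inequality: Cauchy–Schwarz on `K` in the inverse Fourier integral. -/
theorem enorm_freqPart_le {N : ℕ} {K : Set (RN N)} (hK : MeasurableSet K)
    (u : RN N → ℝ) (x : RN N) :
    ‖freqPart K u x‖ₑ ≤ volume K ^ (1 / 2 : ℝ) * eLpNorm (l2Fourier u) 2 := by
  have h1 : ‖freqPart K u x‖ₑ ≤ ∫⁻ ξ, ‖K.indicator (l2Fourier u) ξ‖ₑ := by
    rw [freqPart, Real.fourierInv_eq]
    refine (enorm_integral_le_lintegral_enorm _).trans (le_of_eq ?_)
    refine lintegral_congr fun ξ => ?_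
    rw [← ofReal_norm, ← ofReal_norm, Circle.norm_smul]
  refine h1.trans ?_
  have h2 : ∫⁻ ξ, ‖K.indicator (l2Fourier u) ξ‖ₑ = eLpNorm (l2Fourier u) 1 (volume.restrict K) := by
    rw [eLpNorm_one_eq_lintegral_enorm, ← lintegral_indicator hK]
    refine lintegral_congr fun ξ => ?_
    by_cases h : ξ ∈ K <;> simp [h]
  rw [h2]
  have h3 := eLpNorm_le_eLpNorm_mul_rpow_measure_univ (μ := volume.restrict K) one_le_two
    (memLp_l2Fourier u).1.restrict
  rw [Measure.restrict_apply_univ] at h3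
  refine h3.trans ?_
  rw [mul_comm]
  have : (1 / (1 : ℝ≥0∞).toReal - 1 / (2 : ℝ≥0∞).toReal : ℝ) = 1 / 2 := by norm_num
  rw [this]
  exact mul_le_mul_right (eLpNorm_mono_measure _ Measure.restrict_le_self) _

theorem eLpNorm_l2Fourier {N : ℕ} {u : RN N → ℝ} (hu : MemLp u 2) :
    eLpNorm (l2Fourier u) 2 = eLpNorm u 2 := by
  have h := Lp.norm_fourier_eq (complexL2 hu)
  rw [Lp.norm_def, Lp.norm_def, ← l2Fourier_of_memLp hu, eLpNorm_congr_ae (coeFn_complexL2 hu)] at h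
  have h' := (ENNReal.toReal_eq_toReal_iff' (memLp_l2Fourier u).2.ne
    (hu.ofReal (K := ℂ)).2.ne).1 h
  rw [h']
  refine eLpNorm_congr_norm_ae (Eventually.of_forall fun x => ?_)
  simp

/-- The remainder after frequency truncation has the expected `L²` norm. -/
theorem eLpNorm_sub_freqPart {N : ℕ} {K : Set (RN N)} (hK : MeasurableSet K)
    (hK' : volume K ≠ ⊤) {u : RN N → ℝ} (hu : MemLp u 2) :
    eLpNorm (fun x => (u x : ℂ) - freqPart K u x) 2 = eLpNorm (Kᶜ.indicator (l2Fourier u)) 2 := by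
  set f := (memLp_indicator_l2Fourier hK u).toLp
  have h1 : (fun x => (u x : ℂ) - freqPart K u x) =ᵐ[volume]
      ((complexL2 hu - 𝓕⁻ f : Lp (α := RN N) ℂ 2 volume) : RN N → ℂ) := by
    filter_upwards [coeFn_complexL2 hu, Lp.coeFn_sub (complexL2 hu) (𝓕⁻ f),
      coeFn_fourierInv_toLp (memLp_indicator_l2Fourier hK u)
        (integrable_indicator_l2Fourier hK hK' u)] with x h1 h2 h3
    rw [h2, Pi.sub_apply, h1, h3]; rfl
  have h2 : ((𝓕 (complexL2 hu) - f : Lp (α := RN N) ℂ 2 volume) : RN N → ℂ) =ᵐ[volume]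
      Kᶜ.indicator (l2Fourier u) := by
    filter_upwards [Lp.coeFn_sub (𝓕 (complexL2 hu)) f,
      (memLp_indicator_l2Fourier hK u).coeFn_toLp] with x h1 h2
    rw [h1, Pi.sub_apply, h2, ← l2Fourier_of_memLp hu]
    by_cases h : x ∈ K <;> simp [h]
  rw [eLpNorm_congr_ae h1, ← eLpNorm_congr_ae h2, ← ENNReal.toReal_eq_toReal_iff'
    (Lp.eLpNorm_ne_top _) (Lp.eLpNorm_ne_top _), ← Lp.norm_def, ← Lp.norm_def,
    ← Lp.norm_fourier_eq (complexL2 hu - 𝓕⁻ f)]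
  congr 1
  rw [sub_eq_add_neg, sub_eq_add_neg, FourierTransform.fourier_add, FourierTransform.fourier_neg,
    FourierTransform.fourier_fourierInv_eq]

/-- Values of the truncation are `L²` pairings with a fixed kernel. -/
theorem exists_kernel_freqPart {N : ℕ} {K : Set (RN N)} (hK : MeasurableSet K)
    (hK' : volume K ≠ ⊤) (x : RN N) : ∃ k₁ k₂ : RN N → ℝ, MemLp k₁ 2 ∧ MemLp k₂ 2 ∧
      ∀ u : RN N → ℝ, MemLp u 2 →
        freqPart K u x = ((∫ y, u y * k₁ y : ℝ) : ℂ) + ((∫ y, u y * k₂ y : ℝ) : ℂ) * Complex.I := by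
  have hmem : MemLp (K.indicator fun ξ => (Real.fourierChar (-⟪ξ, x⟫) : ℂ)) 2 := by
    have : IsFiniteMeasure (volume.restrict K) := ⟨by simpa using hK'.lt_top⟩
    rw [memLp_indicator_iff_restrict hK]
    refine MemLp.of_bound (Continuous.aestronglyMeasurable (by fun_prop)) 1
      (Eventually.of_forall fun ξ => (Circle.norm_coe _).le)
  -- Evaluation at `x` after truncation is the pairing of û with the truncated character, so by
  -- Plancherel the pairing of u with its inverse transform κ. The inner product conjugates κ, hence
  -- the sign of the imaginary part below.
  set κ : Lp (α := RN N) ℂ 2 volume := 𝓕⁻ (hmem.toLp) with hκ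
  refine ⟨fun y => (κ y).re, fun y => -(κ y).im, (Lp.memLp κ).re, (Lp.memLp κ).im.neg,
    fun u hu => ?_⟩
  have hκu := Lp.inner_fourier_eq κ (complexL2 hu)
  have h1 : inner ℂ (𝓕 κ) (𝓕 (complexL2 hu)) = freqPart K u x := by
    rw [hκ, FourierTransform.fourier_fourierInv_eq, L2.inner_def, ← l2Fourier_of_memLp hu,
      freqPart, Real.fourierInv_eq]
    refine integral_congr_ae ?_
    filter_upwards [hmem.coeFn_toLp] with ξ hξ
    rw [hξ, Circle.smul_def]
    by_cases h : ξ ∈ K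
    · simp only [Set.indicator_of_mem h, AddChar.map_neg_eq_inv, Circle.coe_inv_eq_conj,
        RCLike.inner_apply, RCLike.conj_conj, smul_eq_mul]
      exact (mul_comm _ _)
    · simp [h]
  have hint : ∀ k : RN N → ℝ, MemLp k 2 → Integrable fun y => u y * k y :=
    fun k hk => hu.integrable_mul hk
  rw [← h1, hκu, L2.inner_def, ← integral_complex_ofReal, ← integral_complex_ofReal,
    ← integral_mul_const, ← integral_add (hint _ (Lp.memLp κ).re).ofReal
      ((hint _ (Lp.memLp κ).im.neg).ofReal.mul_const _)]
  refine integral_congr_ae ?_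
  filter_upwards [coeFn_complexL2 hu] with y hy
  rw [hy]
  apply Complex.ext <;> simp

end

/-! ## Distribution functions -/

section

theorem eLpNorm_two_sq_eq_lintegral {N : ℕ} {F : Type*} [NormedAddCommGroup F] (f : RN N → F) :
    eLpNorm f 2 ^ 2 = ∫⁻ x, ‖f x‖ₑ ^ 2 := by
  have := eLpNorm_nnreal_pow_eq_lintegral (μ := volume) (f := f) (p := 2) two_ne_zero
  simpa using this

theorem ofReal_l2sq {N : ℕ} {F : Type*} [NormedAddCommGroup F] {f : RN N → F} (hf : MemLp f 2) :
    ENNReal.ofReal (l2sq f) = ∫⁻ x, ‖f x‖ₑ ^ 2 := by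
  rw [l2sq, ofReal_integral_eq_lintegral_ofReal (MemLp.integrable_norm_sq hf)
    (Eventually.of_forall fun x => by positivity)]
  refine lintegral_congr fun x => ?_
  rw [ENNReal.ofReal_pow (norm_nonneg _), ofReal_norm]

theorem l2sq_nonneg {N : ℕ} {F : Type*} [NormedAddCommGroup F] (f : RN N → F) : 0 ≤ l2sq f :=
  integral_nonneg fun x => by positivity

theorem eLpNorm_two_eq_ofReal {N : ℕ} {F : Type*} [NormedAddCommGroup F] {f : RN N → F}
    (hf : MemLp f 2) : eLpNorm f 2 = ENNReal.ofReal (Real.sqrt (l2sq f)) := by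
  have h1 := eLpNorm_two_sq_eq_lintegral f
  rw [← ofReal_l2sq hf, ← Real.sq_sqrt (l2sq_nonneg f), ENNReal.ofReal_pow (Real.sqrt_nonneg _)] at h1
  exact (ENNReal.pow_right_strictMono two_ne_zero).injective h1

/-- The volume of the unit ball, as a real number. -/
def ballVol (N : ℕ) : ℝ := (volume (Metric.ball (0 : RN N) 1)).toReal

theorem ballVol_pos (N : ℕ) : 0 < ballVol N :=
  ENNReal.toReal_pos (Metric.measure_ball_pos volume _ one_pos).ne' measure_ball_lt_top.ne

/-- The level set of high frequencies, described by a power of the norm. -/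
theorem volume_low_le {N : ℕ} (hN : 1 ≤ N) {A t : ℝ} (hA : 0 < A) (ht : 0 < t) :
    volume {ξ : RN N | 2 * A * Real.sqrt (ballVol N) * ‖ξ‖ ^ ((N : ℝ) / 2) ≤ t} ≤
      ENNReal.ofReal ((t / 2 / A) ^ 2) := by
  have hb := ballVol_pos N
  have hNR : (0 : ℝ) < N := by exact_mod_cast hN
  set s := Real.sqrt (ballVol N) with hs
  have hs0 : 0 < s := Real.sqrt_pos.2 hb
  -- The radius at which the defining inequality becomes an equality; its ball has volume R^N · |B₁|
  -- = (t/2A)².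
  set R := (t / (2 * A * s)) ^ (2 / (N : ℝ)) with hR
  have hR0 : 0 ≤ R := by positivity
  have hsub : {ξ : RN N | 2 * A * s * ‖ξ‖ ^ ((N : ℝ) / 2) ≤ t} ⊆ Metric.closedBall 0 R := by
    intro ξ hξ
    rw [mem_closedBall_zero_iff]
    have h1 : ‖ξ‖ ^ ((N : ℝ) / 2) ≤ t / (2 * A * s) := by
      rw [le_div_iff₀ (by positivity), mul_comm]; exact hξ
    calc ‖ξ‖ = (‖ξ‖ ^ ((N : ℝ) / 2)) ^ (2 / (N : ℝ)) := by
          rw [← Real.rpow_mul (norm_nonneg _), div_mul_div_comm, mul_comm, div_self (by positivity),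
            Real.rpow_one]
      _ ≤ R := Real.rpow_le_rpow (by positivity) h1 (by positivity)
  refine (measure_mono hsub).trans ?_
  have : Nontrivial (RN N) := by
    have : Nonempty (Fin N) := ⟨⟨0, hN⟩⟩
    infer_instance
  rw [Measure.addHaar_closedBall _ _ hR0, finrank_euclideanSpace, Fintype.card_fin,
    ← ENNReal.ofReal_toReal (measure_ball_lt_top (x := (0 : RN N)) (r := 1)).ne,
    ← ENNReal.ofReal_mul (by positivity)]
  refine le_of_eq (congrArg _ ?_)
  have h2 : R ^ N = (t / (2 * A * s)) ^ 2 := by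
    rw [hR, ← Real.rpow_natCast, ← Real.rpow_mul (by positivity), div_mul_cancel₀ _ hNR.ne']
    norm_num
  rw [h2]
  change (t / (2 * A * s)) ^ 2 * ballVol N = _
  have h3 : s ^ 2 = ballVol N := Real.sq_sqrt hb.le
  rw [← h3]
  field_simp

theorem aemeasurable_norm_sq_l2Fourier {N : ℕ} (u : RN N → ℝ) :
    AEMeasurable (fun ξ => ‖l2Fourier u ξ‖ₑ ^ 2) :=
  (memLp_l2Fourier u).1.enorm.pow_const 2

/-- Distribution function of `u` in terms of its high frequencies. -/
theorem distribution_le {N : ℕ} (hN : 1 ≤ N) {u : RN N → ℝ} (hu : MemLp u 2)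
    {A : ℝ} (hA : 0 < A) (hAu : A = Real.sqrt (l2sq u)) {t : ℝ} (ht : 0 < t) :
    volume {x | t < |u x|} ≤ ENNReal.ofReal (4 * t ^ (-2 : ℝ)) *
      (volume.withDensity fun ξ => ‖l2Fourier u ξ‖ₑ ^ 2)
        {ξ | t < 2 * A * Real.sqrt (ballVol N) * ‖ξ‖ ^ ((N : ℝ) / 2)} := by
  set Λ : RN N → ℝ := fun ξ => 2 * A * Real.sqrt (ballVol N) * ‖ξ‖ ^ ((N : ℝ) / 2) with hΛ
  have hΛc : Continuous Λ := by
    have : (0 : ℝ) ≤ (N : ℝ) / 2 := by positivity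
    exact continuous_const.mul (continuous_norm.rpow_const fun _ => Or.inr this)
  -- The frequency cut depends on the level `t`: it makes |K|^{1/2}‖u‖₂ ≤ t/2, so the low part never
  -- exceeds t/2. Where |u| > t the high part is at least t/2, and Chebyshev's inequality in L²
  -- applies to it.
  set K : Set (RN N) := {ξ | Λ ξ ≤ t} with hK
  have hKm : MeasurableSet K := (isClosed_le hΛc continuous_const).measurableSet
  have hKv : volume K ≤ ENNReal.ofReal ((t / 2 / A) ^ 2) := volume_low_le hN hA ht
  have hKt : volume K ≠ ⊤ := (hKv.trans_lt ENNReal.ofReal_lt_top).ne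
  have hlow : ∀ x, ‖freqPart K u x‖ ≤ t / 2 := by
    intro x
    have h1 := enorm_freqPart_le hKm u x
    rw [eLpNorm_l2Fourier hu, eLpNorm_two_eq_ofReal hu, ← hAu] at h1
    have h2 : ‖freqPart K u x‖ₑ ≤ ENNReal.ofReal (t / 2) := by
      refine h1.trans ?_
      calc volume K ^ (1 / 2 : ℝ) * ENNReal.ofReal A
          ≤ (ENNReal.ofReal ((t / 2 / A) ^ 2)) ^ (1 / 2 : ℝ) * ENNReal.ofReal A := by gcongr
        _ = ENNReal.ofReal (t / 2) := by
          rw [ENNReal.ofReal_rpow_of_nonneg (by positivity) (by norm_num), ← Real.sqrt_eq_rpow,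
            Real.sqrt_sq (by positivity), ← ENNReal.ofReal_mul (by positivity),
            div_mul_cancel₀ _ hA.ne']
    rw [← ofReal_norm] at h2
    exact (ENNReal.ofReal_le_ofReal_iff (by positivity)).1 h2
  have hsub : {x | t < |u x|} ⊆
      {x | ENNReal.ofReal (t / 2) ^ 2 ≤ ‖(u x : ℂ) - freqPart K u x‖ₑ ^ 2} := by
    intro x hx
    rw [Set.mem_ofPred_eq] at hx ⊢
    have h1 : t / 2 ≤ ‖(u x : ℂ) - freqPart K u x‖ := by
      have := norm_sub_norm_le (u x : ℂ) (freqPart K u x)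
      rw [Complex.norm_real, Real.norm_eq_abs] at this
      linarith [hlow x]
    rw [← ofReal_norm]
    gcongr
  have hmeas : AEMeasurable fun x => ‖(u x : ℂ) - freqPart K u x‖ₑ ^ 2 := by
    have : AEStronglyMeasurable (freqPart K u) volume :=
      (Lp.aestronglyMeasurable _).congr (coeFn_fourierInv_toLp (memLp_indicator_l2Fourier hKm u)
        (integrable_indicator_l2Fourier hKm hKt u))
    exact (((hu.ofReal (K := ℂ)).1.sub this).enorm).pow_const 2
  refine (measure_mono hsub).trans ?_
  refine (meas_ge_le_lintegral_div hmeas (by simpa using ht) (by simp)).trans ?_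
  have h4 : ∫⁻ x, ‖(u x : ℂ) - freqPart K u x‖ₑ ^ 2 =
      (volume.withDensity fun ξ => ‖l2Fourier u ξ‖ₑ ^ 2) {ξ | t < Λ ξ} := by
    rw [← eLpNorm_two_sq_eq_lintegral, eLpNorm_sub_freqPart hKm hKt hu, eLpNorm_two_sq_eq_lintegral,
      withDensity_apply _ (isOpen_lt continuous_const hΛc).measurableSet,
      ← lintegral_indicator (isOpen_lt continuous_const hΛc).measurableSet]
    refine lintegral_congr fun ξ => ?_
    have : Kᶜ = {ξ | t < Λ ξ} := by ext; simp [hK]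
    rw [this]
    by_cases h : ξ ∈ {ξ | t < Λ ξ}
    · rw [Set.indicator_of_mem h, Set.indicator_of_mem h]
    · rw [Set.indicator_of_notMem h, Set.indicator_of_notMem h]; simp
  rw [h4, ENNReal.div_eq_inv_mul]
  gcongr
  rw [← ENNReal.ofReal_pow (by positivity), ← ENNReal.ofReal_inv_of_pos (by positivity)]
  refine le_of_eq (congrArg _ ?_)
  rw [Real.rpow_neg ht.le, Real.rpow_two]
  field_simp
  norm_num

/-- `∫ |u|^p` is controlled by a fractional Sobolev seminorm. -/
theorem lintegral_rpow_le_fourier {N : ℕ} (hN : 1 ≤ N) {u : RN N → ℝ} (hu : MemLp u 2)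
    {A : ℝ} (hA : 0 < A) (hAu : A = Real.sqrt (l2sq u)) {p : ℝ} (hp : 2 < p) :
    ∫⁻ x, ENNReal.ofReal (|u x| ^ p) ≤ ENNReal.ofReal (4 * p / (p - 2)) *
      ∫⁻ ξ, ENNReal.ofReal ((2 * A * Real.sqrt (ballVol N) * ‖ξ‖ ^ ((N : ℝ) / 2)) ^ (p - 2)) *
        ‖l2Fourier u ξ‖ₑ ^ 2 := by
  set Λ : RN N → ℝ := fun ξ => 2 * A * Real.sqrt (ballVol N) * ‖ξ‖ ^ ((N : ℝ) / 2) with hΛ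
  have hΛc : Continuous Λ := by
    have : (0 : ℝ) ≤ (N : ℝ) / 2 := by positivity
    exact continuous_const.mul (continuous_norm.rpow_const fun _ => Or.inr this)
  have hΛ0 : ∀ ξ, 0 ≤ Λ ξ := fun ξ => by positivity
  set ν := volume.withDensity fun ξ => ‖l2Fourier u ξ‖ₑ ^ 2 with hν
  -- Two layer-cake formulas are compared, for |u| under Lebesgue measure and for Λ under the
  -- density |û|². The factor 4t⁻² of `distribution_le` lowers the exponent from p to p - 2 and the
  -- constant 4p/(p-2) collects the prefactors.
  have h1 := lintegral_rpow_eq_lintegral_meas_lt_mul volume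
    (f := fun x => |u x|) (Eventually.of_forall fun x => abs_nonneg _)
    (hu.1.aemeasurable.abs) (p := p) (by linarith)
  have h2 := lintegral_rpow_eq_lintegral_meas_lt_mul ν
    (f := Λ) (Eventually.of_forall hΛ0) hΛc.measurable.aemeasurable (p := p - 2) (by linarith)
  have h3 : ∫⁻ ξ, ENNReal.ofReal (Λ ξ ^ (p - 2)) ∂ν =
      ∫⁻ ξ, ENNReal.ofReal (Λ ξ ^ (p - 2)) * ‖l2Fourier u ξ‖ₑ ^ 2 := by
    rw [hν, lintegral_withDensity_eq_lintegral_mul₀ (aemeasurable_norm_sq_l2Fourier u)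
      (hΛc.measurable.pow_const _).ennreal_ofReal.aemeasurable]
    exact lintegral_congr fun ξ => by rw [Pi.mul_apply, mul_comm]
  rw [h1, ← h3, h2]
  calc ENNReal.ofReal p * ∫⁻ t in Set.Ioi 0, volume {x | t < |u x|} * ENNReal.ofReal (t ^ (p - 1))
      ≤ ENNReal.ofReal p * ∫⁻ t in Set.Ioi 0, ENNReal.ofReal 4 *
          (ν {ξ | t < Λ ξ} * ENNReal.ofReal (t ^ (p - 2 - 1))) := by
        gcongr ENNReal.ofReal p * ?_
        refine setLIntegral_mono' measurableSet_Ioi fun t ht => ?_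
        have ht0 : (0 : ℝ) < t := ht
        calc volume {x | t < |u x|} * ENNReal.ofReal (t ^ (p - 1))
            ≤ (ENNReal.ofReal (4 * t ^ (-2 : ℝ)) * ν {ξ | t < Λ ξ}) * ENNReal.ofReal (t ^ (p - 1)) := by
              gcongr
              exact distribution_le hN hu hA hAu ht0
          _ = (ENNReal.ofReal (4 * t ^ (-2 : ℝ)) * ENNReal.ofReal (t ^ (p - 1))) *
              ν {ξ | t < Λ ξ} := by ring
          _ = (ENNReal.ofReal 4 * ENNReal.ofReal (t ^ (p - 2 - 1))) * ν {ξ | t < Λ ξ} := by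
              rw [← ENNReal.ofReal_mul (by positivity), ← ENNReal.ofReal_mul (by positivity),
                mul_assoc, ← Real.rpow_add ht0]
              ring_nf
          _ = _ := by ring
    _ = ENNReal.ofReal (4 * p / (p - 2)) * (ENNReal.ofReal (p - 2) *
          ∫⁻ t in Set.Ioi 0, ν {ξ | t < Λ ξ} * ENNReal.ofReal (t ^ (p - 2 - 1))) := by
        rw [lintegral_const_mul' _ _ ENNReal.ofReal_ne_top, ← mul_assoc, ← mul_assoc,
          ← ENNReal.ofReal_mul (by linarith), ← ENNReal.ofReal_mul (by
            apply div_nonneg <;> linarith)]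
        congr 2
        field_simp [show p - 2 ≠ 0 by linarith]

end

/-! ## The Gagliardo–Nirenberg inequality -/

section

/-- Plancherel for Δu, with the factor (2π)⁴ ≥ 1 dropped. -/
theorem lintegral_norm_pow_four_mul_le {N : ℕ} {u : RN N → ℝ} (hu : MemH2 u) :
    ∫⁻ ξ, ENNReal.ofReal (‖ξ‖ ^ 4) * ‖l2Fourier u ξ‖ₑ ^ 2 ≤
      ENNReal.ofReal (l2sq (weakLaplacian u)) := by
  obtain ⟨hΔ, hΔ2⟩ := hu.weakLaplacian_spec
  rw [← l2sq_l2Fourier hΔ2, ofReal_l2sq (memLp_l2Fourier _)]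
  refine lintegral_mono_ae ?_
  filter_upwards [hΔ.l2Fourier_ae_eq hu.memLp hΔ2] with ξ hξ
  rw [hξ, enorm_mul, mul_pow]
  gcongr
  rw [← Complex.ofReal_neg, ← ofReal_norm, Complex.norm_real, ← ENNReal.ofReal_pow (norm_nonneg _)]
  refine ENNReal.ofReal_le_ofReal ?_
  rw [norm_neg, Real.norm_eq_abs, sq_abs, ← pow_mul, mul_pow]
  have : (1 : ℝ) ≤ (2 * Real.pi) ^ 4 := one_le_pow₀ (by linarith [Real.pi_gt_three])
  exact le_mul_of_one_le_left (by positivity) this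

/-- Hölder's inequality with exponents 1 - θ and θ between the weights 1 and ‖ξ‖⁴. -/
theorem lintegral_norm_rpow_mul_le {N : ℕ} {u : RN N → ℝ} (hu : MemH2 u) {θ : ℝ} (h0 : 0 < θ)
    (h1 : θ ≤ 1) :
    ∫⁻ ξ, ENNReal.ofReal (‖ξ‖ ^ (4 * θ)) * ‖l2Fourier u ξ‖ₑ ^ 2 ≤
      ENNReal.ofReal (l2sq u) ^ (1 - θ) * ENNReal.ofReal (l2sq (weakLaplacian u)) ^ θ := by
  have hm := aemeasurable_norm_sq_l2Fourier u
  calc ∫⁻ ξ, ENNReal.ofReal (‖ξ‖ ^ (4 * θ)) * ‖l2Fourier u ξ‖ₑ ^ 2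
      = ∫⁻ ξ, (‖l2Fourier u ξ‖ₑ ^ 2) ^ (1 - θ) *
          (ENNReal.ofReal (‖ξ‖ ^ 4) * ‖l2Fourier u ξ‖ₑ ^ 2) ^ θ := by
        refine lintegral_congr fun ξ => ?_
        rw [ENNReal.mul_rpow_of_nonneg _ _ h0.le, ENNReal.ofReal_rpow_of_nonneg (by positivity) h0.le,
          Real.rpow_mul (norm_nonneg _), mul_left_comm,
          ← ENNReal.rpow_add_of_nonneg _ _ (by linarith) h0.le, sub_add_cancel, ENNReal.rpow_one]
        norm_cast
    _ ≤ (∫⁻ ξ, ‖l2Fourier u ξ‖ₑ ^ 2) ^ (1 - θ) *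
          (∫⁻ ξ, ENNReal.ofReal (‖ξ‖ ^ 4) * ‖l2Fourier u ξ‖ₑ ^ 2) ^ θ :=
        ENNReal.lintegral_mul_norm_pow_le hm
          ((by fun_prop : Measurable fun ξ : RN N => ENNReal.ofReal (‖ξ‖ ^ 4)).aemeasurable.mul hm)
          (by linarith) h0.le (by ring)
    _ ≤ _ := by
        gcongr
        · exact le_of_eq (by rw [← ofReal_l2sq (memLp_l2Fourier _), l2sq_l2Fourier hu.memLp])
        · exact lintegral_norm_pow_four_mul_le hu

/-- The power Λ^(p-2) is a multiple of ‖ξ‖^(4θ) with θ = N(p-2)/8, and θ ≤ 1 is exactly the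
condition p ≤ 2 + 8/N under which it interpolates between L² and the Laplacian. Zero mass is treated
apart, since Λ is built from a positive ‖u‖₂. -/
theorem lintegral_rpow_le_gn {N : ℕ} (hN : 1 ≤ N) {p : ℝ} (hp : 2 < p)
    (hp' : p ≤ 2 + 8 / (N : ℝ)) {u : RN N → ℝ} (hu : MemH2 u) :
    ∫⁻ x, ENNReal.ofReal (|u x| ^ p) ≤
      ENNReal.ofReal (4 * p / (p - 2) * (2 * Real.sqrt (ballVol N)) ^ (p - 2) *
        (Real.sqrt (l2sq u) ^ (p * (1 - gnExponent N p)) *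
          Real.sqrt (l2sq (weakLaplacian u)) ^ (p * gnExponent N p))) := by
  have hNR : (0 : ℝ) < N := by exact_mod_cast hN
  have hb := ballVol_pos N
  rcases (Real.sqrt_nonneg (l2sq u)).eq_or_lt with hA | hA
  · have h0 : u =ᵐ[volume] 0 := by
      have h1 := eLpNorm_two_eq_ofReal hu.memLp
      rw [← hA, ENNReal.ofReal_zero] at h1
      exact (eLpNorm_eq_zero_iff hu.memLp.1 two_ne_zero).1 h1
    have : ∫⁻ x, ENNReal.ofReal (|u x| ^ p) = 0 := by
      rw [lintegral_eq_zero_iff' (hu.memLp.1.aemeasurable.abs.pow_const p).ennreal_ofReal]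
      filter_upwards [h0] with x hx
      rw [hx]; simp [Real.zero_rpow (by linarith : p ≠ 0)]
    rw [this]; exact zero_le
  set A := Real.sqrt (l2sq u) with hAu
  set L := Real.sqrt (l2sq (weakLaplacian u)) with hL
  set θ := (N : ℝ) * (p - 2) / 8 with hθ
  have hθ0 : 0 < θ := by
    have : 0 < p - 2 := by linarith
    positivity
  have hθ1 : θ ≤ 1 := by
    rw [hθ, div_le_one (by norm_num)]
    have : p - 2 ≤ 8 / N := by linarith
    rw [le_div_iff₀ hNR] at this
    linarith
  have hγ : p * gnExponent N p = 2 * θ := by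
    rw [gnExponent, hθ]; field_simp [show p ≠ 0 by linarith]; ring
  have hγ' : p * (1 - gnExponent N p) = (p - 2) + 2 * (1 - θ) := by
    rw [mul_sub, hγ]; ring
  refine (lintegral_rpow_le_fourier hN hu.memLp hA hAu hp).trans ?_
  have hfac : ∀ ξ : RN N,
      ENNReal.ofReal ((2 * A * Real.sqrt (ballVol N) * ‖ξ‖ ^ ((N : ℝ) / 2)) ^ (p - 2)) *
        ‖l2Fourier u ξ‖ₑ ^ 2 = ENNReal.ofReal ((2 * Real.sqrt (ballVol N)) ^ (p - 2) * A ^ (p - 2)) *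
          (ENNReal.ofReal (‖ξ‖ ^ (4 * θ)) * ‖l2Fourier u ξ‖ₑ ^ 2) := by
    intro ξ
    rw [← mul_assoc, ← ENNReal.ofReal_mul (by positivity), ← Real.mul_rpow (by positivity) hA.le]
    congr 2
    rw [Real.mul_rpow (by positivity) (by positivity), ← Real.rpow_mul (norm_nonneg _)]
    congr 2
    · ring
    · rw [hθ]; ring
  simp_rw [hfac]
  rw [lintegral_const_mul' _ _ ENNReal.ofReal_ne_top, ← mul_assoc, ← ENNReal.ofReal_mul (by
    apply div_nonneg <;> linarith)]
  refine (mul_le_mul_right (lintegral_norm_rpow_mul_le hu hθ0 hθ1) _).trans ?_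
  have h1 : l2sq u = A ^ (2 : ℝ) := by
    rw [Real.rpow_two]; exact (Real.sq_sqrt (l2sq_nonneg u)).symm
  have h2 : l2sq (weakLaplacian u) = L ^ (2 : ℝ) := by
    rw [Real.rpow_two]; exact (Real.sq_sqrt (l2sq_nonneg _)).symm
  have hL0 : 0 ≤ L := Real.sqrt_nonneg _
  rw [h1, h2, ENNReal.ofReal_rpow_of_nonneg (by positivity) (by linarith),
    ENNReal.ofReal_rpow_of_nonneg (by positivity) hθ0.le, ← ENNReal.ofReal_mul (by positivity),
    ← Real.rpow_mul hA.le, ← Real.rpow_mul hL0, ← ENNReal.ofReal_mul (by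
      refine mul_nonneg (div_nonneg ?_ ?_) ?_ <;> first | linarith | positivity), hγ, hγ',
      Real.rpow_add hA]
  refine le_of_eq (congrArg _ ?_)
  ring

theorem eLpNorm_ofReal_eq {N : ℕ} {p : ℝ} (hp : 0 < p) (u : RN N → ℝ) :
    eLpNorm u (ENNReal.ofReal p) volume = (∫⁻ x, ENNReal.ofReal (|u x| ^ p)) ^ (1 / p) := by
  rw [eLpNorm_eq_lintegral_rpow_enorm_toReal (by simpa using hp) ENNReal.ofReal_ne_top,
    ENNReal.toReal_ofReal hp.le]
  congr 1
  refine lintegral_congr fun x => ?_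
  rw [← ENNReal.ofReal_rpow_of_nonneg (abs_nonneg _) hp.le, ← Real.norm_eq_abs, ofReal_norm]

/-- The optimal Gagliardo–Nirenberg constant satisfies the Gagliardo–Nirenberg inequality. -/
theorem eLpNorm_le_gnConst {N : ℕ} (hN : 1 ≤ N) {p : ℝ} (hp : 2 < p)
    (hp' : p ≤ 2 + 8 / (N : ℝ)) {u : RN N → ℝ} (hu : MemH2 u) :
    eLpNorm u (ENNReal.ofReal p) volume ≤
      ENNReal.ofReal (gnConst N p * Real.sqrt (l2sq u) ^ (1 - gnExponent N p) *
        Real.sqrt (l2sq (weakLaplacian u)) ^ gnExponent N p) := by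
  set S := {C : ℝ | 0 < C ∧ ∀ u : RN N → ℝ, MemH2 u →
    eLpNorm u (ENNReal.ofReal p) volume ≤
      ENNReal.ofReal (C * Real.sqrt (l2sq u) ^ (1 - gnExponent N p) *
        Real.sqrt (l2sq (weakLaplacian u)) ^ gnExponent N p)} with hS
  have hp0 : 0 < p := by linarith
  have hne : S.Nonempty := by
    obtain ⟨K, hK, hKu⟩ : ∃ K : ℝ, 0 < K ∧ ∀ u : RN N → ℝ, MemH2 u →
        ∫⁻ x, ENNReal.ofReal (|u x| ^ p) ≤ ENNReal.ofReal (K *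
          (Real.sqrt (l2sq u) ^ (p * (1 - gnExponent N p)) *
            Real.sqrt (l2sq (weakLaplacian u)) ^ (p * gnExponent N p))) := by
      have : 0 < p - 2 := by linarith
      have hb := ballVol_pos N
      exact ⟨_, by positivity, fun u hu => lintegral_rpow_le_gn hN hp hp' hu⟩
    refine ⟨K ^ (1 / p), Real.rpow_pos_of_pos hK _, fun u hu => ?_⟩
    rw [eLpNorm_ofReal_eq hp0]
    refine (ENNReal.rpow_le_rpow (hKu u hu) (by positivity)).trans ?_
    rw [ENNReal.ofReal_rpow_of_nonneg (by positivity) (by positivity),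
      Real.mul_rpow hK.le (by positivity), Real.mul_rpow (by positivity) (by positivity),
      ← Real.rpow_mul (Real.sqrt_nonneg _), ← Real.rpow_mul (Real.sqrt_nonneg _), ← mul_assoc]
    have h1 : p * (1 - gnExponent N p) * (1 / p) = 1 - gnExponent N p := by field_simp
    have h2 : p * gnExponent N p * (1 / p) = gnExponent N p := by field_simp
    rw [h1, h2]
  -- For fixed `u` the inequality is a closed condition on the constant, so it survives passage to
  -- the infimum; nonemptiness excludes the default value of `sInf`.
  have hcl : gnConst N p ∈ closure S := csInf_mem_closure hne ⟨0, fun C hC => hC.1.le⟩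
  have hclosed : IsClosed {C : ℝ | eLpNorm u (ENNReal.ofReal p) volume ≤
      ENNReal.ofReal (C * Real.sqrt (l2sq u) ^ (1 - gnExponent N p) *
        Real.sqrt (l2sq (weakLaplacian u)) ^ gnExponent N p)} := by
    refine isClosed_le continuous_const (ENNReal.continuous_ofReal.comp ?_)
    fun_prop
  exact closure_minimal (fun C hC => hC.2 u hu) hclosed hcl

theorem gnConst_nonneg (N : ℕ) (p : ℝ) : 0 ≤ gnConst N p := Real.sInf_nonneg fun _ h => h.1.le

theorem integrable_abs_rpow {N : ℕ} (hN : 1 ≤ N) {p : ℝ} (hp : 2 < p)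
    (hp' : p ≤ 2 + 8 / (N : ℝ)) {u : RN N → ℝ} (hu : MemH2 u) :
    Integrable fun x => |u x| ^ p := by
  refine ⟨(hu.memLp.1.aemeasurable.abs.pow_const p).aestronglyMeasurable, ?_⟩
  rw [hasFiniteIntegral_iff_ofReal (Eventually.of_forall fun x => by positivity)]
  exact (lintegral_rpow_le_gn hN hp hp' hu).trans_lt ENNReal.ofReal_lt_top

theorem integral_abs_rpow_le {N : ℕ} (hN : 1 ≤ N) {p : ℝ} (hp : 2 < p)
    (hp' : p ≤ 2 + 8 / (N : ℝ)) {u : RN N → ℝ} (hu : MemH2 u) :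
    ∫ x, |u x| ^ p ≤ gnConst N p ^ p * (Real.sqrt (l2sq u) ^ (p * (1 - gnExponent N p)) *
        Real.sqrt (l2sq (weakLaplacian u)) ^ (p * gnExponent N p)) := by
  have hp0 : 0 < p := by linarith
  have hg := gnConst_nonneg N p
  have h := eLpNorm_le_gnConst hN hp hp' hu
  rw [eLpNorm_ofReal_eq hp0, ← ofReal_integral_eq_lintegral_ofReal (integrable_abs_rpow hN hp hp' hu)
    (Eventually.of_forall fun x => by positivity)] at h
  have h2 := ENNReal.rpow_le_rpow h hp0.le
  rw [← ENNReal.rpow_mul, one_div, inv_mul_cancel₀ hp0.ne', ENNReal.rpow_one,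
    ENNReal.ofReal_rpow_of_nonneg (by positivity) hp0.le,
    ENNReal.ofReal_le_ofReal_iff (by positivity), Real.mul_rpow (by positivity) (by positivity),
    Real.mul_rpow (by positivity) (by positivity), ← Real.rpow_mul (Real.sqrt_nonneg _),
    ← Real.rpow_mul (Real.sqrt_nonneg _)] at h2
  rw [mul_comm p, mul_comm p, ← mul_assoc]
  exact h2

end

/-! ## Calculus in `H²` -/

section

open SchwartzMap Laplacian LineDeriv

theorem l2sq_congr {N : ℕ} {F : Type*} [NormedAddCommGroup F] {f g : RN N → F}
    (h : f =ᵐ[volume] g) : l2sq f = l2sq g :=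
  integral_congr_ae (h.mono fun x hx => by simp only [hx])

theorem integral_linear_mul {N : ℕ} {u v h : RN N → ℝ} (hu : MemLp u 2) (hv : MemLp v 2)
    (hh : MemLp h 2) (a b : ℝ) :
    ∫ x, (a * u x + b * v x) * h x = a * (∫ x, u x * h x) + b * (∫ x, v x * h x) := by
  rw [← integral_const_mul, ← integral_const_mul]
  refine Eq.trans ?_ (integral_add ((hu.integrable_mul hh).const_mul a)
    ((hv.integrable_mul hh).const_mul b))
  exact integral_congr_ae (Eventually.of_forall fun x => by simp only []; ring)

/-! ### Test functions -/

section TestFunctions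

variable {N : ℕ} {φ : RN N → ℝ}

theorem memLp_testFunction (hφ : ContDiff ℝ ∞ φ) (hc : HasCompactSupport φ) : MemLp φ 2 :=
  (hc.toSchwartzMap hφ).memLp 2 volume

theorem memLp_laplacian_testFunction (hφ : ContDiff ℝ ∞ φ) (hc : HasCompactSupport φ) :
    MemLp (Δ φ) 2 := by
  have h : (Δ (hc.toSchwartzMap hφ) : 𝓢(RN N, ℝ)) = Δ φ :=
    funext fun x => SchwartzMap.laplacian_apply _ x
  rw [← h]; exact SchwartzMap.memLp _ 2 volume

theorem memLp_fderiv_testFunction (hφ : ContDiff ℝ ∞ φ) (hc : HasCompactSupport φ) (e : RN N) :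
    MemLp (fun x => fderiv ℝ φ x e) 2 := by
  have h : (∂_{e} (hc.toSchwartzMap hφ) : 𝓢(RN N, ℝ)) = fun x => fderiv ℝ φ x e :=
    funext fun x => SchwartzMap.lineDerivOp_apply_eq_fderiv _ _ x
  rw [← h]; exact SchwartzMap.memLp _ 2 volume

theorem isWeakLaplacian_testFunction (hφ : ContDiff ℝ ∞ φ) (hc : HasCompactSupport φ) :
    IsWeakLaplacian φ (Δ φ) := by
  refine ⟨(memLp_laplacian_testFunction hφ hc).locallyIntegrable one_le_two, fun ψ hψ hc' => ?_⟩
  have h := SchwartzMap.integral_mul_laplacian_right_eq_left (μ := volume) (hc.toSchwartzMap hφ)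
    (hc'.toSchwartzMap hψ)
  simp only [SchwartzMap.laplacian_apply] at h
  exact h

theorem isWeakGradient_testFunction (hφ : ContDiff ℝ ∞ φ) (hc : HasCompactSupport φ) :
    IsWeakGradient φ (gradient φ) ∧ MemLp (gradient φ) 2 := by
  have hcont : Continuous (gradient φ) :=
    (LinearIsometryEquiv.continuous _).comp (hφ.continuous_fderiv (by simp))
  have hcs : HasCompactSupport (gradient φ) :=
    (hc.fderiv (𝕜 := ℝ)).comp_left (g := (InnerProductSpace.toDual ℝ (RN N)).symm) (map_zero _)
  refine ⟨⟨hcont.locallyIntegrable, fun ψ hψ hc' e => ?_⟩, hcont.memLp_of_hasCompactSupport hcs⟩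
  have h := SchwartzMap.integral_mul_lineDerivOp_right_eq_neg_left (μ := volume) (hc.toSchwartzMap hφ)
    (hc'.toSchwartzMap hψ) e
  simp only [SchwartzMap.lineDerivOp_apply_eq_fderiv] at h
  refine h.trans (congrArg _ (integral_congr_ae (Eventually.of_forall fun x => ?_)))
  simp only [gradient, InnerProductSpace.toDual_symm_apply]
  rfl

end TestFunctions

/-! ### The space `H²` -/

section Sobolev

variable {N : ℕ} {u v w w' : RN N → ℝ} {g g' : RN N → RN N}

/-- Uniqueness of weak Laplacians identifies the chosen representative with any explicit candidate.
Linear combinations, translates and weak limits are all handled this way. -/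
theorem memH2_of_weak (hu : MemLp u 2) (hg : IsWeakGradient u g) (hg2 : MemLp g 2)
    (hw : IsWeakLaplacian u w) (hw2 : MemLp w 2) : MemH2 u ∧ weakLaplacian u =ᵐ[volume] w := by
  have h : MemH2 u := ⟨hu, ⟨g, hg, hg2⟩, ⟨w, hw, hw2⟩⟩
  exact ⟨h, h.weakLaplacian_spec.1.ae_eq hw⟩

theorem MemH2.memLp_weakLaplacian (hu : MemH2 u) : MemLp (weakLaplacian u) 2 :=
  hu.weakLaplacian_spec.2

/-- Gradient terms become pairings of `u` with its Laplacian, so later limits only have to follow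
these two functions. -/
theorem MemH2.l2sq_weakGradient (hu : MemH2 u) :
    l2sq (weakGradient u) = -∫ x, u x * weakLaplacian u x :=
  hu.weakGradient_spec.1.l2sq_eq hu.weakLaplacian_spec.1 hu.memLp hu.weakGradient_spec.2
    hu.weakLaplacian_spec.2

theorem IsWeakLaplacian.linear (hu : MemLp u 2) (hv : MemLp v 2) (hw2 : MemLp w 2)
    (hw2' : MemLp w' 2) (h : IsWeakLaplacian u w) (h' : IsWeakLaplacian v w') (a b : ℝ) :
    IsWeakLaplacian (fun x => a * u x + b * v x) (fun x => a * w x + b * w' x) := by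
  refine ⟨((hw2.const_mul a).add (hw2'.const_mul b)).locallyIntegrable one_le_two,
    fun φ hφ hc => ?_⟩
  rw [integral_linear_mul hu hv (memLp_laplacian_testFunction hφ hc),
    integral_linear_mul hw2 hw2' (memLp_testFunction hφ hc), h.2 φ hφ hc, h'.2 φ hφ hc]

theorem IsWeakGradient.linear (hu : MemLp u 2) (hv : MemLp v 2) (hg2 : MemLp g 2)
    (hg2' : MemLp g' 2) (h : IsWeakGradient u g) (h' : IsWeakGradient v g') (a b : ℝ) :
    IsWeakGradient (fun x => a * u x + b * v x) (fun x => a • g x + b • g' x) := by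
  refine ⟨((hg2.const_smul a).add (hg2'.const_smul b)).locallyIntegrable one_le_two,
    fun φ hφ hc e => ?_⟩
  have e2 := integral_linear_mul (hg2.inner_const e) (hg2'.inner_const e)
    (memLp_testFunction hφ hc) a b
  rw [integral_linear_mul hu hv (memLp_fderiv_testFunction hφ hc e)]
  simp only [inner_add_left, real_inner_smul_left]
  rw [e2, h.2 φ hφ hc e, h'.2 φ hφ hc e]
  ring

theorem MemH2.linear (hu : MemH2 u) (hv : MemH2 v) (a b : ℝ) :
    MemH2 (fun x => a * u x + b * v x) ∧ weakLaplacian (fun x => a * u x + b * v x) =ᵐ[volume]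
      fun x => a * weakLaplacian u x + b * weakLaplacian v x :=
  memH2_of_weak ((hu.memLp.const_mul a).add (hv.memLp.const_mul b))
    (hu.weakGradient_spec.1.linear hu.memLp hv.memLp hu.weakGradient_spec.2 hv.weakGradient_spec.2
      hv.weakGradient_spec.1 a b)
    ((hu.weakGradient_spec.2.const_smul a).add (hv.weakGradient_spec.2.const_smul b))
    (hu.weakLaplacian_spec.1.linear hu.memLp hv.memLp hu.weakLaplacian_spec.2
      hv.weakLaplacian_spec.2 hv.weakLaplacian_spec.1 a b)
    ((hu.weakLaplacian_spec.2.const_mul a).add (hv.weakLaplacian_spec.2.const_mul b))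

theorem MemH2.const_mul (hu : MemH2 u) (a : ℝ) :
    MemH2 (fun x => a * u x) ∧ weakLaplacian (fun x => a * u x) =ᵐ[volume]
      fun x => a * weakLaplacian u x := by
  simpa using hu.linear hu a 0

theorem MemH2.sub (hu : MemH2 u) (hv : MemH2 v) :
    MemH2 (fun x => u x - v x) ∧ weakLaplacian (fun x => u x - v x) =ᵐ[volume]
      fun x => weakLaplacian u x - weakLaplacian v x := by
  simpa [sub_eq_add_neg] using hu.linear hv 1 (-1)

theorem memH2_zero : MemH2 (fun _ : RN N => (0 : ℝ)) :=
  ⟨MemLp.zero', ⟨fun _ => 0, ⟨locallyIntegrable_zero, by simp⟩, MemLp.zero'⟩,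
    ⟨fun _ => 0, ⟨locallyIntegrable_zero, by simp⟩, MemLp.zero'⟩⟩

theorem memH2_testFunction {φ : RN N → ℝ} (hφ : ContDiff ℝ ∞ φ) (hc : HasCompactSupport φ) :
    MemH2 φ ∧ weakLaplacian φ =ᵐ[volume] Δ φ :=
  memH2_of_weak (memLp_testFunction hφ hc) (isWeakGradient_testFunction hφ hc).1
    (isWeakGradient_testFunction hφ hc).2 (isWeakLaplacian_testFunction hφ hc)
    (memLp_laplacian_testFunction hφ hc)

theorem laplacian_comp_add_right (φ : RN N → ℝ) (y x : RN N) :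
    Δ (fun z => φ (z + y)) x = Δ φ (x + y) := by
  simp only [InnerProductSpace.laplacian_eq_iteratedFDeriv_stdOrthonormalBasis,
    iteratedFDeriv_comp_add_right]

theorem memLp_translate {F : Type*} [NormedAddCommGroup F] {f : RN N → F} {p : ℝ≥0∞}
    (hf : MemLp f p) (y : RN N) : MemLp (fun x => f (x - y)) p :=
  hf.comp_measurePreserving (measurePreserving_sub_right volume y)

theorem integral_translate_mul (f h : RN N → ℝ) (y : RN N) :
    ∫ x, f (x - y) * h x = ∫ x, f x * h (x + y) := by
  rw [← integral_sub_right_eq_self (fun x => f x * h (x + y)) y]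
  simp

theorem IsWeakLaplacian.translate (hw2 : MemLp w 2) (h : IsWeakLaplacian u w) (y : RN N) :
    IsWeakLaplacian (fun x => u (x - y)) (fun x => w (x - y)) := by
  refine ⟨(memLp_translate hw2 y).locallyIntegrable one_le_two, fun φ hφ hc => ?_⟩
  have := h.2 (fun z => φ (z + y)) (hφ.comp (contDiff_id.add contDiff_const))
    (hc.comp_homeomorph (Homeomorph.addRight y))
  rw [integral_translate_mul, integral_translate_mul, ← this]
  simp only [laplacian_comp_add_right]

theorem IsWeakGradient.translate (hg2 : MemLp g 2) (h : IsWeakGradient u g) (y : RN N) :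
    IsWeakGradient (fun x => u (x - y)) (fun x => g (x - y)) := by
  refine ⟨(memLp_translate hg2 y).locallyIntegrable one_le_two, fun φ hφ hc e => ?_⟩
  have := h.2 (fun z => φ (z + y)) (hφ.comp (contDiff_id.add contDiff_const))
    (hc.comp_homeomorph (Homeomorph.addRight y)) e
  rw [integral_translate_mul, integral_translate_mul (fun x => inner ℝ (g x) e), ← this]
  simp only [fderiv_comp_add_right]

theorem MemH2.translate (hu : MemH2 u) (y : RN N) :
    MemH2 (fun x => u (x - y)) ∧ weakLaplacian (fun x => u (x - y)) =ᵐ[volume]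
      fun x => weakLaplacian u (x - y) :=
  memH2_of_weak (memLp_translate hu.memLp y)
    (hu.weakGradient_spec.1.translate hu.weakGradient_spec.2 y)
    (memLp_translate hu.weakGradient_spec.2 y)
    (hu.weakLaplacian_spec.1.translate hu.weakLaplacian_spec.2 y)
    (memLp_translate hu.weakLaplacian_spec.2 y)

theorem l2sq_translate {F : Type*} [NormedAddCommGroup F] (f : RN N → F) (y : RN N) :
    l2sq (fun x => f (x - y)) = l2sq f :=
  integral_sub_right_eq_self (fun x => ‖f x‖ ^ 2) y

theorem l2sq_const_mul (a : ℝ) (f : RN N → ℝ) : l2sq (fun x => a * f x) = a ^ 2 * l2sq f := by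
  simp only [l2sq, norm_mul, mul_pow, integral_const_mul, Real.norm_eq_abs, sq_abs]

theorem eq_zero_ae_of_l2sq_eq_zero (hu : MemLp u 2) (h : l2sq u = 0) : u =ᵐ[volume] 0 := by
  have h1 := eLpNorm_two_eq_ofReal hu
  rw [h, Real.sqrt_zero, ENNReal.ofReal_zero] at h1
  exact (eLpNorm_eq_zero_iff hu.1 two_ne_zero).1 h1

/-- Cauchy–Schwarz. -/
theorem abs_integral_mul_le (hu : MemLp u 2) (hv : MemLp v 2) :
    |∫ x, u x * v x| ≤ Real.sqrt (l2sq u) * Real.sqrt (l2sq v) := by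
  have h := abs_real_inner_le_norm (hu.toLp) (hv.toLp)
  rw [L2.inner_def, Lp.norm_toLp, Lp.norm_toLp, eLpNorm_two_eq_ofReal hu, eLpNorm_two_eq_ofReal hv,
    ENNReal.toReal_ofReal (Real.sqrt_nonneg _), ENNReal.toReal_ofReal (Real.sqrt_nonneg _)] at h
  refine le_of_eq_of_le (congrArg _ (integral_congr_ae ?_)) h
  filter_upwards [hu.coeFn_toLp, hv.coeFn_toLp] with x h1 h2
  rw [h1, h2]
  simp [mul_comm]

end Sobolev

end

/-! ## Weak compactness and local strong convergence -/

section

/-- Bounded sequences in a separable Hilbert space have weakly convergent subsequences. -/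
theorem exists_weak_limit_of_norm_le {H : Type*} [NormedAddCommGroup H] [InnerProductSpace ℝ H]
    [CompleteSpace H] [TopologicalSpace.SeparableSpace H] (x : ℕ → H) {C : ℝ}
    (hx : ∀ n, ‖x n‖ ≤ C) : ∃ (φ : ℕ → ℕ) (z : H), StrictMono φ ∧
      ∀ y, Tendsto (fun n => inner ℝ (x (φ n)) y) atTop (𝓝 (inner ℝ z y)) := by
  let T := InnerProductSpace.toDual ℝ H
  have hmem : ∀ n, StrongDual.toWeakDual (T (x n)) ∈
      (WeakDual.toStrongDual ⁻¹' Metric.closedBall (0 : StrongDual ℝ H) C) := fun n => by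
    change T (x n) ∈ Metric.closedBall (0 : StrongDual ℝ H) C
    rw [mem_closedBall_zero_iff, LinearIsometryEquiv.norm_map]
    exact hx n
  obtain ⟨z, -, φ, hφ, hlim⟩ := WeakDual.isSeqCompact_closedBall ℝ H 0 C hmem
  refine ⟨φ, T.symm (WeakDual.toStrongDual z), hφ, fun y => ?_⟩
  have h := ((WeakDual.eval_continuous y).tendsto z).comp hlim
  have e : inner ℝ (T.symm (WeakDual.toStrongDual z)) y = z y := by
    rw [InnerProductSpace.toDual_symm_apply]; rfl
  rw [e]
  exact h

/-- Vector values are allowed because weak limits of gradients are needed to see that the limit lies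
in H². -/
theorem exists_weak_limit_of_l2sq_le {N : ℕ} {F : Type*} [NormedAddCommGroup F]
    [InnerProductSpace ℝ F] [CompleteSpace F] [TopologicalSpace.SeparableSpace F]
    (f : ℕ → RN N → F) (hf : ∀ n, MemLp (f n) 2) {C : ℝ} (hC : ∀ n, l2sq (f n) ≤ C) :
    ∃ (φ : ℕ → ℕ) (g : RN N → F), StrictMono φ ∧ MemLp g 2 ∧ ∀ h : RN N → F, MemLp h 2 →
      Tendsto (fun n => ∫ x, inner ℝ (f (φ n) x) (h x)) atTop (𝓝 (∫ x, inner ℝ (g x) (h x))) := by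
  have hb : ∀ n, ‖(hf n).toLp‖ ≤ Real.sqrt C := fun n => by
    rw [Lp.norm_toLp, eLpNorm_two_eq_ofReal (hf n), ENNReal.toReal_ofReal (Real.sqrt_nonneg _)]
    exact Real.sqrt_le_sqrt (hC n)
  have : Fact ((2 : ℝ≥0∞) ≠ ⊤) := ⟨by simp⟩
  obtain ⟨φ, z, hφ, hz⟩ := exists_weak_limit_of_norm_le (fun n => (hf n).toLp) hb
  refine ⟨φ, z, hφ, Lp.memLp z, fun h hh => ?_⟩
  have e : ∀ (k : RN N → F) (q : Lp F 2 (volume : Measure (RN N))), q =ᵐ[volume] k →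
      inner ℝ q hh.toLp = ∫ x, inner ℝ (k x) (h x) := fun k q hq => by
    rw [L2.inner_def]
    refine integral_congr_ae ?_
    filter_upwards [hq, hh.coeFn_toLp] with x h1 h2
    rw [h1, h2]
  have h1 := hz hh.toLp
  rw [e z z (ae_eq_refl _)] at h1
  exact h1.congr fun n => e _ _ (hf (φ n)).coeFn_toLp

/-- Weak convergence in `L²(ℝ^N)`. -/
def WeakTendsto {N : ℕ} (f : ℕ → RN N → ℝ) (g : RN N → ℝ) : Prop :=
  ∀ h : RN N → ℝ, MemLp h 2 → Tendsto (fun n => ∫ x, f n x * h x) atTop (𝓝 (∫ x, g x * h x))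

theorem exists_weakTendsto {N : ℕ} (f : ℕ → RN N → ℝ) (hf : ∀ n, MemLp (f n) 2) {C : ℝ}
    (hC : ∀ n, l2sq (f n) ≤ C) :
    ∃ (φ : ℕ → ℕ) (g : RN N → ℝ), StrictMono φ ∧ MemLp g 2 ∧ WeakTendsto (fun n => f (φ n)) g := by
  obtain ⟨φ, g, hφ, hg, h⟩ := exists_weak_limit_of_l2sq_le f hf hC
  refine ⟨φ, g, hφ, hg, fun k hk => ?_⟩
  simpa [mul_comm] using h k hk

/-- Green's formula and Cauchy–Schwarz. At bounded mass the gradient term thus grows only like the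
square root of the squared Laplacian norm. -/
theorem MemH2.l2sq_weakGradient_le {N : ℕ} {u : RN N → ℝ} (hu : MemH2 u) :
    l2sq (weakGradient u) ≤ Real.sqrt (l2sq u) * Real.sqrt (l2sq (weakLaplacian u)) := by
  rw [hu.l2sq_weakGradient]
  exact (neg_le_abs _).trans (abs_integral_mul_le hu.memLp hu.memLp_weakLaplacian)

/-- Bounded sequences in `H²` have weakly convergent subsequences. -/
theorem exists_weakTendsto_memH2 {N : ℕ} (u : ℕ → RN N → ℝ) (hu : ∀ n, MemH2 (u n)) {C : ℝ}
    (hC : ∀ n, l2sq (u n) ≤ C) (hC' : ∀ n, l2sq (weakLaplacian (u n)) ≤ C) :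
    ∃ (φ : ℕ → ℕ) (U : RN N → ℝ), StrictMono φ ∧ MemH2 U ∧ WeakTendsto (fun n => u (φ n)) U ∧
      WeakTendsto (fun n => weakLaplacian (u (φ n))) (weakLaplacian U) := by
  obtain ⟨φ₁, U, hφ₁, hU, hlim₁⟩ := exists_weakTendsto u (fun n => (hu n).memLp) hC
  obtain ⟨φ₂, W, hφ₂, hW, hlim₂⟩ := exists_weakTendsto (fun n => weakLaplacian (u (φ₁ n)))
    (fun n => (hu _).memLp_weakLaplacian) (fun n => hC' _)
  obtain ⟨φ₃, G, hφ₃, hG, hlim₃⟩ := exists_weak_limit_of_l2sq_le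
    (fun n => weakGradient (u (φ₁ (φ₂ n)))) (fun n => (hu _).weakGradient_spec.2)
    (C := Real.sqrt C * Real.sqrt C) (fun n => (hu _).l2sq_weakGradient_le.trans (by
      gcongr
      · exact hC _
      · exact hC' _))
  have hl1 : WeakTendsto (fun n => u (φ₁ (φ₂ (φ₃ n)))) U := fun h hh =>
    (hlim₁ h hh).comp (hφ₂.comp hφ₃).tendsto_atTop
  have hl2 : WeakTendsto (fun n => weakLaplacian (u (φ₁ (φ₂ (φ₃ n))))) W := fun h hh =>
    (hlim₂ h hh).comp hφ₃.tendsto_atTop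
  -- The defining identities are pairings with L² functions on both sides, so they pass to the weak
  -- limit.
  have hwW : IsWeakLaplacian U W := by
    refine ⟨hW.locallyIntegrable one_le_two, fun φ hφ hc => ?_⟩
    refine tendsto_nhds_unique (hl1 _ (memLp_laplacian_testFunction hφ hc)) ?_
    refine (hl2 _ (memLp_testFunction hφ hc)).congr fun n => ?_
    exact ((hu _).weakLaplacian_spec.1.2 φ hφ hc).symm
  have hwG : IsWeakGradient U G := by
    refine ⟨hG.locallyIntegrable one_le_two, fun φ hφ hc e => ?_⟩
    refine tendsto_nhds_unique (hl1 _ (memLp_fderiv_testFunction hφ hc e)) ?_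
    have hm : MemLp (fun x => φ x • e) 2 := by
      have hcont : Continuous fun x => φ x • e := hφ.continuous.smul continuous_const
      exact hcont.memLp_of_hasCompactSupport hc.smul_right
    have h3 := (hlim₃ _ hm).neg
    have e1 : ∀ g : RN N → RN N, ∫ x, inner ℝ (g x) (φ x • e) = ∫ x, inner ℝ (g x) e * φ x :=
      fun g => integral_congr_ae (Eventually.of_forall fun x => by
        simp only [real_inner_smul_right, mul_comm])
    simp only [e1] at h3
    refine h3.congr fun n => ?_
    exact ((hu _).weakGradient_spec.1.2 φ hφ hc e).symm
  obtain ⟨hU2, hae⟩ := memH2_of_weak hU hwG hG hwW hW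
  refine ⟨fun n => φ₁ (φ₂ (φ₃ n)), U, hφ₁.comp (hφ₂.comp hφ₃), hU2, hl1, fun h hh => ?_⟩
  have : ∫ x, weakLaplacian U x * h x = ∫ x, W x * h x :=
    integral_congr_ae (hae.mono fun x hx => by simp only [hx])
  rw [this]
  exact hl2 h hh

theorem WeakTendsto.sub {N : ℕ} {f f' : ℕ → RN N → ℝ} {g g' : RN N → ℝ} (hf : ∀ n, MemLp (f n) 2)
    (hf' : ∀ n, MemLp (f' n) 2) (hg : MemLp g 2) (hg' : MemLp g' 2) (h : WeakTendsto f g)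
    (h' : WeakTendsto f' g') : WeakTendsto (fun n x => f n x - f' n x) (fun x => g x - g' x) := by
  intro k hk
  have e : ∀ {a b : RN N → ℝ}, MemLp a 2 → MemLp b 2 →
      ∫ x, (a x - b x) * k x = (∫ x, a x * k x) - ∫ x, b x * k x := fun ha hb => by
    have := integral_linear_mul ha hb hk 1 (-1)
    simpa [sub_eq_add_neg] using this
  simp only [e (hf _) (hf' _), e hg hg']
  exact (h k hk).sub (h' k hk)

theorem enorm_add_sq_le {E : Type*} [SeminormedAddCommGroup E] (a b : E) :
    ‖a + b‖ₑ ^ 2 ≤ 2 * ‖a‖ₑ ^ 2 + 2 * ‖b‖ₑ ^ 2 := by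
  rw [← ofReal_norm, ← ofReal_norm, ← ofReal_norm, ← ENNReal.ofReal_pow (norm_nonneg _),
    ← ENNReal.ofReal_pow (norm_nonneg _), ← ENNReal.ofReal_pow (norm_nonneg _),
    show (2 : ℝ≥0∞) = ENNReal.ofReal 2 by simp, ← ENNReal.ofReal_mul zero_le_two,
    ← ENNReal.ofReal_mul zero_le_two, ← ENNReal.ofReal_add (by positivity) (by positivity)]
  refine ENNReal.ofReal_le_ofReal ?_
  have := norm_add_le a b
  nlinarith [norm_nonneg (a + b), sq_nonneg (‖a‖ - ‖b‖)]

/-- Frequencies above `R` carry little mass. -/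
theorem lintegral_sub_freqPart_le {N : ℕ} {u : RN N → ℝ} (hu : MemH2 u) {R : ℝ} (hR : 0 < R) :
    ∫⁻ x, ‖(u x : ℂ) - freqPart (Metric.closedBall 0 R) u x‖ₑ ^ 2 ≤
      ENNReal.ofReal (l2sq (weakLaplacian u) / R ^ 4) := by
  rw [← eLpNorm_two_sq_eq_lintegral, eLpNorm_sub_freqPart measurableSet_closedBall
    measure_closedBall_lt_top.ne hu.memLp, eLpNorm_two_sq_eq_lintegral]
  calc ∫⁻ ξ, ‖(Metric.closedBall 0 R)ᶜ.indicator (l2Fourier u) ξ‖ₑ ^ 2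
      ≤ ∫⁻ ξ, ENNReal.ofReal (1 / R ^ 4) * (ENNReal.ofReal (‖ξ‖ ^ 4) * ‖l2Fourier u ξ‖ₑ ^ 2) := by
        refine lintegral_mono fun ξ => ?_
        by_cases h : ξ ∈ (Metric.closedBall (0 : RN N) R)ᶜ
        · rw [Set.indicator_of_mem h, ← mul_assoc, ← ENNReal.ofReal_mul (by positivity)]
          refine le_mul_of_one_le_left zero_le ?_
          rw [← ENNReal.ofReal_one]
          refine ENNReal.ofReal_le_ofReal ?_
          have h1 : R < ‖ξ‖ := by simpa using h
          rw [one_div, inv_mul_eq_div, le_div_iff₀ (by positivity), one_mul]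
          gcongr
        · rw [Set.indicator_of_notMem h]; simp
    _ = ENNReal.ofReal (1 / R ^ 4) * ∫⁻ ξ, ENNReal.ofReal (‖ξ‖ ^ 4) * ‖l2Fourier u ξ‖ₑ ^ 2 :=
        lintegral_const_mul' _ _ ENNReal.ofReal_ne_top
    _ ≤ ENNReal.ofReal (1 / R ^ 4) * ENNReal.ofReal (l2sq (weakLaplacian u)) := by
        gcongr; exact lintegral_norm_pow_four_mul_le hu
    _ = _ := by rw [← ENNReal.ofReal_mul (by positivity)]; ring_nf

theorem measurable_freqPart {N : ℕ} {K : Set (RN N)} (hK : MeasurableSet K)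
    (hK' : volume K ≠ ⊤) (u : RN N → ℝ) : Measurable (freqPart K u) :=
  (VectorFourier.fourierIntegral_continuous Real.continuous_fourierChar
      (L := -innerₗ (RN N)) (continuous_inner (𝕜 := ℝ) (E := RN N)).neg
      (integrable_indicator_l2Fourier hK hK' u)).measurable

/-- **Rellich's theorem**: weak convergence to zero and bounded Laplacians give strong local
convergence. -/
theorem WeakTendsto.tendsto_lintegral_ball {N : ℕ} {w : ℕ → RN N → ℝ} (hw : ∀ n, MemH2 (w n))
    {C : ℝ} (hC : ∀ n, l2sq (w n) ≤ C) (hC' : ∀ n, l2sq (weakLaplacian (w n)) ≤ C)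
    (h : WeakTendsto w 0) (r : ℝ) :
    Tendsto (fun n => ∫⁻ x in Metric.ball 0 r, ‖w n x‖ₑ ^ 2) atTop (𝓝 0) := by
  have hC0 : 0 ≤ C := (l2sq_nonneg _).trans (hC 0)
  rw [ENNReal.tendsto_nhds_zero]
  intro ε hε
  -- The bound on the Laplacians makes frequencies above `R` uniformly small in L², leaving only the
  -- low part to be studied.
  obtain ⟨R, hR, hRε⟩ : ∃ R : ℝ, 0 < R ∧ 2 * ENNReal.ofReal (C / R ^ 4) ≤ ε / 2 := by
    have h1 : Tendsto (fun R : ℝ => 2 * ENNReal.ofReal (C / R ^ 4)) atTop (𝓝 (2 * 0)) := by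
      refine ENNReal.Tendsto.const_mul ?_ (Or.inr (by simp))
      rw [← ENNReal.ofReal_zero]
      exact ENNReal.tendsto_ofReal (tendsto_const_nhds.div_atTop (tendsto_pow_atTop (by norm_num)))
    rw [mul_zero] at h1
    have h2 := (h1.eventually (ge_mem_nhds (ENNReal.half_pos hε.ne'))).and (eventually_gt_atTop 0)
    obtain ⟨R, h3, h4⟩ := h2.exists
    exact ⟨R, h4, h3⟩
  set K := Metric.closedBall (0 : RN N) R
  have hKm : MeasurableSet K := measurableSet_closedBall
  have hK : volume K ≠ ⊤ := measure_closedBall_lt_top.ne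
  set M := volume K ^ (1 / 2 : ℝ) * ENNReal.ofReal (Real.sqrt C)
  have hM : M ≠ ⊤ := ENNReal.mul_ne_top (ENNReal.rpow_ne_top_of_nonneg (by norm_num) hK)
    ENNReal.ofReal_ne_top
  -- Each value of the low part is a pairing with a fixed L² kernel, so it tends to 0 pointwise; the
  -- uniform bound `M` is integrable over the ball.
  have hlim : Tendsto (fun n => ∫⁻ x in Metric.ball 0 r, ‖freqPart K (w n) x‖ₑ ^ 2) atTop (𝓝 0) := by
    have := tendsto_lintegral_of_dominated_convergence (μ := volume.restrict (Metric.ball (0 : RN N) r))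
      (F := fun n x => ‖freqPart K (w n) x‖ₑ ^ 2) (f := fun _ => 0) (fun _ => M ^ 2)
      (fun n => (measurable_freqPart hKm hK (w n)).enorm.pow_const 2)
      (fun n => Eventually.of_forall fun x => ?_) ?_ (Eventually.of_forall fun x => ?_)
    · simpa using this
    · refine pow_le_pow_left₀ zero_le ((enorm_freqPart_le hKm _ x).trans ?_) 2
      rw [eLpNorm_l2Fourier (hw n).memLp, eLpNorm_two_eq_ofReal (hw n).memLp]
      refine mul_le_mul_right ?_ _
      exact ENNReal.ofReal_le_ofReal (Real.sqrt_le_sqrt (hC n))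
    · rw [lintegral_const, Measure.restrict_apply_univ]
      exact ENNReal.mul_ne_top (ENNReal.pow_ne_top hM) measure_ball_lt_top.ne
    · obtain ⟨k₁, k₂, hk₁, hk₂, hk⟩ := exists_kernel_freqPart hKm hK x
      have h1 := h k₁ hk₁
      have h2 := h k₂ hk₂
      simp only [Pi.zero_apply, zero_mul, integral_zero] at h1 h2
      have h3 : Tendsto (fun n => freqPart K (w n) x) atTop (𝓝 0) := by
        simp only [hk _ (hw _).memLp]
        have h4 := (Complex.continuous_ofReal.tendsto _).comp h1
        have h5 := ((Complex.continuous_ofReal.tendsto _).comp h2).mul_const Complex.I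
        simpa using h4.add h5
      have h6 := (ENNReal.continuous_pow 2).tendsto _ |>.comp h3.enorm
      simpa [Function.comp_def] using h6
  have hlim2 : Tendsto (fun n => 2 * ∫⁻ x in Metric.ball 0 r, ‖freqPart K (w n) x‖ₑ ^ 2) atTop
      (𝓝 0) := by
    simpa using ENNReal.Tendsto.const_mul hlim (Or.inr (by simp : (2 : ℝ≥0∞) ≠ ⊤))
  filter_upwards [hlim2.eventually (ge_mem_nhds (ENNReal.half_pos hε.ne'))] with n hn
  calc ∫⁻ x in Metric.ball 0 r, ‖w n x‖ₑ ^ 2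
      ≤ ∫⁻ x in Metric.ball 0 r, (2 * ‖(w n x : ℂ) - freqPart K (w n) x‖ₑ ^ 2 +
          2 * ‖freqPart K (w n) x‖ₑ ^ 2) := by
        refine lintegral_mono fun x => ?_
        have h1 := enorm_add_sq_le ((w n x : ℂ) - freqPart K (w n) x) (freqPart K (w n) x)
        rw [sub_add_cancel] at h1
        have h2 : ‖(w n x : ℂ)‖ₑ = ‖w n x‖ₑ := by
          rw [← ofReal_norm, ← ofReal_norm, Complex.norm_real]
        rwa [h2] at h1
    _ = (∫⁻ x in Metric.ball 0 r, 2 * ‖(w n x : ℂ) - freqPart K (w n) x‖ₑ ^ 2) +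
          ∫⁻ x in Metric.ball 0 r, 2 * ‖freqPart K (w n) x‖ₑ ^ 2 :=
        lintegral_add_right _ (((measurable_freqPart hKm hK (w n)).enorm.pow_const 2).const_mul 2)
    _ = 2 * (∫⁻ x in Metric.ball 0 r, ‖(w n x : ℂ) - freqPart K (w n) x‖ₑ ^ 2) +
          2 * ∫⁻ x in Metric.ball 0 r, ‖freqPart K (w n) x‖ₑ ^ 2 := by
        rw [lintegral_const_mul' _ _ (by simp), lintegral_const_mul' _ _ (by simp)]
    _ ≤ 2 * ENNReal.ofReal (C / R ^ 4) + ε / 2 := by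
        gcongr
        refine (setLIntegral_le_lintegral _ _).trans ((lintegral_sub_freqPart_le (hw n) hR).trans ?_)
        refine ENNReal.ofReal_le_ofReal ?_
        gcongr
        exact hC' n
    _ ≤ ε := by
        refine (add_le_add_left hRε _).trans ?_
        rw [ENNReal.add_halves]

end

/-! ## Almost everywhere convergence and the Brezis–Lieb splitting -/

section

/-- The weight (1 + ‖x‖)⁻¹ turns local into global L² convergence, because bounded mass makes the
weighted tails uniformly small. One extraction then suffices, without a diagonal argument over
balls. -/
theorem WeakTendsto.exists_ae_tendsto {N : ℕ} {w : ℕ → RN N → ℝ} (hw : ∀ n, MemH2 (w n))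
    {C : ℝ} (hC : ∀ n, l2sq (w n) ≤ C) (hC' : ∀ n, l2sq (weakLaplacian (w n)) ≤ C)
    (h : WeakTendsto w 0) :
    ∃ φ : ℕ → ℕ, StrictMono φ ∧ ∀ᵐ x, Tendsto (fun n => w (φ n) x) atTop (𝓝 0) := by
  have hC0 : 0 ≤ C := (l2sq_nonneg _).trans (hC 0)
  set f : ℕ → RN N → ℝ := fun n x => (1 + ‖x‖)⁻¹ * w n x with hf
  have hmeas : ∀ n, AEStronglyMeasurable (f n) volume := fun n => by
    refine AEStronglyMeasurable.mul (Continuous.aestronglyMeasurable ?_) (hw n).memLp.1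
    exact Continuous.inv₀ (by fun_prop) fun x => by positivity
  have hsq : Tendsto (fun n => ∫⁻ x, ‖f n x‖ₑ ^ 2) atTop (𝓝 0) := by
    rw [ENNReal.tendsto_nhds_zero]
    intro ε hε
    obtain ⟨R, hR, hRε⟩ : ∃ R : ℝ, 0 < R ∧ ENNReal.ofReal (C / (1 + R) ^ 2) ≤ ε / 2 := by
      have h1 : Tendsto (fun R : ℝ => ENNReal.ofReal (C / (1 + R) ^ 2)) atTop (𝓝 0) := by
        rw [← ENNReal.ofReal_zero]
        refine ENNReal.tendsto_ofReal (tendsto_const_nhds.div_atTop ?_)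
        exact (tendsto_pow_atTop two_ne_zero).comp (tendsto_atTop_add_const_left _ 1 tendsto_id)
      have h2 := (h1.eventually (ge_mem_nhds (ENNReal.half_pos hε.ne'))).and
        (eventually_gt_atTop 0)
      obtain ⟨R, h3, h4⟩ := h2.exists
      exact ⟨R, h4, h3⟩
    filter_upwards [(h.tendsto_lintegral_ball hw hC hC' R).eventually
      (ge_mem_nhds (ENNReal.half_pos hε.ne'))] with n hn
    have hfn : ∀ x, ‖f n x‖ₑ ^ 2 = ENNReal.ofReal ((1 + ‖x‖)⁻¹ ^ 2) * ‖w n x‖ₑ ^ 2 := fun x => by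
      rw [hf, enorm_mul, mul_pow, Real.enorm_eq_ofReal (by positivity : 0 ≤ (1 + ‖x‖)⁻¹),
        ENNReal.ofReal_pow (by positivity)]
    rw [← lintegral_add_compl _ (measurableSet_ball (x := (0 : RN N)) (ε := R))]
    refine (add_le_add (b := ε / 2) (d := ε / 2) ?_ ?_).trans (ENNReal.add_halves ε).le
    · refine (lintegral_mono fun x => ?_).trans hn
      simp only [hfn]
      refine mul_le_of_le_one_left zero_le ?_
      rw [← ENNReal.ofReal_one]
      refine ENNReal.ofReal_le_ofReal (pow_le_one₀ (by positivity) (inv_le_one_of_one_le₀ ?_))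
      linarith [norm_nonneg x]
    · calc ∫⁻ x in (Metric.ball 0 R)ᶜ, ‖f n x‖ₑ ^ 2
          ≤ ∫⁻ x in (Metric.ball 0 R)ᶜ, ENNReal.ofReal ((1 + R)⁻¹ ^ 2) * ‖w n x‖ₑ ^ 2 := by
            refine setLIntegral_mono' measurableSet_ball.compl fun x hx => ?_
            rw [hfn]
            have hx' : R ≤ ‖x‖ := by simpa using hx
            gcongr
        _ ≤ ∫⁻ x, ENNReal.ofReal ((1 + R)⁻¹ ^ 2) * ‖w n x‖ₑ ^ 2 := setLIntegral_le_lintegral _ _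
        _ = ENNReal.ofReal ((1 + R)⁻¹ ^ 2) * ENNReal.ofReal (l2sq (w n)) := by
            rw [lintegral_const_mul' _ _ ENNReal.ofReal_ne_top, ofReal_l2sq (hw n).memLp]
        _ ≤ ENNReal.ofReal (C / (1 + R) ^ 2) := by
            rw [← ENNReal.ofReal_mul (by positivity)]
            refine ENNReal.ofReal_le_ofReal ?_
            rw [inv_pow, inv_mul_eq_div]
            gcongr
            exact hC n
        _ ≤ ε / 2 := hRε
  have hL : Tendsto (fun n => eLpNorm (f n - 0) 2 volume) atTop (𝓝 0) := by
    have h2 := (ENNReal.continuous_rpow_const (y := (1 / 2 : ℝ))).tendsto 0 |>.comp hsq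
    rw [ENNReal.zero_rpow_of_pos (by norm_num)] at h2
    refine h2.congr fun n => ?_
    rw [sub_zero, Function.comp_apply, ← eLpNorm_two_sq_eq_lintegral, ← ENNReal.rpow_two,
      ← ENNReal.rpow_mul]
    norm_num
  obtain ⟨φ, hφ, hae⟩ := (tendstoInMeasure_of_tendsto_eLpNorm two_ne_zero hmeas
    aestronglyMeasurable_zero hL).exists_seq_tendsto_ae
  refine ⟨φ, hφ, hae.mono fun x hx => ?_⟩
  have h3 := hx.const_mul (1 + ‖x‖)
  have h4 : (1 + ‖x‖) ≠ 0 := by positivity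
  simpa [hf, mul_inv_cancel_left₀ h4] using h3

/-! ### The coupling term -/

section Coupling

variable {p q : ℝ}

theorem continuous_coupling (hp : 0 < p) (hq : 0 < q) :
    Continuous fun a : ℝ × ℝ => |a.1| ^ p * |a.2| ^ q :=
  (continuous_fst.abs.rpow_const fun _ => Or.inr hp.le).mul
    (continuous_snd.abs.rpow_const fun _ => Or.inr hq.le)

theorem coupling_le_norm (hp : 0 < p) (hq : 0 < q) (a : ℝ × ℝ) :
    |a.1| ^ p * |a.2| ^ q ≤ ‖a‖ ^ (p + q) := by
  rw [Real.rpow_add_of_nonneg (norm_nonneg _) hp.le hq.le]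
  gcongr
  · exact norm_fst_le a
  · exact norm_snd_le a

theorem norm_rpow_le (a : ℝ × ℝ) : ‖a‖ ^ p ≤ |a.1| ^ p + |a.2| ^ p := by
  rcases max_cases ‖a.1‖ ‖a.2‖ with h | h
  · rw [Prod.norm_def, h.1, Real.norm_eq_abs]
    exact le_add_of_nonneg_right (by positivity)
  · rw [Prod.norm_def, h.1, Real.norm_eq_abs]
    exact le_add_of_nonneg_left (by positivity)

theorem coupling_le_add (hp : 0 < p) (hq : 0 < q) (s t : ℝ) :
    |s| ^ p * |t| ^ q ≤ |s| ^ (p + q) + |t| ^ (p + q) :=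
  (coupling_le_norm hp hq (s, t)).trans (norm_rpow_le (s, t))

theorem coupling_smul (hp : 0 < p) (hq : 0 < q) {c : ℝ} (hc : 0 ≤ c) (s t : ℝ) :
    |c * s| ^ p * |c * t| ^ q = c ^ (p + q) * (|s| ^ p * |t| ^ q) := by
  rw [abs_mul, abs_mul, abs_of_nonneg hc, Real.mul_rpow hc (abs_nonneg _),
    Real.mul_rpow hc (abs_nonneg _), Real.rpow_add_of_nonneg hc hp.le hq.le]
  ring

/-- The elementary inequality behind the Brezis–Lieb lemma for the coupling term. -/
theorem exists_coupling_sub_le (hp : 0 < p) (hq : 0 < q) {ε : ℝ} (hε : 0 < ε) :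
    ∃ C : ℝ, 0 ≤ C ∧ ∀ a b : ℝ × ℝ,
      |(|(a + b).1| ^ p * |(a + b).2| ^ q - |a.1| ^ p * |a.2| ^ q)| ≤
        ε * (|a.1| ^ (p + q) + |a.2| ^ (p + q)) + C * (|b.1| ^ (p + q) + |b.2| ^ (p + q)) := by
  have hpq : 0 < p + q := add_pos hp hq
  have hu := (isCompact_closedBall (0 : ℝ × ℝ) 2).uniformContinuousOn_of_continuous
    (continuous_coupling hp hq).continuousOn
  rw [Metric.uniformContinuousOn_iff] at hu
  obtain ⟨δ', hδ', hδε⟩ := hu ε hε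
  -- The cap at 1 keeps the rescaled sum in the ball of radius 2 where uniform continuity is
  -- available.
  set δ := min δ' 1 with hδd
  have hδ : 0 < δ := lt_min hδ' one_pos
  refine ⟨(δ⁻¹ + 1) ^ (p + q), by positivity, fun a b => ?_⟩
  have ha0 : 0 ≤ ε * (|a.1| ^ (p + q) + |a.2| ^ (p + q)) := by positivity
  have hb0 : 0 ≤ (δ⁻¹ + 1) ^ (p + q) * (|b.1| ^ (p + q) + |b.2| ^ (p + q)) := by positivity
  -- If `b` is relatively small, homogeneity reduces to ‖a‖ = 1 and uniform continuity gives the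
  -- ε-term. Otherwise `a` is controlled by `b` and both values go into the C-term.
  by_cases hab : ‖b‖ < δ * ‖a‖
  · have hn : 0 < ‖a‖ := by
      by_contra hcon
      have : ‖a‖ = 0 := le_antisymm (not_lt.1 hcon) (norm_nonneg _)
      rw [this, mul_zero] at hab
      exact absurd hab (not_lt.2 (norm_nonneg _))
    have hinv : 0 ≤ ‖a‖⁻¹ := by positivity
    have e : ∀ c : ℝ × ℝ, |c.1| ^ p * |c.2| ^ q =
        ‖a‖ ^ (p + q) * (|(‖a‖⁻¹ • c).1| ^ p * |(‖a‖⁻¹ • c).2| ^ q) := fun c => by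
      rw [Prod.smul_fst, Prod.smul_snd, smul_eq_mul, smul_eq_mul, coupling_smul hp hq hinv,
        ← mul_assoc, ← Real.mul_rpow hn.le hinv, mul_inv_cancel₀ hn.ne', Real.one_rpow, one_mul]
    have hna : ‖‖a‖⁻¹ • a‖ = 1 := by
      rw [norm_smul, norm_inv, norm_norm, inv_mul_cancel₀ hn.ne']
    have hnb : ‖‖a‖⁻¹ • b‖ < δ := by
      rw [norm_smul, norm_inv, norm_norm, inv_mul_lt_iff₀ hn, mul_comm]; exact hab
    have h1 : ‖a‖⁻¹ • (a + b) ∈ Metric.closedBall (0 : ℝ × ℝ) 2 := by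
      rw [mem_closedBall_zero_iff, smul_add]
      refine (norm_add_le _ _).trans ?_
      rw [hna]
      linarith [hnb.le, min_le_right δ' 1]
    have h2 : ‖a‖⁻¹ • a ∈ Metric.closedBall (0 : ℝ × ℝ) 2 := by
      rw [mem_closedBall_zero_iff, hna]; norm_num
    have h3 := hδε _ h1 _ h2 (by
      rw [dist_eq_norm, smul_add, add_sub_cancel_left]; exact hnb.trans_le (min_le_left _ _))
    rw [Real.dist_eq] at h3
    rw [e (a + b), e a, ← mul_sub, abs_mul, abs_of_nonneg (by positivity)]
    calc ‖a‖ ^ (p + q) * _ ≤ ‖a‖ ^ (p + q) * ε := by gcongr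
      _ ≤ (|a.1| ^ (p + q) + |a.2| ^ (p + q)) * ε := by gcongr; exact norm_rpow_le a
      _ ≤ _ := by linarith
  · have hle : ‖a‖ ≤ δ⁻¹ * ‖b‖ := by
      rw [le_inv_mul_iff₀ hδ]; exact not_lt.1 hab
    have h1 : |(a + b).1| ^ p * |(a + b).2| ^ q ≤ (δ⁻¹ + 1) ^ (p + q) * ‖b‖ ^ (p + q) := by
      rw [← Real.mul_rpow (by positivity) (norm_nonneg _)]
      refine (coupling_le_norm hp hq _).trans (Real.rpow_le_rpow (norm_nonneg _) ?_ hpq.le)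
      linarith [norm_add_le a b]
    have h2 : |a.1| ^ p * |a.2| ^ q ≤ (δ⁻¹ + 1) ^ (p + q) * ‖b‖ ^ (p + q) := by
      rw [← Real.mul_rpow (by positivity) (norm_nonneg _)]
      refine (coupling_le_norm hp hq _).trans (Real.rpow_le_rpow (norm_nonneg _) ?_ hpq.le)
      linarith [norm_nonneg b]
    have h3 : (δ⁻¹ + 1) ^ (p + q) * ‖b‖ ^ (p + q) ≤
        (δ⁻¹ + 1) ^ (p + q) * (|b.1| ^ (p + q) + |b.2| ^ (p + q)) := by
      gcongr; exact norm_rpow_le b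
    have h4 : 0 ≤ |(a + b).1| ^ p * |(a + b).2| ^ q := by positivity
    have h5 : 0 ≤ |a.1| ^ p * |a.2| ^ q := by positivity
    rw [abs_le]
    constructor <;> linarith

theorem integrable_coupling {α : Type*} [MeasurableSpace α] {μ : Measure α} (hp : 0 < p)
    (hq : 0 < q) {f g : α → ℝ} (hfm : AEStronglyMeasurable f μ) (hgm : AEStronglyMeasurable g μ)
    (hf : Integrable (fun x => |f x| ^ (p + q)) μ)
    (hg : Integrable (fun x => |g x| ^ (p + q)) μ) :
    Integrable (fun x => |f x| ^ p * |g x| ^ q) μ := by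
  refine (hf.add hg).mono' ?_ (Eventually.of_forall fun x => ?_)
  · exact (continuous_coupling hp hq).comp_aestronglyMeasurable (hfm.prodMk hgm)
  · rw [Real.norm_of_nonneg (by positivity)]
    exact coupling_le_add hp hq _ _

/-- **Brezis–Lieb lemma** for the coupling term. -/
theorem tendsto_integral_coupling_sub {α : Type*} [MeasurableSpace α] {μ : Measure α} (hp : 0 < p)
    (hq : 0 < q) {w z : ℕ → α → ℝ} {U V : α → ℝ}
    (hwm : ∀ n, AEStronglyMeasurable (w n) μ) (hzm : ∀ n, AEStronglyMeasurable (z n) μ)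
    (hUm : AEStronglyMeasurable U μ) (hVm : AEStronglyMeasurable V μ)
    (hw : ∀ n, Integrable (fun x => |w n x| ^ (p + q)) μ)
    (hz : ∀ n, Integrable (fun x => |z n x| ^ (p + q)) μ)
    (hU : Integrable (fun x => |U x| ^ (p + q)) μ) (hV : Integrable (fun x => |V x| ^ (p + q)) μ)
    (hwU : ∀ n, Integrable (fun x => |w n x + U x| ^ (p + q)) μ)
    (hzV : ∀ n, Integrable (fun x => |z n x + V x| ^ (p + q)) μ)
    {M : ℝ} (hwM : ∀ n, ∫ x, |w n x| ^ (p + q) ∂μ ≤ M) (hzM : ∀ n, ∫ x, |z n x| ^ (p + q) ∂μ ≤ M)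
    (hwt : ∀ᵐ x ∂μ, Tendsto (fun n => w n x) atTop (𝓝 0))
    (hzt : ∀ᵐ x ∂μ, Tendsto (fun n => z n x) atTop (𝓝 0)) :
    Tendsto (fun n => (∫ x, |w n x + U x| ^ p * |z n x + V x| ^ q ∂μ) -
      (∫ x, |w n x| ^ p * |z n x| ^ q ∂μ) - ∫ x, |U x| ^ p * |V x| ^ q ∂μ) atTop (𝓝 0) := by
  set D : ℕ → α → ℝ := fun n x => |w n x + U x| ^ p * |z n x + V x| ^ q -
    |w n x| ^ p * |z n x| ^ q - |U x| ^ p * |V x| ^ q with hD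
  have hi1 : ∀ n, Integrable (fun x => |w n x + U x| ^ p * |z n x + V x| ^ q) μ := fun n =>
    integrable_coupling hp hq ((hwm n).add hUm) ((hzm n).add hVm) (hwU n) (hzV n)
  have hi2 : ∀ n, Integrable (fun x => |w n x| ^ p * |z n x| ^ q) μ := fun n =>
    integrable_coupling hp hq (hwm n) (hzm n) (hw n) (hz n)
  have hi3 : Integrable (fun x => |U x| ^ p * |V x| ^ q) μ := integrable_coupling hp hq hUm hVm hU hV
  have hDi : ∀ n, Integrable (D n) μ := fun n => ((hi1 n).sub (hi2 n)).sub hi3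
  have hDint : ∀ n, ∫ x, D n x ∂μ = (∫ x, |w n x + U x| ^ p * |z n x + V x| ^ q ∂μ) -
      (∫ x, |w n x| ^ p * |z n x| ^ q ∂μ) - ∫ x, |U x| ^ p * |V x| ^ q ∂μ := fun n => by
    rw [← integral_sub (hi1 n) (hi2 n)]
    exact integral_sub ((hi1 n).sub (hi2 n)) hi3
  simp only [← hDint]
  have hM0 : 0 ≤ M := (integral_nonneg fun x => by positivity).trans (hwM 0)
  rw [Metric.tendsto_atTop]
  intro η hη
  -- Since ∫ sₙ ≤ 2M, the ε-term contributes at most η/2; the 1 guards against M = 0.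
  set ε := η / (2 * (2 * M + 1)) with hε
  have hε0 : 0 < ε := by positivity
  obtain ⟨C, hC0, hC⟩ := exists_coupling_sub_le hp hq hε0
  set s : ℕ → α → ℝ := fun n x => |w n x| ^ (p + q) + |z n x| ^ (p + q) with hs
  set B : α → ℝ := fun x => |U x| ^ (p + q) + |V x| ^ (p + q) with hB
  have hsi : ∀ n, Integrable (s n) μ := fun n => (hw n).add (hz n)
  have hBi : Integrable B μ := hU.add hV
  have hDle : ∀ n x, |D n x| ≤ ε * s n x + (C + 1) * B x := fun n x => by
    have h1 := hC (w n x, z n x) (U x, V x)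
    have h2 := coupling_le_add hp hq (U x) (V x)
    have h3 : 0 ≤ |U x| ^ p * |V x| ^ q := by positivity
    have h4 : |D n x| ≤ |(|w n x + U x| ^ p * |z n x + V x| ^ q - |w n x| ^ p * |z n x| ^ q)| +
        |U x| ^ p * |V x| ^ q := by
      refine (abs_sub _ _).trans ?_
      rw [abs_of_nonneg h3]
    simp only [Prod.mk_add_mk] at h1
    calc |D n x| ≤ _ := h4
      _ ≤ (ε * s n x + C * B x) + B x := add_le_add h1 h2
      _ = _ := by ring
  -- Subtracting ε sₙ leaves an excess dominated by (C + 1)B, which is integrable and independent of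
  -- n, although Dₙ itself need not have an integrable majorant.
  set G : ℕ → α → ℝ := fun n x => max (|D n x| - ε * s n x) 0 with hG
  have hGt : Tendsto (fun n => ∫ x, G n x ∂μ) atTop (𝓝 0) := by
    have := tendsto_integral_of_dominated_convergence (μ := μ) (F := G) (f := fun _ => 0)
      (fun x => (C + 1) * B x)
      (fun n => (((hDi n).abs.sub ((hsi n).const_mul ε)).sup (integrable_zero α ℝ μ)).1)
      (hBi.const_mul _) (fun n => Eventually.of_forall fun x => ?_) ?_
    · simpa using this
    · rw [Real.norm_of_nonneg (le_max_right _ _)]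
      refine max_le ?_ ?_
      · linarith [hDle n x]
      · have : 0 ≤ B x := by positivity
        positivity
    · filter_upwards [hwt, hzt] with x h1 h2
      have hDx : Tendsto (fun n => D n x) atTop (𝓝 0) := by
        have hc := continuous_coupling hp hq
        have h3 : Tendsto (fun n => (w n x + U x, z n x + V x)) atTop (𝓝 (U x, V x)) := by
          have h31 := h1.add_const (U x)
          have h32 := h2.add_const (V x)
          rw [zero_add] at h31 h32
          exact h31.prodMk_nhds h32
        have h4 : Tendsto (fun n => (w n x, z n x)) atTop (𝓝 ((0 : ℝ), (0 : ℝ))) :=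
          h1.prodMk_nhds h2
        have h5 := (((hc.tendsto _).comp h3).sub ((hc.tendsto _).comp h4)).sub_const
          (|U x| ^ p * |V x| ^ q)
        simpa [hD, Function.comp_def, Real.zero_rpow hp.ne'] using h5
      have hDa := hDx.abs
      rw [abs_zero] at hDa
      refine squeeze_zero (fun n => le_max_right _ _) (fun n => max_le ?_ (abs_nonneg _)) hDa
      have : 0 ≤ s n x := by positivity
      nlinarith
  obtain ⟨n₀, hn₀⟩ := eventually_atTop.1 (hGt.eventually (gt_mem_nhds (half_pos hη)))
  refine ⟨n₀, fun n hn => ?_⟩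
  have hGi : Integrable (G n) μ :=
    ((hDi n).abs.sub ((hsi n).const_mul ε)).sup (integrable_zero α ℝ μ)
  have hsM : ∫ x, s n x ∂μ ≤ 2 * M := by
    rw [hs, integral_add (hw n) (hz n)]
    linarith [hwM n, hzM n]
  rw [Real.dist_eq, sub_zero]
  calc |∫ x, D n x ∂μ| ≤ ∫ x, |D n x| ∂μ := abs_integral_le_integral_abs
    _ ≤ ∫ x, (G n x + ε * s n x) ∂μ := by
        refine integral_mono (hDi n).abs (hGi.add ((hsi n).const_mul ε)) fun x => ?_
        have := le_max_left (|D n x| - ε * s n x) 0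
        simp only [hG]
        linarith
    _ = (∫ x, G n x ∂μ) + ε * ∫ x, s n x ∂μ := by
        rw [integral_add hGi ((hsi n).const_mul ε), integral_const_mul]
    _ < η / 2 + η / 2 := by
        refine add_lt_add_of_lt_of_le (hn₀ n hn) ?_
        calc ε * ∫ x, s n x ∂μ ≤ ε * (2 * M + 1) := by gcongr; linarith
          _ = η / 2 := by rw [hε]; field_simp
    _ = η := add_halves η

end Coupling

end

/-! ## The quadratic part of the energy -/

section

theorem integral_add_mul_mul {N : ℕ} {f f' g g' : RN N → ℝ} (hf : MemLp f 2) (hf' : MemLp f' 2)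
    (hg : MemLp g 2) (hg' : MemLp g' 2) (t : ℝ) :
    ∫ x, (f x + t * g x) * (f' x + t * g' x) = (∫ x, f x * f' x) +
      t * ((∫ x, f x * g' x) + ∫ x, g x * f' x) + t ^ 2 * ∫ x, g x * g' x := by
  have h1 := integral_linear_mul hf hg (hf'.add (hg'.const_mul t)) 1 t
  have h2 := integral_linear_mul hf' hg' hf 1 t
  have h3 := integral_linear_mul hf' hg' hg 1 t
  simp only [one_mul, Pi.add_apply] at h1 h2 h3
  rw [h1]
  simp only [mul_comm (f _), mul_comm (g _)] at h2 h3 ⊢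
  rw [h2, h3]
  ring

/-- The quadratic form `½‖Δa‖² - (α/2)‖∇a‖² + μ‖a‖²`. -/
def quadForm {N : ℕ} (α μ : ℝ) (a : RN N → ℝ) : ℝ :=
  1 / 2 * l2sq (weakLaplacian a) - α / 2 * l2sq (weakGradient a) + μ * l2sq a

theorem MemH2.quadForm_eq {N : ℕ} {a : RN N → ℝ} (ha : MemH2 a) (α μ : ℝ) :
    quadForm α μ a = 1 / 2 * (∫ x, weakLaplacian a x * weakLaplacian a x) +
      α / 2 * (∫ x, a x * weakLaplacian a x) + μ * ∫ x, a x * a x := by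
  rw [quadForm, ha.l2sq_weakGradient, l2sq_eq_integral_mul_self, l2sq_eq_integral_mul_self]
  ring

/-- The polynomial is quadratic in (2π‖ξ‖)². Given one zero ζ, Vieta's relation puts every other
zero on the sphere through ζ or on one further sphere. As radius 0 may occur, nullity of spheres
uses that the space is nontrivial. -/
theorem volume_quartic_eq_zero {N : ℕ} (hN : 1 ≤ N) (α μ : ℝ) :
    volume {ξ : RN N | ((2 * Real.pi * ‖ξ‖) ^ 2) ^ 2 - α * (2 * Real.pi * ‖ξ‖) ^ 2 + 2 * μ = 0} =
      0 := by
  have : Nontrivial (RN N) := by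
    have : Nonempty (Fin N) := ⟨⟨0, hN⟩⟩
    infer_instance
  rcases Set.eq_empty_or_nonempty {ξ : RN N | ((2 * Real.pi * ‖ξ‖) ^ 2) ^ 2 -
    α * (2 * Real.pi * ‖ξ‖) ^ 2 + 2 * μ = 0} with h | ⟨ζ, hζ⟩
  · rw [h, measure_empty]
  · refine measure_mono_null (t := Metric.sphere 0 ‖ζ‖ ∪ Metric.sphere 0
      (Real.sqrt (α - (2 * Real.pi * ‖ζ‖) ^ 2) / (2 * Real.pi))) (fun ξ hξ => ?_)
      (measure_union_null (Measure.addHaar_sphere _ _ _) (Measure.addHaar_sphere _ _ _))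
    rw [Set.mem_ofPred_eq] at hξ hζ
    have hπ := Real.pi_pos
    have h1 : ((2 * Real.pi * ‖ξ‖) ^ 2 - (2 * Real.pi * ‖ζ‖) ^ 2) *
        ((2 * Real.pi * ‖ξ‖) ^ 2 + (2 * Real.pi * ‖ζ‖) ^ 2 - α) = 0 := by
      linear_combination hξ - hζ
    rcases mul_eq_zero.1 h1 with h2 | h2
    · left
      rw [mem_sphere_zero_iff_norm]
      have h3 := (sq_eq_sq₀ (by positivity) (by positivity)).1 (sub_eq_zero.1 h2)
      exact mul_left_cancel₀ (by positivity) h3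
    · right
      rw [mem_sphere_zero_iff_norm, eq_div_iff (by positivity),
        show α - (2 * Real.pi * ‖ζ‖) ^ 2 = (2 * Real.pi * ‖ξ‖) ^ 2 by linarith,
        Real.sqrt_sq (by positivity)]
      ring

/-- A nonnegative form `½‖Δa‖² - (α/2)‖∇a‖² + μ‖a‖²` on `H²` has trivial kernel. -/
theorem eq_zero_ae_of_quadForm_eq_zero {N : ℕ} (hN : 1 ≤ N) {α μ : ℝ} {w : RN N → ℝ}
    (hw : MemH2 w) (hnonneg : ∀ a : RN N → ℝ, MemH2 a → 0 ≤ quadForm α μ a)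
    (h0 : quadForm α μ w = 0) : w =ᵐ[volume] 0 := by
  set W := weakLaplacian w with hW
  have hW2 : MemLp W 2 := hw.memLp_weakLaplacian
  -- Being a minimum of a nonnegative form, `w` satisfies the Euler–Lagrange equation Δ²w + αΔw +
  -- 2μw = 0 weakly.
  have hEL : IsWeakLaplacian W (fun x => -α * W x + (-(2 * μ)) * w x) := by
    refine ⟨((hW2.const_mul _).add (hw.memLp.const_mul _)).locallyIntegrable one_le_two,
      fun φ hφ hc => ?_⟩
    obtain ⟨hφ2, hφΔ⟩ := memH2_testFunction hφ hc
    have hφL := memLp_testFunction hφ hc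
    have hΔL := memLp_laplacian_testFunction hφ hc
    have key : ∀ t : ℝ, 0 ≤ t * (1 / 2 * ((∫ x, W x * Laplacian.laplacian φ x) +
        ∫ x, Laplacian.laplacian φ x * W x) + α / 2 * ((∫ x, w x * Laplacian.laplacian φ x) +
        ∫ x, φ x * W x) + μ * ((∫ x, w x * φ x) + ∫ x, φ x * w x)) +
        t ^ 2 * quadForm α μ φ := by
      intro t
      obtain ⟨ha, haΔ⟩ := hw.linear hφ2 1 t
      have h1 := hnonneg _ ha
      rw [ha.quadForm_eq] at h1
      have haΔ' : weakLaplacian (fun x => 1 * w x + t * φ x) =ᵐ[volume]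
          fun x => W x + t * Laplacian.laplacian φ x := by
        filter_upwards [haΔ, hφΔ] with x h2 h3
        rw [h2, h3, one_mul]
      have i1 : ∫ x, weakLaplacian (fun x => 1 * w x + t * φ x) x *
          weakLaplacian (fun x => 1 * w x + t * φ x) x = ∫ x, (W x + t * Laplacian.laplacian φ x) *
            (W x + t * Laplacian.laplacian φ x) :=
        integral_congr_ae (haΔ'.mono fun x hx => by simp only [hx])
      have i2 : ∫ x, (1 * w x + t * φ x) * weakLaplacian (fun x => 1 * w x + t * φ x) x =
          ∫ x, (w x + t * φ x) * (W x + t * Laplacian.laplacian φ x) :=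
        integral_congr_ae (haΔ'.mono fun x hx => by simp only [hx]; rw [one_mul])
      have i3 : ∫ x, (1 * w x + t * φ x) * (1 * w x + t * φ x) =
          ∫ x, (w x + t * φ x) * (w x + t * φ x) := by simp only [one_mul]
      rw [i1, i2, i3, integral_add_mul_mul hW2 hW2 hΔL hΔL,
        integral_add_mul_mul hw.memLp hW2 hφL hΔL,
        integral_add_mul_mul hw.memLp hw.memLp hφL hφL] at h1
      have h2 := hw.quadForm_eq α μ
      rw [h0] at h2
      have h3 : quadForm α μ φ = 1 / 2 * (∫ x, Laplacian.laplacian φ x * Laplacian.laplacian φ x) +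
          α / 2 * (∫ x, φ x * Laplacian.laplacian φ x) + μ * ∫ x, φ x * φ x := by
        rw [hφ2.quadForm_eq]
        have j1 : ∫ x, weakLaplacian φ x * weakLaplacian φ x =
            ∫ x, Laplacian.laplacian φ x * Laplacian.laplacian φ x :=
          integral_congr_ae (hφΔ.mono fun x hx => by simp only [hx])
        have j2 : ∫ x, φ x * weakLaplacian φ x = ∫ x, φ x * Laplacian.laplacian φ x :=
          integral_congr_ae (hφΔ.mono fun x hx => by simp only [hx])
        rw [j1, j2]
      rw [h3]
      rw [← hW] at h2
      linarith
    have hlin : 1 / 2 * ((∫ x, W x * Laplacian.laplacian φ x) +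
        ∫ x, Laplacian.laplacian φ x * W x) + α / 2 * ((∫ x, w x * Laplacian.laplacian φ x) +
        ∫ x, φ x * W x) + μ * ((∫ x, w x * φ x) + ∫ x, φ x * w x) = 0 := by
      generalize 1 / 2 * ((∫ x, W x * Laplacian.laplacian φ x) +
        ∫ x, Laplacian.laplacian φ x * W x) + α / 2 * ((∫ x, w x * Laplacian.laplacian φ x) +
        ∫ x, φ x * W x) + μ * ((∫ x, w x * φ x) + ∫ x, φ x * w x) = b at key
      have hq := hnonneg φ hφ2
      set Q := quadForm α μ φ
      -- With this t, tb + t²Q = -b²/(Q+1)². The denominator is `Q + 1` because `Q` may vanish.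
      have h1 := key (-b / (Q + 1))
      have hQ : 0 < Q + 1 := by linarith
      have h2 : -b / (Q + 1) * b + (-b / (Q + 1)) ^ 2 * Q = -(b ^ 2 / (Q + 1) ^ 2) := by
        field_simp; ring
      rw [h2] at h1
      have h3 : b ^ 2 / (Q + 1) ^ 2 = 0 := le_antisymm (by linarith) (by positivity)
      rcases div_eq_zero_iff.1 h3 with h4 | h4
      · exact pow_eq_zero_iff two_ne_zero |>.1 h4
      · exact absurd h4 (by positivity)
    have hdef := hw.weakLaplacian_spec.1.2 φ hφ hc
    rw [← hW] at hdef
    rw [integral_linear_mul hW2 hw.memLp hφL]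
    have hcomm : ∀ f g : RN N → ℝ, ∫ x, f x * g x = ∫ x, g x * f x := fun f g => by
      simp only [mul_comm]
    rw [hcomm _ W, hcomm φ W, hcomm φ w, hdef] at hlin
    linarith
  have hF1 := hw.weakLaplacian_spec.1.l2Fourier_ae_eq hw.memLp hW2
  have hF2 := hEL.l2Fourier_ae_eq hW2 ((hW2.const_mul _).add (hw.memLp.const_mul _))
  have hF3 := l2Fourier_add_smul hW2 hw.memLp (-α) (-(2 * μ))
  have hnull : ∀ᵐ ξ : RN N, ((2 * Real.pi * ‖ξ‖) ^ 2) ^ 2 - α * (2 * Real.pi * ‖ξ‖) ^ 2 + 2 * μ ≠ 0 := by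
    rw [ae_iff]
    simpa using volume_quartic_eq_zero hN α μ
  have hzero : l2Fourier w =ᵐ[volume] 0 := by
    filter_upwards [hF1, hF2, hF3, hnull] with ξ h1 h2 h3 h4
    rw [h3] at h2
    rw [← hW] at h1
    rw [h1] at h2
    have h5 : ((((2 * Real.pi * ‖ξ‖) ^ 2) ^ 2 - α * (2 * Real.pi * ‖ξ‖) ^ 2 + 2 * μ : ℝ) : ℂ) *
        l2Fourier w ξ = 0 := by
      push_cast at h2 ⊢
      linear_combination -h2
    rcases mul_eq_zero.1 h5 with h6 | h6
    · exact absurd (by exact_mod_cast h6) h4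
    · exact h6
  refine eq_zero_ae_of_l2sq_eq_zero hw.memLp ?_
  rw [← l2sq_l2Fourier hw.memLp, l2sq_congr hzero]
  simp [l2sq]

end

/-! ## Energy estimates -/

section

/-- The coupling integral `∫ |u|^p |v|^q`. -/
def coupling {N : ℕ} (p q : ℝ) (u v : RN N → ℝ) : ℝ := ∫ x, |u x| ^ p * |v x| ^ q

theorem coupling_nonneg {N : ℕ} (p q : ℝ) (u v : RN N → ℝ) : 0 ≤ coupling p q u v :=
  integral_nonneg fun x => by positivity

/-! ### Scaling and translation of the energy -/

section Energy

variable {N : ℕ} {α₁ α₂ β r₁ r₂ : ℝ} {u v : RN N → ℝ}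

theorem energy_eq (hu : MemH2 u) (hv : MemH2 v) : energy α₁ α₂ β r₁ r₂ u v =
    1 / 2 * (l2sq (weakLaplacian u) + l2sq (weakLaplacian v)) +
      α₁ / 2 * (∫ x, u x * weakLaplacian u x) + α₂ / 2 * (∫ x, v x * weakLaplacian v x) -
      β * coupling r₁ r₂ u v := by
  rw [energy, hu.l2sq_weakGradient, hv.l2sq_weakGradient, coupling]
  ring

theorem MemH2.l2sq_weakLaplacian_const_mul (hu : MemH2 u) (c : ℝ) :
    l2sq (weakLaplacian fun x => c * u x) = c ^ 2 * l2sq (weakLaplacian u) := by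
  rw [l2sq_congr (hu.const_mul c).2, l2sq_const_mul]

theorem MemH2.integral_mul_weakLaplacian_const_mul (hu : MemH2 u) (c : ℝ) :
    ∫ x, (c * u x) * weakLaplacian (fun x => c * u x) x = c ^ 2 * ∫ x, u x * weakLaplacian u x := by
  rw [← integral_const_mul]
  refine integral_congr_ae ((hu.const_mul c).2.mono fun x hx => ?_)
  simp only [hx]
  ring

/-- Behaviour of the energy under multiplication by a positive constant. -/
theorem energy_const_mul (hr₁ : 0 < r₁) (hr₂ : 0 < r₂) (hu : MemH2 u) (hv : MemH2 v) {c : ℝ}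
    (hc : 0 ≤ c) : energy α₁ α₂ β r₁ r₂ (fun x => c * u x) (fun x => c * v x) =
      c ^ 2 * energy α₁ α₂ β r₁ r₂ u v - β * (c ^ (r₁ + r₂) - c ^ 2) * coupling r₁ r₂ u v := by
  have h : coupling r₁ r₂ (fun x => c * u x) (fun x => c * v x) =
      c ^ (r₁ + r₂) * coupling r₁ r₂ u v := by
    rw [coupling, coupling, ← integral_const_mul]
    simp only [coupling_smul hr₁ hr₂ hc]
  rw [energy_eq (hu.const_mul c).1 (hv.const_mul c).1, energy_eq hu hv, h,
    hu.l2sq_weakLaplacian_const_mul, hv.l2sq_weakLaplacian_const_mul,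
    hu.integral_mul_weakLaplacian_const_mul, hv.integral_mul_weakLaplacian_const_mul]
  ring

theorem coupling_translate (y : RN N) :
    coupling r₁ r₂ (fun x => u (x - y)) (fun x => v (x - y)) = coupling r₁ r₂ u v :=
  integral_sub_right_eq_self (fun x => |u x| ^ r₁ * |v x| ^ r₂) y

theorem energy_translate (hu : MemH2 u) (hv : MemH2 v) (y : RN N) :
    energy α₁ α₂ β r₁ r₂ (fun x => u (x - y)) (fun x => v (x - y)) =
      energy α₁ α₂ β r₁ r₂ u v := by
  have h : ∀ {w : RN N → ℝ}, MemH2 w → l2sq (weakLaplacian fun x => w (x - y)) =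
      l2sq (weakLaplacian w) := fun hw => by
    rw [l2sq_congr (hw.translate y).2, l2sq_translate]
  have h' : ∀ {w : RN N → ℝ}, MemH2 w → ∫ x, w (x - y) * weakLaplacian (fun x => w (x - y)) x =
      ∫ x, w x * weakLaplacian w x := fun {w} hw => by
    rw [← integral_sub_right_eq_self (fun x => w x * weakLaplacian w x) y]
    exact integral_congr_ae ((hw.translate y).2.mono fun x hx => by simp only [hx])
  rw [energy_eq (hu.translate y).1 (hv.translate y).1, energy_eq hu hv, h hu, h hv, h' hu, h' hv,
    coupling_translate]

theorem massSphere_translate {ρ : ℝ} (h : (u, v) ∈ massSphere N ρ) (y : RN N) :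
    ((fun x => u (x - y)), fun x => v (x - y)) ∈ massSphere N ρ := by
  obtain ⟨hu, hv, hm⟩ := h
  refine ⟨(hu.translate y).1, (hv.translate y).1, ?_⟩
  simp only [l2sq_translate]
  exact hm

theorem massSphere_const_mul {ρ : ℝ} (hu : MemH2 u) (hv : MemH2 v)
    (hτ : 0 < l2sq u + l2sq v) :
    ((fun x => ρ / Real.sqrt (l2sq u + l2sq v) * u x),
      fun x => ρ / Real.sqrt (l2sq u + l2sq v) * v x) ∈ massSphere N ρ := by
  refine ⟨(hu.const_mul _).1, (hv.const_mul _).1, ?_⟩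
  simp only [l2sq_const_mul]
  rw [← mul_add, div_pow, Real.sq_sqrt hτ.le, div_mul_cancel₀ _ hτ.ne']

end Energy

/-! ### Bounds for the coupling term -/

/-- Weighted AM–GM with the optimal constant. -/
theorem rpow_mul_rpow_le {p q A B : ℝ} (hp : 0 < p) (hq : 0 < q) (hA : 0 ≤ A) (hB : 0 ≤ B) :
    A ^ p * B ^ q ≤ (p / (p + q)) ^ (p / 2) * (q / (p + q)) ^ (q / 2) *
      (A ^ 2 + B ^ 2) ^ ((p + q) / 2) := by
  have hpq : 0 < p + q := add_pos hp hq
  set s := p / (p + q) with hs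
  set t := q / (p + q) with ht
  have hs0 : 0 < s := by positivity
  have ht0 : 0 < t := by positivity
  -- Dividing by the weights makes the arithmetic mean equal to A² + B²; raising to the power
  -- (p+q)/2 gives the claim.
  have h1 := Real.geom_mean_le_arith_mean2_weighted (w₁ := s) (w₂ := t) (p₁ := A ^ 2 / s)
    (p₂ := B ^ 2 / t) hs0.le ht0.le (by positivity) (by positivity)
    (by rw [hs, ht]; field_simp)
  rw [mul_div_cancel₀ _ hs0.ne', mul_div_cancel₀ _ ht0.ne'] at h1
  have h2 := Real.rpow_le_rpow (by positivity) h1 (by positivity : 0 ≤ (p + q) / 2)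
  rw [Real.mul_rpow (by positivity) (by positivity), ← Real.rpow_mul (by positivity),
    ← Real.rpow_mul (by positivity)] at h2
  have e1 : s * ((p + q) / 2) = p / 2 := by rw [hs]; field_simp
  have e2 : t * ((p + q) / 2) = q / 2 := by rw [ht]; field_simp
  rw [e1, e2, Real.div_rpow (by positivity) hs0.le, Real.div_rpow (by positivity) ht0.le,
    ← Real.rpow_natCast, ← Real.rpow_natCast, ← Real.rpow_mul hA, ← Real.rpow_mul hB] at h2
  have e3 : ((2 : ℕ) : ℝ) * (p / 2) = p := by push_cast; ring
  have e4 : ((2 : ℕ) : ℝ) * (q / 2) = q := by push_cast; ring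
  rw [e3, e4, div_mul_div_comm, div_le_iff₀ (by positivity)] at h2
  simp only [Real.rpow_natCast] at h2
  linarith

/-- Hölder's inequality for the coupling term. -/
theorem coupling_le_holder {N : ℕ} {p q : ℝ} (hp : 0 < p) (hq : 0 < q) {u v : RN N → ℝ}
    (hu : Integrable fun x => |u x| ^ (p + q)) (hv : Integrable fun x => |v x| ^ (p + q)) :
    coupling p q u v ≤ (∫ x, |u x| ^ (p + q)) ^ (p / (p + q)) *
      (∫ x, |v x| ^ (p + q)) ^ (q / (p + q)) := by
  have hpq : 0 < p + q := add_pos hp hq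
  have h := ENNReal.lintegral_mul_norm_pow_le (μ := volume)
    hu.1.aemeasurable.ennreal_ofReal hv.1.aemeasurable.ennreal_ofReal
    (p := p / (p + q)) (q := q / (p + q)) (by positivity) (by positivity) (by field_simp)
  have hi1 : 0 ≤ ∫ x, |u x| ^ (p + q) := integral_nonneg fun x => by positivity
  have hi2 : 0 ≤ ∫ x, |v x| ^ (p + q) := integral_nonneg fun x => by positivity
  rw [← ofReal_integral_eq_lintegral_ofReal hu (Eventually.of_forall fun x => by positivity),
    ← ofReal_integral_eq_lintegral_ofReal hv (Eventually.of_forall fun x => by positivity),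
    ENNReal.ofReal_rpow_of_nonneg hi1 (by positivity),
    ENNReal.ofReal_rpow_of_nonneg hi2 (by positivity), ← ENNReal.ofReal_mul (by positivity)] at h
  rw [coupling]
  by_cases hm : AEStronglyMeasurable (fun x => |u x| ^ p * |v x| ^ q) volume
  · rw [integral_eq_lintegral_of_nonneg_ae (Eventually.of_forall fun x => by positivity) hm]
    refine ENNReal.toReal_le_of_le_ofReal (by positivity) (le_of_eq_of_le ?_ h)
    refine lintegral_congr fun x => ?_
    rw [ENNReal.ofReal_rpow_of_nonneg (by positivity) (by positivity),
      ENNReal.ofReal_rpow_of_nonneg (by positivity) (by positivity),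
      ← ENNReal.ofReal_mul (by positivity), ← Real.rpow_mul (abs_nonneg _),
      ← Real.rpow_mul (abs_nonneg _), mul_div_cancel₀ _ hpq.ne', mul_div_cancel₀ _ hpq.ne']
  · rw [integral_non_aestronglyMeasurable hm]
    positivity

/-! ### Control of the coupling by mass and Laplacians; coercivity -/

section Coupling

variable {N : ℕ} {r₁ r₂ : ℝ}

theorem constD1_nonneg (hr₁ : 0 < r₁) (hr₂ : 0 < r₂) : 0 ≤ constD1 N r₁ r₂ := by
  have := gnConst_nonneg N (r₁ + r₂)
  unfold constD1
  positivity

theorem mul_gnExponent {p : ℝ} (hp : p ≠ 0) : p * gnExponent N p = N * (p - 2) / 4 := by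
  rw [gnExponent]; field_simp

theorem gnExponent_mem {p : ℝ} (hN : 1 ≤ N) (hp : 2 < p) (hp' : p ≤ 2 + 8 / (N : ℝ)) :
    0 < gnExponent N p ∧ gnExponent N p < 1 ∧ p * gnExponent N p ≤ 2 := by
  have hNR : (0 : ℝ) < N := by exact_mod_cast hN
  have h1 : p - 2 ≤ 8 / N := by linarith
  rw [le_div_iff₀ hNR] at h1
  have h2 : 0 < p - 2 := by linarith
  have h3 : p * gnExponent N p ≤ 2 := by
    rw [mul_gnExponent (by linarith)]; linarith
  refine ⟨by unfold gnExponent; positivity, ?_, h3⟩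
  by_contra hcon
  nlinarith

/-- The Gagliardo–Nirenberg bound for the coupling term with the constant `𝒟₁`. -/
theorem coupling_le {u v : RN N → ℝ} (hN : 1 ≤ N) (hr₁ : 1 < r₁) (hr₂ : 1 < r₂)
    (hr : r₁ + r₂ ≤ 2 + 8 / (N : ℝ)) (hu : MemH2 u) (hv : MemH2 v) :
    coupling r₁ r₂ u v ≤ constD1 N r₁ r₂ *
      (l2sq u + l2sq v) ^ ((r₁ + r₂) * (1 - gnExponent N (r₁ + r₂)) / 2) *
      (l2sq (weakLaplacian u) + l2sq (weakLaplacian v)) ^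
        ((r₁ + r₂) * gnExponent N (r₁ + r₂) / 2) := by
  have h1 : 0 < r₁ := by linarith
  have h2 : 0 < r₂ := by linarith
  have hr2 : 2 < r₁ + r₂ := by linarith
  have hr0 : 0 < r₁ + r₂ := by linarith
  obtain ⟨hγ0, hγ1, -⟩ := gnExponent_mem hN hr2 hr
  set γ := gnExponent N (r₁ + r₂) with hγ
  set G := gnConst N (r₁ + r₂) with hG
  have hG0 : 0 ≤ G := gnConst_nonneg _ _
  set κ := (r₁ / (r₁ + r₂)) ^ (r₁ / 2) * (r₂ / (r₁ + r₂)) ^ (r₂ / 2) with hκ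
  have hκ0 : 0 < κ := by positivity
  set A := Real.sqrt (l2sq u) with hA
  set B := Real.sqrt (l2sq v) with hB
  set L := Real.sqrt (l2sq (weakLaplacian u)) with hL
  set M := Real.sqrt (l2sq (weakLaplacian v)) with hM
  have hA0 : 0 ≤ A := Real.sqrt_nonneg _
  have hB0 : 0 ≤ B := Real.sqrt_nonneg _
  have hL0 : 0 ≤ L := Real.sqrt_nonneg _
  have hM0 : 0 ≤ M := Real.sqrt_nonneg _
  have key : ∀ {w : RN N → ℝ}, MemH2 w → ∀ s : ℝ, 0 < s →
      (∫ x, |w x| ^ (r₁ + r₂)) ^ (s / (r₁ + r₂)) ≤ G ^ s *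
        (Real.sqrt (l2sq w) ^ s) ^ (1 - γ) * (Real.sqrt (l2sq (weakLaplacian w)) ^ s) ^ γ := by
    intro w hw s hs
    have hi : 0 ≤ ∫ x, |w x| ^ (r₁ + r₂) := integral_nonneg fun x => by positivity
    refine (Real.rpow_le_rpow hi (integral_abs_rpow_le hN hr2 hr hw) (by positivity)).trans ?_
    have ha := Real.sqrt_nonneg (l2sq w)
    have hb := Real.sqrt_nonneg (l2sq (weakLaplacian w))
    rw [Real.mul_rpow (by positivity) (by positivity), Real.mul_rpow (by positivity) (by positivity),
      ← Real.rpow_mul hG0, ← Real.rpow_mul ha, ← Real.rpow_mul hb, ← Real.rpow_mul ha,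
      ← Real.rpow_mul hb, mul_div_cancel₀ _ hr0.ne', ← mul_assoc]
    have e1 : (r₁ + r₂) * (1 - γ) * (s / (r₁ + r₂)) = s * (1 - γ) := by field_simp
    have e2 : (r₁ + r₂) * γ * (s / (r₁ + r₂)) = s * γ := by field_simp
    rw [e1, e2]
  calc coupling r₁ r₂ u v
      ≤ (∫ x, |u x| ^ (r₁ + r₂)) ^ (r₁ / (r₁ + r₂)) * (∫ x, |v x| ^ (r₁ + r₂)) ^ (r₂ / (r₁ + r₂)) :=
        coupling_le_holder h1 h2 (integrable_abs_rpow hN hr2 hr hu) (integrable_abs_rpow hN hr2 hr hv)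
    _ ≤ (G ^ r₁ * (A ^ r₁) ^ (1 - γ) * (L ^ r₁) ^ γ) * (G ^ r₂ * (B ^ r₂) ^ (1 - γ) * (M ^ r₂) ^ γ) :=
        mul_le_mul (key hu r₁ h1) (key hv r₂ h2)
          (Real.rpow_nonneg (integral_nonneg fun x => by positivity) _) (by positivity)
    _ = G ^ (r₁ + r₂) * ((A ^ r₁ * B ^ r₂) ^ (1 - γ) * (L ^ r₁ * M ^ r₂) ^ γ) := by
        rw [Real.rpow_add_of_nonneg hG0 h1.le h2.le,
          Real.mul_rpow (by positivity) (by positivity),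
          Real.mul_rpow (by positivity) (by positivity)]
        ring
    -- The optimal AM–GM inequality is used separately for the masses and for the Laplacians; the
    -- two constants recombine as κ^(1-γ) κ^γ = κ, which yields 𝒟₁ exactly.
    _ ≤ G ^ (r₁ + r₂) * ((κ * (A ^ 2 + B ^ 2) ^ ((r₁ + r₂) / 2)) ^ (1 - γ) *
          (κ * (L ^ 2 + M ^ 2) ^ ((r₁ + r₂) / 2)) ^ γ) := by
        have h1γ : 0 ≤ 1 - γ := by linarith
        exact mul_le_mul_of_nonneg_left (mul_le_mul
          (Real.rpow_le_rpow (by positivity) (rpow_mul_rpow_le h1 h2 hA0 hB0) h1γ)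
          (Real.rpow_le_rpow (by positivity) (rpow_mul_rpow_le h1 h2 hL0 hM0) hγ0.le)
          (by positivity) (by positivity)) (by positivity)
    _ = _ := by
        rw [hA, hB, hL, hM, Real.sq_sqrt (l2sq_nonneg _), Real.sq_sqrt (l2sq_nonneg _),
          Real.sq_sqrt (l2sq_nonneg _), Real.sq_sqrt (l2sq_nonneg _)]
        have hs1 : 0 ≤ l2sq u + l2sq v := add_nonneg (l2sq_nonneg _) (l2sq_nonneg _)
        have hs2 : 0 ≤ l2sq (weakLaplacian u) + l2sq (weakLaplacian v) :=
          add_nonneg (l2sq_nonneg _) (l2sq_nonneg _)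
        rw [Real.mul_rpow hκ0.le (by positivity), Real.mul_rpow hκ0.le (by positivity),
          ← Real.rpow_mul hs1, ← Real.rpow_mul hs2]
        have e1 : (r₁ + r₂) / 2 * (1 - γ) = (r₁ + r₂) * (1 - γ) / 2 := by ring
        have e2 : (r₁ + r₂) / 2 * γ = (r₁ + r₂) * γ / 2 := by ring
        have e3 : κ ^ (1 - γ) * κ ^ γ = κ := by
          rw [← Real.rpow_add hκ0, sub_add_cancel, Real.rpow_one]
        have e4 : constD1 N r₁ r₂ = κ * G ^ (r₁ + r₂) := rfl
        rw [e1, e2, e4]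
        calc _ = G ^ (r₁ + r₂) * (κ ^ (1 - γ) * κ ^ γ) *
              (l2sq u + l2sq v) ^ ((r₁ + r₂) * (1 - γ) / 2) *
              (l2sq (weakLaplacian u) + l2sq (weakLaplacian v)) ^ ((r₁ + r₂) * γ / 2) := by ring
          _ = _ := by rw [e3]; ring

/-- Sublinear powers are absorbed by a small multiple of the variable. -/
theorem exists_mul_rpow_le {K θ : ℝ} (hK : 0 ≤ K) (hθ : 0 < θ) (hθ1 : θ < 1) :
    ∃ C : ℝ, ∀ X : ℝ, 0 ≤ X → K * X ^ θ ≤ 1 / 4 * X + C := by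
  -- Beyond this threshold X^(1-θ) ≥ 4K, so K X^θ ≤ X/4.
  set Y := (4 * K) ^ (1 / (1 - θ)) with hY
  have h1θ : 0 < 1 - θ := by linarith
  have hY0 : 0 ≤ Y := by positivity
  refine ⟨K * Y ^ θ, fun X hX => ?_⟩
  rcases le_total X Y with h | h
  · have : K * X ^ θ ≤ K * Y ^ θ := by gcongr
    linarith
  · have h1 : 4 * K ≤ X ^ (1 - θ) := by
      have h2 := Real.rpow_le_rpow hY0 h h1θ.le
      rwa [hY, ← Real.rpow_mul (by positivity), one_div, inv_mul_cancel₀ h1θ.ne',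
        Real.rpow_one] at h2
    have h3 : X ^ (1 - θ) * X ^ θ = X := by
      rw [← Real.rpow_add_of_nonneg hX h1θ.le hθ.le, sub_add_cancel, Real.rpow_one]
    have h4 : 4 * K * X ^ θ ≤ X ^ (1 - θ) * X ^ θ := by gcongr
    have h5 : 0 ≤ K * Y ^ θ := by positivity
    linarith

/-- The Laplacian part enters `coupling_le` with exponent N(r-2)/8. Below criticality this is less
than 1 and the term is absorbed with coefficient 1/4. At criticality it is 1, the mass factor is
ρ^(8/N), and the assumption on ρ says β𝒟₁ρ^(8/N) < 1/2. -/
theorem exists_coupling_bound {β ρ : ℝ} (hN : 1 ≤ N) (hβ : 0 < β) (hr₁ : 1 < r₁) (hr₂ : 1 < r₂)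
    (hρ : 0 < ρ) (hr : r₁ + r₂ < 2 + 8 / (N : ℝ) ∨ (r₁ + r₂ = 2 + 8 / (N : ℝ) ∧
      ρ < (1 / (2 * constD1 N r₁ r₂ * β)) ^ ((N : ℝ) / 8))) :
    ∃ c C : ℝ, c < 1 / 2 ∧ ∀ u v : RN N → ℝ, (u, v) ∈ massSphere N ρ →
      β * coupling r₁ r₂ u v ≤ c * (l2sq (weakLaplacian u) + l2sq (weakLaplacian v)) + C := by
  have hNR : (0 : ℝ) < N := by exact_mod_cast hN
  have hr2 : 2 < r₁ + r₂ := by linarith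
  have hle : r₁ + r₂ ≤ 2 + 8 / (N : ℝ) := by
    rcases hr with h | h
    · exact h.le
    · exact h.1.le
  have hD := constD1_nonneg (N := N) (by linarith : 0 < r₁) (by linarith : 0 < r₂)
  set D := constD1 N r₁ r₂
  have hmg := mul_gnExponent (N := N) (p := r₁ + r₂) (by linarith)
  obtain ⟨hγ0, hγ1, hγ2⟩ := gnExponent_mem hN hr2 hle
  set γ := gnExponent N (r₁ + r₂)
  rcases hr with h | ⟨h, hlt⟩
  · have hθ1 : (r₁ + r₂) * γ / 2 < 1 := by
      have h1 : r₁ + r₂ - 2 < 8 / N := by linarith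
      rw [lt_div_iff₀ hNR] at h1
      rw [hmg]; linarith
    obtain ⟨C, hC⟩ := exists_mul_rpow_le (K := β * (D * (ρ ^ 2) ^ ((r₁ + r₂) * (1 - γ) / 2)))
      (by positivity) (by positivity : 0 < (r₁ + r₂) * γ / 2) hθ1
    refine ⟨1 / 4, C, by norm_num, fun u v hS => ?_⟩
    obtain ⟨hu, hv, hm⟩ := hS
    have h1 := coupling_le hN hr₁ hr₂ hle hu hv
    simp only at hm
    rw [hm] at h1
    refine (mul_le_mul_of_nonneg_left h1 hβ.le).trans (le_of_eq_of_le ?_ (hC _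
      (add_nonneg (l2sq_nonneg _) (l2sq_nonneg _))))
    ring
  -- If 𝒟₁ were 0, division by zero would make the threshold 0, against 0 < ρ < threshold.
  · have hD0 : 0 < D := by
      rcases hD.eq_or_lt with h0 | h0
      · exfalso
        rw [← h0] at hlt
        rw [mul_zero, zero_mul, div_zero, Real.zero_rpow (by positivity)] at hlt
        linarith
      · exact h0
    have hθ1 : (r₁ + r₂) * γ / 2 = 1 := by
      rw [hmg, h]; field_simp; norm_num
    have he : (r₁ + r₂) * (1 - γ) / 2 = 4 / N := by
      have : (r₁ + r₂) * γ = 2 := by linarith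
      rw [mul_sub, this, h]; ring
    have hρD : ρ ^ (8 / (N : ℝ)) < 1 / (2 * D * β) := by
      have h1 := Real.rpow_lt_rpow hρ.le hlt (by positivity : 0 < 8 / (N : ℝ))
      rwa [← Real.rpow_mul (by positivity), div_mul_div_comm, mul_comm (N : ℝ) 8,
        div_self (by positivity), Real.rpow_one] at h1
    refine ⟨β * D * ρ ^ (8 / (N : ℝ)), 0, ?_, fun u v hS => ?_⟩
    · rw [lt_div_iff₀ (by positivity)] at hρD
      linarith
    · obtain ⟨hu, hv, hm⟩ := hS
      have h1 := coupling_le hN hr₁ hr₂ hle hu hv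
      simp only at hm
      rw [hm, hθ1, he, Real.rpow_one, ← Real.rpow_natCast, ← Real.rpow_mul hρ.le] at h1
      have e : ((2 : ℕ) : ℝ) * (4 / N) = 8 / N := by push_cast; ring
      rw [e] at h1
      refine (mul_le_mul_of_nonneg_left h1 hβ.le).trans (le_of_eq ?_)
      ring

theorem sqrt_mul_sqrt_le_of_mass {a b c d ρ : ℝ} (hb : 0 ≤ b) (hd : 0 ≤ d)
    (hρ : 0 ≤ ρ) (h : a + b = ρ ^ 2) :
    Real.sqrt a * Real.sqrt c ≤ ρ * Real.sqrt (c + d) := by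
  have h1 : Real.sqrt a ≤ ρ := by
    rw [Real.sqrt_le_left hρ]; linarith
  have h2 : Real.sqrt c ≤ Real.sqrt (c + d) := Real.sqrt_le_sqrt (by linarith)
  exact mul_le_mul h1 h2 (Real.sqrt_nonneg _) hρ

/-- Coercivity of the energy on the mass constraint. -/
theorem exists_coercive {α₁ α₂ β ρ : ℝ} (hN : 1 ≤ N) (hα₁ : 0 < α₁) (hα₂ : 0 < α₂) (hβ : 0 < β)
    (hr₁ : 1 < r₁) (hr₂ : 1 < r₂) (hρ : 0 < ρ)
    (hr : r₁ + r₂ < 2 + 8 / (N : ℝ) ∨ (r₁ + r₂ = 2 + 8 / (N : ℝ) ∧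
      ρ < (1 / (2 * constD1 N r₁ r₂ * β)) ^ ((N : ℝ) / 8))) :
    ∃ d C : ℝ, 0 < d ∧ ∀ u v : RN N → ℝ, (u, v) ∈ massSphere N ρ →
      d * (l2sq (weakLaplacian u) + l2sq (weakLaplacian v)) - C ≤ energy α₁ α₂ β r₁ r₂ u v := by
  obtain ⟨c, C, hc, hC⟩ := exists_coupling_bound hN hβ hr₁ hr₂ hρ hr
  set d := 1 / 2 - c with hd
  have hd0 : 0 < d := by linarith
  set K := (α₁ + α₂) * ρ / 2 with hK
  refine ⟨d / 2, C + K ^ 2 / (2 * d), by linarith, fun u v hS => ?_⟩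
  have hb := hC u v hS
  obtain ⟨hu, hv, hm⟩ := hS
  simp only at hu hv hm
  have hX0 : 0 ≤ l2sq (weakLaplacian u) + l2sq (weakLaplacian v) :=
    add_nonneg (l2sq_nonneg _) (l2sq_nonneg _)
  have g1 := hu.l2sq_weakGradient_le.trans (sqrt_mul_sqrt_le_of_mass (l2sq_nonneg v)
    (l2sq_nonneg (weakLaplacian v)) hρ.le hm)
  have g2 := hv.l2sq_weakGradient_le.trans (sqrt_mul_sqrt_le_of_mass (l2sq_nonneg u)
    (l2sq_nonneg (weakLaplacian u)) hρ.le ((add_comm _ _).trans hm))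
  rw [add_comm (l2sq (weakLaplacian v))] at g2
  rw [energy]
  change _ ≤ _ - _ - _ - β * coupling r₁ r₂ u v
  set X := l2sq (weakLaplacian u) + l2sq (weakLaplacian v)
  have hsq := Real.sq_sqrt hX0
  -- Young's inequality: the gradient terms cost half of the coefficient `d` left over by the
  -- coupling.
  have hY : K * Real.sqrt X ≤ d / 2 * X + K ^ 2 / (2 * d) := by
    have h0 : 0 ≤ (d * Real.sqrt X - K) ^ 2 / (2 * d) := by positivity
    have h1 : (d * Real.sqrt X - K) ^ 2 / (2 * d) =
        d / 2 * Real.sqrt X ^ 2 + K ^ 2 / (2 * d) - K * Real.sqrt X := by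
      field_simp; ring
    rw [h1, hsq] at h0
    linarith
  have g3 : α₁ / 2 * l2sq (weakGradient u) ≤ α₁ / 2 * (ρ * Real.sqrt X) := by gcongr
  have g4 : α₂ / 2 * l2sq (weakGradient v) ≤ α₂ / 2 * (ρ * Real.sqrt X) := by gcongr
  have g5 : α₁ / 2 * (ρ * Real.sqrt X) + α₂ / 2 * (ρ * Real.sqrt X) = K * Real.sqrt X := by
    rw [hK]; ring
  have g6 : c * X = 1 / 2 * X - d * X := by rw [hd]; ring
  linarith

end Coupling

end

/-! ## Splitting along weak limits -/

section

section WeakLimits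

variable {N : ℕ}

theorem l2sq_sub_le {f g : RN N → ℝ} (hf : MemLp f 2) (hg : MemLp g 2) :
    l2sq (fun x => f x - g x) ≤ 2 * l2sq f + 2 * l2sq g := by
  simp only [l2sq]
  rw [← integral_const_mul, ← integral_const_mul,
    ← integral_add ((MemLp.integrable_norm_sq hf).const_mul 2) ((MemLp.integrable_norm_sq hg).const_mul 2)]
  refine integral_mono (MemLp.integrable_norm_sq (hf.sub hg))
    (((MemLp.integrable_norm_sq hf).const_mul 2).add ((MemLp.integrable_norm_sq hg).const_mul 2)) fun x => ?_
  simp only [Real.norm_eq_abs, sq_abs]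
  nlinarith [sq_nonneg (f x + g x)]

theorem WeakTendsto.comp {f : ℕ → RN N → ℝ} {g : RN N → ℝ} (h : WeakTendsto f g) {φ : ℕ → ℕ}
    (hφ : StrictMono φ) : WeakTendsto (fun n => f (φ n)) g :=
  fun k hk => (h k hk).comp hφ.tendsto_atTop

/-- Products of weakly convergent sequences, up to the product of the remainders. -/
theorem WeakTendsto.tendsto_integral_mul_sub {w w' : ℕ → RN N → ℝ} {g g' : RN N → ℝ}
    (hw : ∀ n, MemLp (w n) 2) (hw' : ∀ n, MemLp (w' n) 2) (hg : MemLp g 2) (hg' : MemLp g' 2)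
    (h : WeakTendsto w 0) (h' : WeakTendsto w' 0) :
    Tendsto (fun n => (∫ x, (w n x + g x) * (w' n x + g' x)) - ∫ x, w n x * w' n x) atTop
      (𝓝 (∫ x, g x * g' x)) := by
  have h1 := h g' hg'
  have h2 := h' g hg
  simp only [Pi.zero_apply, zero_mul, integral_zero] at h1 h2
  have h3 := (h1.add h2).add (tendsto_const_nhds (x := ∫ x, g x * g' x))
  rw [add_zero, zero_add] at h3
  refine h3.congr fun n => ?_
  have e := integral_add_mul_mul (hw n) (hw' n) hg hg' 1
  simp only [one_mul, one_pow] at e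
  rw [e]
  have : ∫ x, w' n x * g x = ∫ x, g x * w' n x := integral_congr_ae
    (Eventually.of_forall fun x => mul_comm _ _)
  linarith

/-- Weak convergence in `H²` together with convergence almost everywhere. -/
structure H2WeakTendsto (a : ℕ → RN N → ℝ) (U : RN N → ℝ) : Prop where
  memH2 : ∀ n, MemH2 (a n)
  memH2_limit : MemH2 U
  weak : WeakTendsto (fun n x => a n x - U x) 0
  weak_laplacian : WeakTendsto (fun n => weakLaplacian fun x => a n x - U x) 0
  ae_tendsto : ∀ᵐ x, Tendsto (fun n => a n x - U x) atTop (𝓝 0)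
  bounded : ∃ C, ∀ n, l2sq (fun x => a n x - U x) ≤ C ∧
    l2sq (weakLaplacian fun x => a n x - U x) ≤ C

theorem H2WeakTendsto.comp {a : ℕ → RN N → ℝ} {U : RN N → ℝ} (h : H2WeakTendsto a U)
    {φ : ℕ → ℕ} (hφ : StrictMono φ) : H2WeakTendsto (fun n => a (φ n)) U where
  memH2 n := h.memH2 (φ n)
  memH2_limit := h.memH2_limit
  weak := h.weak.comp hφ
  weak_laplacian := h.weak_laplacian.comp hφ
  ae_tendsto := h.ae_tendsto.mono fun _ hx => hx.comp hφ.tendsto_atTop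
  bounded := h.bounded.imp fun _ hC n => hC (φ n)

/-- After the weak limits are found, everything is stated for the remainders, which tend weakly to
0; a further extraction gives convergence almost everywhere. -/
theorem exists_h2WeakTendsto {a : ℕ → RN N → ℝ} (ha : ∀ n, MemH2 (a n)) {C : ℝ}
    (hC : ∀ n, l2sq (a n) ≤ C) (hC' : ∀ n, l2sq (weakLaplacian (a n)) ≤ C) :
    ∃ (φ : ℕ → ℕ) (U : RN N → ℝ), StrictMono φ ∧ H2WeakTendsto (fun n => a (φ n)) U := by
  obtain ⟨φ, U, hφ, hU, hw, hw'⟩ := exists_weakTendsto_memH2 a ha hC hC'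
  have hs : ∀ n, MemH2 fun x => a (φ n) x - U x := fun n => ((ha (φ n)).sub hU).1
  have hs' : ∀ n, l2sq (weakLaplacian fun x => a (φ n) x - U x) =
      l2sq fun x => weakLaplacian (a (φ n)) x - weakLaplacian U x :=
    fun n => l2sq_congr ((ha (φ n)).sub hU).2
  have hconst : ∀ g : RN N → ℝ, WeakTendsto (fun _ => g) g := fun g k _ => tendsto_const_nhds
  have w1 : WeakTendsto (fun n x => a (φ n) x - U x) 0 := by
    have := hw.sub (fun n => (ha (φ n)).memLp) (fun _ => hU.memLp) hU.memLp hU.memLp (hconst U)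
    simp only [sub_self] at this
    exact this
  have w2 : WeakTendsto (fun n => weakLaplacian fun x => a (φ n) x - U x) 0 := by
    have := hw'.sub (fun n => (ha (φ n)).memLp_weakLaplacian) (fun _ => hU.memLp_weakLaplacian)
      hU.memLp_weakLaplacian hU.memLp_weakLaplacian (hconst (weakLaplacian U))
    simp only [sub_self] at this
    refine fun k hk => (this k hk).congr fun n => integral_congr_ae ?_
    exact ((ha (φ n)).sub hU).2.mono fun x hx => by simp only [hx]
  have hb : ∀ n, l2sq (fun x => a (φ n) x - U x) ≤
      2 * C + 2 * (l2sq U + l2sq (weakLaplacian U)) := fun n => by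
    have := l2sq_sub_le (ha (φ n)).memLp hU.memLp
    linarith [hC (φ n), l2sq_nonneg (weakLaplacian U)]
  have hb' : ∀ n, l2sq (weakLaplacian fun x => a (φ n) x - U x) ≤
      2 * C + 2 * (l2sq U + l2sq (weakLaplacian U)) := fun n => by
    rw [hs' n]
    have := l2sq_sub_le (ha (φ n)).memLp_weakLaplacian hU.memLp_weakLaplacian
    linarith [hC' (φ n), l2sq_nonneg U]
  obtain ⟨ψ, hψ, hae⟩ := w1.exists_ae_tendsto hs hb hb'
  exact ⟨φ ∘ ψ, U, hφ.comp hψ, fun n => ha _, hU, w1.comp hψ, w2.comp hψ, hae, _,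
    fun n => ⟨hb (ψ n), hb' (ψ n)⟩⟩

namespace H2WeakTendsto

variable {a b : ℕ → RN N → ℝ} {U V : RN N → ℝ}

theorem memH2_sub (h : H2WeakTendsto a U) (n : ℕ) : MemH2 fun x => a n x - U x :=
  ((h.memH2 n).sub h.memH2_limit).1

theorem weakLaplacian_ae_eq (h : H2WeakTendsto a U) (n : ℕ) : weakLaplacian (a n) =ᵐ[volume]
    fun x => weakLaplacian (fun x => a n x - U x) x + weakLaplacian U x :=
  ((h.memH2 n).sub h.memH2_limit).2.mono fun x hx => by simp only [hx]; ring

theorem tendsto_l2sq (h : H2WeakTendsto a U) :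
    Tendsto (fun n => l2sq (a n) - l2sq fun x => a n x - U x) atTop (𝓝 (l2sq U)) := by
  have := h.weak.tendsto_integral_mul_sub (fun n => (h.memH2_sub n).memLp)
    (fun n => (h.memH2_sub n).memLp) h.memH2_limit.memLp h.memH2_limit.memLp h.weak
  simp only [sub_add_cancel, ← l2sq_eq_integral_mul_self] at this
  exact this

theorem tendsto_l2sq_weakLaplacian (h : H2WeakTendsto a U) :
    Tendsto (fun n => l2sq (weakLaplacian (a n)) - l2sq (weakLaplacian fun x => a n x - U x))
      atTop (𝓝 (l2sq (weakLaplacian U))) := by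
  have := h.weak_laplacian.tendsto_integral_mul_sub (fun n => (h.memH2_sub n).memLp_weakLaplacian)
    (fun n => (h.memH2_sub n).memLp_weakLaplacian) h.memH2_limit.memLp_weakLaplacian
    h.memH2_limit.memLp_weakLaplacian h.weak_laplacian
  simp only [← l2sq_eq_integral_mul_self] at this
  exact this.congr fun n => by rw [l2sq_congr (h.weakLaplacian_ae_eq n)]

/-- Through Green's formula this is the splitting of the gradient terms. -/
theorem tendsto_integral_mul_weakLaplacian (h : H2WeakTendsto a U) :
    Tendsto (fun n => (∫ x, a n x * weakLaplacian (a n) x) -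
      ∫ x, (a n x - U x) * weakLaplacian (fun x => a n x - U x) x)
      atTop (𝓝 (∫ x, U x * weakLaplacian U x)) := by
  have := h.weak.tendsto_integral_mul_sub (fun n => (h.memH2_sub n).memLp)
    (fun n => (h.memH2_sub n).memLp_weakLaplacian) h.memH2_limit.memLp
    h.memH2_limit.memLp_weakLaplacian h.weak_laplacian
  simp only [sub_add_cancel] at this
  refine this.congr fun n => congrArg₂ _ (integral_congr_ae ?_) rfl
  exact (h.weakLaplacian_ae_eq n).mono fun x hx => by simp only [hx]

theorem exists_integral_abs_rpow_le (h : H2WeakTendsto a U) (hN : 1 ≤ N) {p : ℝ} (hp : 2 < p)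
    (hp' : p ≤ 2 + 8 / (N : ℝ)) : ∃ M, ∀ n, ∫ x, |a n x - U x| ^ p ≤ M := by
  obtain ⟨C, hC⟩ := h.bounded
  obtain ⟨hγ0, hγ1, -⟩ := gnExponent_mem hN hp hp'
  refine ⟨gnConst N p ^ p * (Real.sqrt C ^ (p * (1 - gnExponent N p)) *
    Real.sqrt C ^ (p * gnExponent N p)), fun n =>
    (integral_abs_rpow_le hN hp hp' (h.memH2_sub n)).trans ?_⟩
  have h1 := Real.sqrt_le_sqrt (hC n).1
  have h2 := Real.sqrt_le_sqrt (hC n).2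
  have hp0 : 0 ≤ p := by linarith
  have hγ : 0 ≤ 1 - gnExponent N p := by linarith
  have := gnConst_nonneg N p
  exact mul_le_mul_of_nonneg_left (mul_le_mul
    (Real.rpow_le_rpow (Real.sqrt_nonneg _) h1 (by positivity))
    (Real.rpow_le_rpow (Real.sqrt_nonneg _) h2 (by positivity)) (by positivity) (by positivity))
    (by positivity)

/-- Splitting of the coupling integral along weak limits. -/
theorem tendsto_coupling {r₁ r₂ : ℝ} (ha : H2WeakTendsto a U) (hb : H2WeakTendsto b V)
    (hN : 1 ≤ N) (hr₁ : 1 < r₁) (hr₂ : 1 < r₂) (hr : r₁ + r₂ ≤ 2 + 8 / (N : ℝ)) :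
    Tendsto (fun n => coupling r₁ r₂ (a n) (b n) -
      coupling r₁ r₂ (fun x => a n x - U x) (fun x => b n x - V x)) atTop
      (𝓝 (coupling r₁ r₂ U V)) := by
  have hr2 : 2 < r₁ + r₂ := by linarith
  obtain ⟨M, hM⟩ := ha.exists_integral_abs_rpow_le hN hr2 hr
  obtain ⟨M', hM'⟩ := hb.exists_integral_abs_rpow_le hN hr2 hr
  have key := tendsto_integral_coupling_sub (p := r₁) (q := r₂) (by linarith) (by linarith)
    (fun n => (ha.memH2_sub n).memLp.1) (fun n => (hb.memH2_sub n).memLp.1)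
    ha.memH2_limit.memLp.1 hb.memH2_limit.memLp.1
    (fun n => integrable_abs_rpow hN hr2 hr (ha.memH2_sub n))
    (fun n => integrable_abs_rpow hN hr2 hr (hb.memH2_sub n))
    (integrable_abs_rpow hN hr2 hr ha.memH2_limit) (integrable_abs_rpow hN hr2 hr hb.memH2_limit)
    (fun n => by simpa only [sub_add_cancel] using integrable_abs_rpow hN hr2 hr (ha.memH2 n))
    (fun n => by simpa only [sub_add_cancel] using integrable_abs_rpow hN hr2 hr (hb.memH2 n))
    (fun n => (hM n).trans (le_max_left M M')) (fun n => (hM' n).trans (le_max_right M M'))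
    ha.ae_tendsto hb.ae_tendsto
  simp only [sub_add_cancel] at key
  have := key.add_const (coupling r₁ r₂ U V)
  rw [zero_add] at this
  refine this.congr fun n => ?_
  simp only [coupling]
  ring

/-- Splitting of the energy along weak limits. -/
theorem tendsto_energy {α₁ α₂ β r₁ r₂ : ℝ} (ha : H2WeakTendsto a U) (hb : H2WeakTendsto b V)
    (hN : 1 ≤ N) (hr₁ : 1 < r₁) (hr₂ : 1 < r₂) (hr : r₁ + r₂ ≤ 2 + 8 / (N : ℝ)) :
    Tendsto (fun n => energy α₁ α₂ β r₁ r₂ (a n) (b n) -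
      energy α₁ α₂ β r₁ r₂ (fun x => a n x - U x) (fun x => b n x - V x)) atTop
      (𝓝 (energy α₁ α₂ β r₁ r₂ U V)) := by
  rw [energy_eq ha.memH2_limit hb.memH2_limit]
  have h := ((((ha.tendsto_l2sq_weakLaplacian.add hb.tendsto_l2sq_weakLaplacian).const_mul
    (1 / 2)).add (ha.tendsto_integral_mul_weakLaplacian.const_mul (α₁ / 2))).add
    (hb.tendsto_integral_mul_weakLaplacian.const_mul (α₂ / 2))).sub
    ((ha.tendsto_coupling hb hN hr₁ hr₂ hr).const_mul β)
  refine h.congr fun n => ?_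
  rw [energy_eq (ha.memH2 n) (hb.memH2 n), energy_eq (ha.memH2_sub n) (hb.memH2_sub n)]
  ring

/-- Local mass of a weak limit. -/
theorem tendsto_lintegral_ball (h : H2WeakTendsto a U) (r : ℝ) :
    Tendsto (fun n => ∫⁻ x in Metric.ball 0 r, ‖a n x - U x‖ₑ ^ 2) atTop (𝓝 0) := by
  obtain ⟨C, hC⟩ := h.bounded
  exact h.weak.tendsto_lintegral_ball h.memH2_sub (fun n => (hC n).1) (fun n => (hC n).2) r

/-- With a zero limit the remainders would be the sequences themselves, and Rellich's theorem would
drive their mass in the unit ball to 0. -/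
theorem l2sq_ne_zero (ha : H2WeakTendsto a U) (hb : H2WeakTendsto b V) {δ : ℝ≥0∞} (hδ : 0 < δ)
    (h : ∀ n, δ ≤ ∫⁻ x in Metric.ball 0 1, (‖a n x‖ₑ ^ 2 + ‖b n x‖ₑ ^ 2)) :
    l2sq U + l2sq V ≠ 0 := by
  intro h0
  have hU0 : l2sq U = 0 := by linarith [l2sq_nonneg U, l2sq_nonneg V]
  have hV0 : l2sq V = 0 := by linarith [l2sq_nonneg U, l2sq_nonneg V]
  have hU := eq_zero_ae_of_l2sq_eq_zero ha.memH2_limit.memLp hU0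
  have hV := eq_zero_ae_of_l2sq_eq_zero hb.memH2_limit.memLp hV0
  have ht := (ha.tendsto_lintegral_ball 1).add (hb.tendsto_lintegral_ball 1)
  rw [add_zero] at ht
  refine hδ.not_ge (ge_of_tendsto ht (Eventually.of_forall fun n => (h n).trans (le_of_eq ?_)))
  rw [← lintegral_add_left' (((ha.memH2_sub n).memLp.1.enorm.pow_const 2).restrict)]
  refine lintegral_congr_ae (ae_restrict_of_ae ?_)
  filter_upwards [hU, hV] with x hx hx'
  simp [hx, hx']

end H2WeakTendsto

end WeakLimits

end

/-! ## Strict binding -/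

section

section Minimizers

variable {N : ℕ} {α₁ α₂ β r₁ r₂ ρ m : ℝ} {a b : RN N → ℝ}

/-- Testing the minimal energy with a rescaled pair. -/
theorem le_energy_rescaled (hr₁ : 0 < r₁) (hr₂ : 0 < r₂) (hρ : 0 < ρ)
    (hm : ∀ u v, (u, v) ∈ massSphere N ρ → m ≤ energy α₁ α₂ β r₁ r₂ u v)
    (ha : MemH2 a) (hb : MemH2 b) (hτ : 0 < l2sq a + l2sq b) :
    m ≤ (ρ / Real.sqrt (l2sq a + l2sq b)) ^ 2 * energy α₁ α₂ β r₁ r₂ a b -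
      β * ((ρ / Real.sqrt (l2sq a + l2sq b)) ^ (r₁ + r₂) -
        (ρ / Real.sqrt (l2sq a + l2sq b)) ^ 2) * coupling r₁ r₂ a b := by
  rw [← energy_const_mul hr₁ hr₂ ha hb (by positivity)]
  exact hm _ _ (massSphere_const_mul ha hb hτ)

theorem l2sq_weakGradient_eq_zero (ha : MemH2 a) (h : l2sq a = 0) : l2sq (weakGradient a) = 0 := by
  have := ha.l2sq_weakGradient_le
  rw [h, Real.sqrt_zero, zero_mul] at this
  exact le_antisymm this (l2sq_nonneg _)

theorem coupling_eq_zero_of_left (hr₁ : r₁ ≠ 0) (h : a =ᵐ[volume] 0) :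
    coupling r₁ r₂ a b = 0 := by
  rw [coupling, ← integral_zero (RN N) ℝ]
  refine integral_congr_ae (h.mono fun x hx => ?_)
  simp [hx, Real.zero_rpow hr₁]

theorem coupling_eq_zero_of_right (hr₂ : r₂ ≠ 0) (h : b =ᵐ[volume] 0) :
    coupling r₁ r₂ a b = 0 := by
  rw [coupling, ← integral_zero (RN N) ℝ]
  refine integral_congr_ae (h.mono fun x hx => ?_)
  simp [hx, Real.zero_rpow hr₂]

theorem one_lt_mass_ratio {τ : ℝ} (hρ : 0 < ρ) (hτ : 0 < τ) (h : τ < ρ ^ 2) :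
    1 < ρ / Real.sqrt τ := by
  rw [lt_div_iff₀ (Real.sqrt_pos.2 hτ), one_mul, Real.sqrt_lt' hρ]
  exact h

/-- The energy of a pair of smaller mass, or of an uncoupled pair, is at least the proportional
share of the minimal energy. -/
theorem mul_le_energy (hβ : 0 < β) (hr₁ : 1 < r₁) (hr₂ : 1 < r₂) (hρ : 0 < ρ)
    (hm : ∀ u v, (u, v) ∈ massSphere N ρ → m ≤ energy α₁ α₂ β r₁ r₂ u v)
    (ha : MemH2 a) (hb : MemH2 b) (h : l2sq a + l2sq b ≤ ρ ^ 2 ∨ coupling r₁ r₂ a b = 0) :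
    (l2sq a + l2sq b) / ρ ^ 2 * m ≤ energy α₁ α₂ β r₁ r₂ a b := by
  have ha0 := l2sq_nonneg a
  have hb0 := l2sq_nonneg b
  rcases (add_nonneg ha0 hb0).eq_or_lt with h0 | hτ
  · have h1 : l2sq a = 0 := by linarith
    have h2 : l2sq b = 0 := by linarith
    have hc := coupling_eq_zero_of_left (r₁ := r₁) (r₂ := r₂) (b := b) (by linarith)
      (eq_zero_ae_of_l2sq_eq_zero ha.memLp h1)
    rw [coupling] at hc
    rw [← h0, zero_div, zero_mul, energy, hc, l2sq_weakGradient_eq_zero ha h1,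
      l2sq_weakGradient_eq_zero hb h2]
    linarith [l2sq_nonneg (weakLaplacian a), l2sq_nonneg (weakLaplacian b)]
  · have h1 := le_energy_rescaled (by linarith) (by linarith) hρ hm ha hb hτ
    have hc2 : (ρ / Real.sqrt (l2sq a + l2sq b)) ^ 2 = ρ ^ 2 / (l2sq a + l2sq b) := by
      rw [div_pow, Real.sq_sqrt hτ.le]
    -- For a scaling factor at least 1 the superquadratic growth of the coupling has a favourable
    -- sign. Without coupling the energy is exactly quadratic, and any mass is allowed.
    have h2 : 0 ≤ β * ((ρ / Real.sqrt (l2sq a + l2sq b)) ^ (r₁ + r₂) -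
        (ρ / Real.sqrt (l2sq a + l2sq b)) ^ 2) * coupling r₁ r₂ a b := by
      rcases h with h | h
      · have hc : 1 ≤ ρ / Real.sqrt (l2sq a + l2sq b) := by
          rw [one_le_div (Real.sqrt_pos.2 hτ), Real.sqrt_le_left hρ.le]
          exact h
        have h3 := Real.rpow_le_rpow_of_exponent_le hc (by linarith : (2 : ℝ) ≤ r₁ + r₂)
        rw [Real.rpow_two] at h3
        exact mul_nonneg (mul_nonneg hβ.le (by linarith)) (coupling_nonneg _ _ _ _)
      · rw [h, mul_zero]
    rw [hc2] at h1 h2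
    have h3 : m ≤ ρ ^ 2 / (l2sq a + l2sq b) * energy α₁ α₂ β r₁ r₂ a b := by linarith
    have h4 := mul_le_mul_of_nonneg_left h3 (by positivity : 0 ≤ (l2sq a + l2sq b) / ρ ^ 2)
    refine h4.trans (le_of_eq ?_)
    field_simp

/-- A pair of strictly smaller mass whose energy does not exceed its share is uncoupled. -/
theorem coupling_eq_zero_of_energy_le (hβ : 0 < β) (hr₁ : 1 < r₁) (hr₂ : 1 < r₂) (hρ : 0 < ρ)
    (hm : ∀ u v, (u, v) ∈ massSphere N ρ → m ≤ energy α₁ α₂ β r₁ r₂ u v)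
    (ha : MemH2 a) (hb : MemH2 b) (hτ : 0 < l2sq a + l2sq b) (hlt : l2sq a + l2sq b < ρ ^ 2)
    (hE : energy α₁ α₂ β r₁ r₂ a b ≤ (l2sq a + l2sq b) / ρ ^ 2 * m) :
    coupling r₁ r₂ a b = 0 := by
  have h1 := le_energy_rescaled (by linarith) (by linarith) hρ hm ha hb hτ
  have hc := one_lt_mass_ratio hρ hτ hlt
  -- Strictly smaller mass makes the factor exceed 1, so a positive coupling would push the rescaled
  -- energy strictly below `m`.
  have h3 := Real.rpow_lt_rpow_of_exponent_lt hc (by linarith : (2 : ℝ) < r₁ + r₂)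
  rw [Real.rpow_two] at h3
  have h5 : (ρ / Real.sqrt (l2sq a + l2sq b)) ^ 2 * energy α₁ α₂ β r₁ r₂ a b ≤ m := by
    rw [div_pow, Real.sq_sqrt hτ.le]
    refine (mul_le_mul_of_nonneg_left hE (by positivity)).trans (le_of_eq ?_)
    field_simp
  by_contra hne
  have h6 : 0 < coupling r₁ r₂ a b := (coupling_nonneg _ _ _ _).lt_of_ne' hne
  have h7 := mul_pos (mul_pos hβ (sub_pos.2 h3)) h6
  linarith

/-- The coefficient μ = -m/ρ² is chosen so that the excess of the energy over the share is the two
quadratic forms minus the coupling. -/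
theorem energy_add_eq_quadForm (hρ : 0 < ρ) : energy α₁ α₂ β r₁ r₂ a b =
    quadForm α₁ (-m / ρ ^ 2) a + quadForm α₂ (-m / ρ ^ 2) b - β * coupling r₁ r₂ a b +
      (l2sq a + l2sq b) / ρ ^ 2 * m := by
  rw [energy, quadForm, quadForm, coupling]
  field_simp
  ring

theorem quadForm_zero {α μ : ℝ} : quadForm α μ (fun _ : RN N => (0 : ℝ)) = 0 := by
  have h := (memH2_zero (N := N)).const_mul 0
  simp only [mul_zero, zero_mul] at h
  have h0 : l2sq (fun _ : RN N => (0 : ℝ)) = 0 := by simp [l2sq]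
  rw [quadForm, l2sq_congr h.2, h0, l2sq_weakGradient_eq_zero memH2_zero h0]
  ring

/-- Pairs with one zero component have no coupling, so the share inequality holds for them at every
mass. -/
theorem quadForm_nonneg_left (hβ : 0 < β) (hr₁ : 1 < r₁) (hr₂ : 1 < r₂) (hρ : 0 < ρ)
    (hm : ∀ u v, (u, v) ∈ massSphere N ρ → m ≤ energy α₁ α₂ β r₁ r₂ u v) (ha : MemH2 a) :
    0 ≤ quadForm α₁ (-m / ρ ^ 2) a := by
  have hc : coupling r₁ r₂ a (fun _ => 0) = 0 :=
    coupling_eq_zero_of_right (by linarith) (Eventually.of_forall fun _ => rfl)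
  have h := mul_le_energy hβ hr₁ hr₂ hρ hm ha memH2_zero (Or.inr hc)
  rw [energy_add_eq_quadForm (m := m) hρ, hc, quadForm_zero] at h
  linarith

theorem quadForm_nonneg_right (hβ : 0 < β) (hr₁ : 1 < r₁) (hr₂ : 1 < r₂) (hρ : 0 < ρ)
    (hm : ∀ u v, (u, v) ∈ massSphere N ρ → m ≤ energy α₁ α₂ β r₁ r₂ u v) (hb : MemH2 b) :
    0 ≤ quadForm α₂ (-m / ρ ^ 2) b := by
  have hc : coupling r₁ r₂ (fun _ => 0) b = 0 :=
    coupling_eq_zero_of_left (by linarith) (Eventually.of_forall fun _ => rfl)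
  have h := mul_le_energy hβ hr₁ hr₂ hρ hm memH2_zero hb (Or.inr hc)
  rw [energy_add_eq_quadForm (m := m) hρ, hc, quadForm_zero] at h
  linarith

/-- Strict binding: a nonzero pair of strictly smaller mass has more energy than its share. -/
theorem mul_lt_energy (hN : 1 ≤ N) (hβ : 0 < β) (hr₁ : 1 < r₁) (hr₂ : 1 < r₂) (hρ : 0 < ρ)
    (hm : ∀ u v, (u, v) ∈ massSphere N ρ → m ≤ energy α₁ α₂ β r₁ r₂ u v)
    (ha : MemH2 a) (hb : MemH2 b) (hτ : 0 < l2sq a + l2sq b) (hlt : l2sq a + l2sq b < ρ ^ 2) :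
    (l2sq a + l2sq b) / ρ ^ 2 * m < energy α₁ α₂ β r₁ r₂ a b := by
  by_contra hcon
  have hE := not_lt.1 hcon
  have hc := coupling_eq_zero_of_energy_le hβ hr₁ hr₂ hρ hm ha hb hτ hlt hE
  rw [energy_add_eq_quadForm (m := m) hρ, hc] at hE
  have hA : ∀ u : RN N → ℝ, MemH2 u → 0 ≤ quadForm α₁ (-m / ρ ^ 2) u :=
    fun u hu => quadForm_nonneg_left hβ hr₁ hr₂ hρ hm hu
  have hB : ∀ u : RN N → ℝ, MemH2 u → 0 ≤ quadForm α₂ (-m / ρ ^ 2) u :=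
    fun u hu => quadForm_nonneg_right hβ hr₁ hr₂ hρ hm hu
  have hA0 := hA a ha
  have hB0 := hB b hb
  -- Two nonnegative forms with nonpositive sum both vanish, so each component is a null vector and
  -- hence zero.
  have za := eq_zero_ae_of_quadForm_eq_zero hN ha hA (by linarith)
  have zb := eq_zero_ae_of_quadForm_eq_zero hN hb hB (by linarith)
  rw [l2sq_congr za, l2sq_congr zb] at hτ
  simp [l2sq] at hτ

/-- The minimal energy is finite. -/
theorem exists_minEnergy_eq {C : ℝ} (hS : (a, b) ∈ massSphere N ρ)
    (hC : ∀ u v, (u, v) ∈ massSphere N ρ → C ≤ energy α₁ α₂ β r₁ r₂ u v) :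
    ∃ m : ℝ, minEnergy N α₁ α₂ β r₁ r₂ ρ = m ∧
      ∀ u v, (u, v) ∈ massSphere N ρ → m ≤ energy α₁ α₂ β r₁ r₂ u v := by
  have h1 : (C : EReal) ≤ minEnergy N α₁ α₂ β r₁ r₂ ρ :=
    le_iInf₂ fun p hp => EReal.coe_le_coe_iff.2 (hC p.1 p.2 hp)
  have h2 : ∀ u v, (u, v) ∈ massSphere N ρ →
      minEnergy N α₁ α₂ β r₁ r₂ ρ ≤ energy α₁ α₂ β r₁ r₂ u v :=
    fun u v h => iInf₂_le (f := fun (p : (RN N → ℝ) × (RN N → ℝ)) (_ : p ∈ massSphere N ρ) =>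
      (energy α₁ α₂ β r₁ r₂ p.1 p.2 : EReal)) (u, v) h
  have h3 : ((minEnergy N α₁ α₂ β r₁ r₂ ρ).toReal : EReal) = minEnergy N α₁ α₂ β r₁ r₂ ρ :=
    EReal.coe_toReal (ne_top_of_le_ne_top (EReal.coe_ne_top _) (h2 a b hS))
      (ne_bot_of_le_ne_bot (EReal.coe_ne_bot _) h1)
  refine ⟨_, h3.symm, fun u v h => ?_⟩
  rw [← EReal.coe_le_coe_iff, h3]
  exact h2 u v h

end Minimizers

end

/-! ## Compactness of minimizing sequences -/

section

section Compactness

variable {N : ℕ} {α₁ α₂ β r₁ r₂ ρ m : ℝ}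

/-- In `coupling_le` the exponent of the mass is positive because γ < 1, and the Laplacian factor
stays bounded. -/
theorem tendsto_coupling_of_l2sq {a b : ℕ → RN N → ℝ} {C : ℝ} (hN : 1 ≤ N) (hr₁ : 1 < r₁)
    (hr₂ : 1 < r₂) (hr : r₁ + r₂ ≤ 2 + 8 / (N : ℝ)) (ha : ∀ n, MemH2 (a n))
    (hb : ∀ n, MemH2 (b n)) (hC : ∀ n, l2sq (weakLaplacian (a n)) + l2sq (weakLaplacian (b n)) ≤ C)
    (h : Tendsto (fun n => l2sq (a n) + l2sq (b n)) atTop (𝓝 0)) :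
    Tendsto (fun n => coupling r₁ r₂ (a n) (b n)) atTop (𝓝 0) := by
  have hr2 : 2 < r₁ + r₂ := by linarith
  obtain ⟨hγ0, hγ1, -⟩ := gnExponent_mem hN hr2 hr
  have hθ : 0 < (r₁ + r₂) * (1 - gnExponent N (r₁ + r₂)) / 2 := by
    have : 0 < 1 - gnExponent N (r₁ + r₂) := by linarith
    positivity
  have hD := constD1_nonneg (N := N) (by linarith : 0 < r₁) (by linarith : 0 < r₂)
  have ht := ((h.rpow_const (Or.inr hθ.le)).const_mul (constD1 N r₁ r₂)).mul_const
    (C ^ ((r₁ + r₂) * gnExponent N (r₁ + r₂) / 2))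
  rw [Real.zero_rpow hθ.ne', mul_zero, zero_mul] at ht
  refine squeeze_zero (fun n => coupling_nonneg _ _ _ _) (fun n => ?_) ht
  refine (coupling_le hN hr₁ hr₂ hr (ha n) (hb n)).trans ?_
  have h1 : 0 ≤ l2sq (a n) + l2sq (b n) := add_nonneg (l2sq_nonneg _) (l2sq_nonneg _)
  exact mul_le_mul_of_nonneg_left (Real.rpow_le_rpow (add_nonneg (l2sq_nonneg _) (l2sq_nonneg _))
    (hC n) (by positivity)) (by positivity)

theorem tendsto_l2sq_weakGradient {a : ℕ → RN N → ℝ} {C : ℝ} (ha : ∀ n, MemH2 (a n))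
    (hC : ∀ n, l2sq (weakLaplacian (a n)) ≤ C) (h : Tendsto (fun n => l2sq (a n)) atTop (𝓝 0)) :
    Tendsto (fun n => l2sq (weakGradient (a n))) atTop (𝓝 0) := by
  have ht := ((Real.continuous_sqrt.tendsto 0).comp h).mul_const (Real.sqrt C)
  rw [Real.sqrt_zero, zero_mul] at ht
  refine squeeze_zero (fun n => l2sq_nonneg _) (fun n => ?_) ht
  exact (ha n).l2sq_weakGradient_le.trans
    (mul_le_mul_of_nonneg_left (Real.sqrt_le_sqrt (hC n)) (Real.sqrt_nonneg _))

/-- Vanishing energy and mass force convergence to zero in `H²`. -/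
theorem tendsto_h2Norm_of_energy {a b : ℕ → RN N → ℝ} {C : ℝ} (hN : 1 ≤ N) (hr₁ : 1 < r₁)
    (hr₂ : 1 < r₂) (hr : r₁ + r₂ ≤ 2 + 8 / (N : ℝ)) (ha : ∀ n, MemH2 (a n))
    (hb : ∀ n, MemH2 (b n)) (hCa : ∀ n, l2sq (weakLaplacian (a n)) ≤ C)
    (hCb : ∀ n, l2sq (weakLaplacian (b n)) ≤ C)
    (h : Tendsto (fun n => l2sq (a n) + l2sq (b n)) atTop (𝓝 0))
    (hE : Tendsto (fun n => energy α₁ α₂ β r₁ r₂ (a n) (b n)) atTop (𝓝 0)) :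
    Tendsto (fun n => h2Norm (a n)) atTop (𝓝 0) ∧ Tendsto (fun n => h2Norm (b n)) atTop (𝓝 0) := by
  have ha0 : Tendsto (fun n => l2sq (a n)) atTop (𝓝 0) :=
    squeeze_zero (fun n => l2sq_nonneg _) (fun n => le_add_of_nonneg_right (l2sq_nonneg _)) h
  have hb0 : Tendsto (fun n => l2sq (b n)) atTop (𝓝 0) :=
    squeeze_zero (fun n => l2sq_nonneg _) (fun n => le_add_of_nonneg_left (l2sq_nonneg _)) h
  have hc := tendsto_coupling_of_l2sq (C := C + C) hN hr₁ hr₂ hr ha hb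
    (fun n => add_le_add (hCa n) (hCb n)) h
  have hX : Tendsto (fun n => l2sq (weakLaplacian (a n)) + l2sq (weakLaplacian (b n))) atTop
      (𝓝 0) := by
    -- The definition of the energy is solved for the Laplacian terms; all other terms tend to 0.
    have := (((hE.add ((tendsto_l2sq_weakGradient ha hCa ha0).const_mul (α₁ / 2))).add
      ((tendsto_l2sq_weakGradient hb hCb hb0).const_mul (α₂ / 2))).add (hc.const_mul β)).const_mul 2
    simp only [mul_zero, add_zero] at this
    refine this.congr fun n => ?_
    rw [energy, coupling]
    ring
  have hXa : Tendsto (fun n => l2sq (weakLaplacian (a n))) atTop (𝓝 0) :=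
    squeeze_zero (fun n => l2sq_nonneg _) (fun n => le_add_of_nonneg_right (l2sq_nonneg _)) hX
  have hXb : Tendsto (fun n => l2sq (weakLaplacian (b n))) atTop (𝓝 0) :=
    squeeze_zero (fun n => l2sq_nonneg _) (fun n => le_add_of_nonneg_left (l2sq_nonneg _)) hX
  have key := Real.continuous_sqrt.tendsto 0
  rw [Real.sqrt_zero] at key
  have hA := hXa.add ha0
  have hB := hXb.add hb0
  rw [add_zero] at hA hB
  exact ⟨key.comp hA, key.comp hB⟩

/-- A minimizing sequence with a nonzero weak limit converges strongly in `H²` to a minimizer. -/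
theorem H2WeakTendsto.tendsto_of_minimizing {a b : ℕ → RN N → ℝ} {U V : RN N → ℝ}
    (hN : 1 ≤ N) (hβ : 0 < β) (hr₁ : 1 < r₁) (hr₂ : 1 < r₂) (hρ : 0 < ρ)
    (hr : r₁ + r₂ ≤ 2 + 8 / (N : ℝ))
    (hm : ∀ u v, (u, v) ∈ massSphere N ρ → m ≤ energy α₁ α₂ β r₁ r₂ u v)
    (hS : ∀ n, (a n, b n) ∈ massSphere N ρ)
    (hE : Tendsto (fun n => energy α₁ α₂ β r₁ r₂ (a n) (b n)) atTop (𝓝 m))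
    (ha : H2WeakTendsto a U) (hb : H2WeakTendsto b V) (h0 : l2sq U + l2sq V ≠ 0) :
    (U, V) ∈ massSphere N ρ ∧ energy α₁ α₂ β r₁ r₂ U V = m ∧
      Tendsto (fun n => h2Norm fun x => a n x - U x) atTop (𝓝 0) ∧
      Tendsto (fun n => h2Norm fun x => b n x - V x) atTop (𝓝 0) := by
  have hρ2 : 0 < ρ ^ 2 := by positivity
  have hτ0 : 0 < l2sq U + l2sq V :=
    (add_nonneg (l2sq_nonneg _) (l2sq_nonneg _)).lt_of_ne' h0
  have hτ : Tendsto (fun n => l2sq (fun x => a n x - U x) + l2sq fun x => b n x - V x) atTop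
      (𝓝 (ρ ^ 2 - (l2sq U + l2sq V))) := by
    refine ((ha.tendsto_l2sq.add hb.tendsto_l2sq).const_sub (ρ ^ 2)).congr fun n => ?_
    have : l2sq (a n) + l2sq (b n) = ρ ^ 2 := (hS n).2.2
    linarith
  have hEw : Tendsto (fun n => energy α₁ α₂ β r₁ r₂ (fun x => a n x - U x) fun x => b n x - V x)
      atTop (𝓝 (m - energy α₁ α₂ β r₁ r₂ U V)) :=
    (hE.sub (ha.tendsto_energy hb hN hr₁ hr₂ hr)).congr fun n => sub_sub_cancel _ _
  have hle : l2sq U + l2sq V ≤ ρ ^ 2 := by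
    have := ge_of_tendsto' hτ fun n => add_nonneg (l2sq_nonneg _) (l2sq_nonneg _)
    linarith
  have hshare : energy α₁ α₂ β r₁ r₂ U V ≤ (l2sq U + l2sq V) / ρ ^ 2 * m := by
    have h1 : ∀ᶠ n in atTop, (l2sq (fun x => a n x - U x) + l2sq fun x => b n x - V x) / ρ ^ 2 * m ≤
        energy α₁ α₂ β r₁ r₂ (fun x => a n x - U x) fun x => b n x - V x := by
      -- Because the limit has positive mass, the remainders eventually have mass below ρ², as the
      -- share inequality requires.
      filter_upwards [hτ.eventually_lt_const (sub_lt_self _ hτ0)] with n hn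
      exact mul_le_energy hβ hr₁ hr₂ hρ hm (ha.memH2_sub n) (hb.memH2_sub n) (Or.inl hn.le)
    have h2 := le_of_tendsto_of_tendsto ((hτ.div_const (ρ ^ 2)).mul_const m) hEw h1
    rw [sub_div, div_self hρ2.ne', sub_mul, one_mul] at h2
    linarith
  have hmass : l2sq U + l2sq V = ρ ^ 2 := by
    by_contra hne
    exact hshare.not_gt (mul_lt_energy hN hβ hr₁ hr₂ hρ hm ha.memH2_limit hb.memH2_limit hτ0
      (lt_of_le_of_ne hle hne))
  have hUV : (U, V) ∈ massSphere N ρ := ⟨ha.memH2_limit, hb.memH2_limit, hmass⟩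
  have hEm : energy α₁ α₂ β r₁ r₂ U V = m := by
    rw [hmass, div_self hρ2.ne', one_mul] at hshare
    exact le_antisymm hshare (hm _ _ hUV)
  rw [hmass, sub_self] at hτ
  rw [hEm, sub_self] at hEw
  obtain ⟨C, hC⟩ := ha.bounded
  obtain ⟨C', hC'⟩ := hb.bounded
  exact ⟨hUV, hEm, tendsto_h2Norm_of_energy (C := max C C') hN hr₁ hr₂ hr ha.memH2_sub
    hb.memH2_sub (fun n => (hC n).2.trans (le_max_left _ _))
    (fun n => (hC' n).2.trans (le_max_right _ _)) hτ hEw⟩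

/-- Compactness of minimizing sequences that keep some mass in the unit ball. -/
theorem exists_minimizer_of_le_lintegral_ball {a b : ℕ → RN N → ℝ} (hN : 1 ≤ N) (hβ : 0 < β)
    (hr₁ : 1 < r₁) (hr₂ : 1 < r₂) (hρ : 0 < ρ) (hr : r₁ + r₂ ≤ 2 + 8 / (N : ℝ)) {d C : ℝ}
    (hd : 0 < d) (hcoe : ∀ u v : RN N → ℝ, (u, v) ∈ massSphere N ρ →
      d * (l2sq (weakLaplacian u) + l2sq (weakLaplacian v)) - C ≤ energy α₁ α₂ β r₁ r₂ u v)
    (hm : ∀ u v, (u, v) ∈ massSphere N ρ → m ≤ energy α₁ α₂ β r₁ r₂ u v)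
    (hS : ∀ n, (a n, b n) ∈ massSphere N ρ)
    (hE : Tendsto (fun n => energy α₁ α₂ β r₁ r₂ (a n) (b n)) atTop (𝓝 m))
    {δ : ℝ≥0∞} (hδ : 0 < δ)
    (hball : ∀ n, δ ≤ ∫⁻ x in Metric.ball 0 1, (‖a n x‖ₑ ^ 2 + ‖b n x‖ₑ ^ 2)) :
    ∃ (φ : ℕ → ℕ) (U V : RN N → ℝ), StrictMono φ ∧ (U, V) ∈ massSphere N ρ ∧
      energy α₁ α₂ β r₁ r₂ U V = m ∧
      Tendsto (fun n => h2Norm fun x => a (φ n) x - U x) atTop (𝓝 0) ∧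
      Tendsto (fun n => h2Norm fun x => b (φ n) x - V x) atTop (𝓝 0) := by
  obtain ⟨M, hM⟩ := hE.bddAbove_range
  have hM' : ∀ n, energy α₁ α₂ β r₁ r₂ (a n) (b n) ≤ M := fun n => hM ⟨n, rfl⟩
  have hX : ∀ n, l2sq (weakLaplacian (a n)) + l2sq (weakLaplacian (b n)) ≤ (M + C) / d := fun n => by
    rw [le_div_iff₀ hd]
    linarith [hcoe _ _ (hS n), hM' n]
  have hX0 : 0 ≤ (M + C) / d :=
    (add_nonneg (l2sq_nonneg _) (l2sq_nonneg _)).trans (hX 0)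
  have hmass : ∀ n, l2sq (a n) + l2sq (b n) = ρ ^ 2 := fun n => (hS n).2.2
  obtain ⟨φ, U, hφ, hU⟩ := exists_h2WeakTendsto (C := ρ ^ 2 + (M + C) / d) (fun n => (hS n).1)
    (fun n => by linarith [hmass n, l2sq_nonneg (b n)])
    (fun n => by nlinarith [hX n, l2sq_nonneg (weakLaplacian (b n))])
  obtain ⟨ψ, V, hψ, hV⟩ := exists_h2WeakTendsto (a := fun n => b (φ n)) (C := ρ ^ 2 + (M + C) / d)
    (fun n => (hS (φ n)).2.1)
    (fun n => by linarith [hmass (φ n), l2sq_nonneg (a (φ n))])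
    (fun n => by nlinarith [hX (φ n), l2sq_nonneg (weakLaplacian (a (φ n)))])
  have hU' := hU.comp hψ
  have hφψ := hφ.comp hψ
  obtain ⟨h1, h2, h3, h4⟩ := hU'.tendsto_of_minimizing hN hβ hr₁ hr₂ hρ hr hm
    (fun n => hS (φ (ψ n))) (hE.comp hφψ.tendsto_atTop) hV
    (hU'.l2sq_ne_zero hV hδ fun n => hball (φ (ψ n)))
  exact ⟨φ ∘ ψ, U, V, hφψ, h1, h2, h3, h4⟩

/-- A sequence that does not vanish keeps some mass in moving unit balls. -/
theorem exists_subseq_le_lintegral_ball {f : ℕ → RN N → ℝ≥0∞}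
    (h : limsup (fun n => ⨆ y : RN N, ∫⁻ x in Metric.ball y 1, f n x) atTop ≠ 0) :
    ∃ (δ : ℝ≥0∞) (ψ : ℕ → ℕ) (y : ℕ → RN N), 0 < δ ∧ StrictMono ψ ∧
      ∀ k, δ ≤ ∫⁻ x in Metric.ball 0 1, f (ψ k) (x - y k) := by
  obtain ⟨δ, hδ, hlt⟩ := exists_between (pos_iff_ne_zero.2 h)
  obtain ⟨ψ, hψ, hk⟩ := extraction_of_frequently_atTop (frequently_lt_of_lt_limsup (by isBoundedDefault) hlt)
  choose c hc using fun k => lt_iSup_iff.1 (hk k)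
  -- Translating by the negative of a near-optimal centre brings its ball to the origin.
  refine ⟨δ, ψ, fun k => -c k, hδ, hψ, fun k => (hc k).le.trans (le_of_eq ?_)⟩
  rw [← lintegral_indicator Metric.isOpen_ball.measurableSet,
    ← lintegral_indicator Metric.isOpen_ball.measurableSet,
    ← lintegral_add_right_eq_self _ (c k)]
  refine lintegral_congr fun x => ?_
  simp only [Set.indicator, Metric.mem_ball, sub_neg_eq_add, dist_eq_norm, add_sub_cancel_right,
    sub_zero]

end Compactness

end

end MixedDispersion

end

/-! ### The dichotomy -/

theorem theorem3p1 (N : ℕ) (hN : 1 ≤ N) (α₁ α₂ β r₁ r₂ ρ : ℝ)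
    (hα₁ : 0 < α₁) (hα₂ : 0 < α₂) (hβ : 0 < β) (hr₁ : 1 < r₁) (hr₂ : 1 < r₂) (hρ : 0 < ρ)
    (hr : r₁ + r₂ < 2 + 8 / (N : ℝ) ∨
      (r₁ + r₂ = 2 + 8 / (N : ℝ) ∧ ρ < (1 / (2 * constD1 N r₁ r₂ * β)) ^ ((N : ℝ) / 8)))
    (u v : ℕ → RN N → ℝ)
    (hS : ∀ n, (u n, v n) ∈ massSphere N ρ)
    (hmin : Tendsto (fun n => (energy α₁ α₂ β r₁ r₂ (u n) (v n) : EReal)) atTop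
      (𝓝 (minEnergy N α₁ α₂ β r₁ r₂ ρ))) :
    limsup (fun n => ⨆ y : RN N, ∫⁻ x in Metric.ball y 1, (‖u n x‖ₑ ^ 2 + ‖v n x‖ₑ ^ 2)) atTop = 0
    ∨
    ∃ (φ : ℕ → ℕ) (U V : RN N → ℝ) (y : ℕ → RN N), StrictMono φ ∧ (U, V) ∈ massSphere N ρ ∧
      Tendsto (fun k => h2Norm (fun x => u (φ k) (x - y k) - U x)) atTop (𝓝 0) ∧
      Tendsto (fun k => h2Norm (fun x => v (φ k) (x - y k) - V x)) atTop (𝓝 0) ∧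
      (energy α₁ α₂ β r₁ r₂ U V : EReal) = minEnergy N α₁ α₂ β r₁ r₂ ρ := by
  rw [or_iff_not_imp_left]
  intro hvan
  have hle : r₁ + r₂ ≤ 2 + 8 / (N : ℝ) := hr.elim le_of_lt fun h => h.1.le
  obtain ⟨d, C, hd, hcoe⟩ := exists_coercive hN hα₁ hα₂ hβ hr₁ hr₂ hρ hr
  -- Coercivity without its nonnegative Laplacian term is a lower bound, so the infimum is a real
  -- number and the convergence can be read in ℝ.
  obtain ⟨m, hmE, hm⟩ := exists_minEnergy_eq (C := -C) (hS 0) fun a b hab => by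
    have h1 := hcoe a b hab
    have h2 := mul_nonneg hd.le
      (add_nonneg (l2sq_nonneg (weakLaplacian a)) (l2sq_nonneg (weakLaplacian b)))
    linarith
  rw [hmE, EReal.tendsto_coe] at hmin
  obtain ⟨δ, ψ, y, hδ, hψ, hball⟩ := exists_subseq_le_lintegral_ball hvan
  obtain ⟨φ, U, V, hφ, hUV, hE, h1, h2⟩ := exists_minimizer_of_le_lintegral_ball
    (a := fun k x => u (ψ k) (x - y k)) (b := fun k x => v (ψ k) (x - y k)) hN hβ hr₁ hr₂ hρ hle
    hd hcoe hm (fun k => massSphere_translate (hS (ψ k)) (y k))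
    ((hmin.comp hψ.tendsto_atTop).congr fun k =>
      (energy_translate (hS (ψ k)).1 (hS (ψ k)).2.1 (y k)).symm) hδ hball
  exact ⟨ψ ∘ φ, U, V, y ∘ φ, hψ.comp hφ, hUV, h1, h2, by rw [hE, hmE]⟩
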